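/- **Theorem 5.1.** Let $n_1,n_2\in(0,\infty)$. Let $(\mathcal X,d_{\mathcal X},\mu_{\mathcal X})$ and $(\mathcal Y,d_{\mathcal Y},\mu_{\mathcal Y})$ be metric measure spaces (Borel measures, all balls of positive finite measure) that are Ahlfors $n_1$- and $n_2$-regular, respectively; here $(\mathcal X,d,\mu)$ is Ahlfors $n$-regular if there are constants $0<C_1\le 1\le C_2$ with $C_1\lambda^n\mu(B(x,r))\le\mu(B(x,\lambda r))\le C_2\lambda^n\mu(B(x,r))$ for all $x$, $0<r<2\,\mathrm{diam}\,\mathcal X$ and $1\le\lambda<2\,\mathrm{diam}\,\mathcal X/r$. Let $f$ be a quasisymmetric homeomorphism from $\mathcal X$ onto $\mathcal Y$, that is, $\frac{d_{\mathcal Y}(f(x),f(a))}{d_{\mathcal Y}(f(x),f(b))}\le\eta\left(\frac{d_{\mathcal X}(x,a)}{d_{\mathcal X}(x,b)}\right)$ for all $a,b,x\in\mathcal X$ with $x\ne b$, for some homeomorphism $\eta:[0,\infty)\to[0,\infty)$. Let $s_i\in(0,n_i)$, $i=1,2$, with $p:=n_1/s_1=n_2/s_2$. For a (real- or complex-valued)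 measurable function $u$, the space $\dot M^{s}_{p,p}(\mathcal X)$ is given by the finiteness of $\|u\|_{\dot M^s_{p,p}(\mathcal X)}=\inf_{(g_k)}\left(\int_{\mathcal X}\sum_{k\in\mathbb Z}g_k^p\,d\mu\right)^{1/p}$, where the infimum is over all sequences $(g_k)_{k\in\mathbb Z}$ of nonnegative measurable functions such that, off a null set, $|u(x)-u(y)|\le d(x,y)^s[g_k(x)+g_k(y)]$ whenever $2^{-k-1}\le d(x,y)<2^{-k}$. The Bourdon–Pajot Besov space $\dot{\mathcal B}^s_p(\mathcal X)$ consists of all $u\in L^p_{\mathrm{loc}}(\mathcal X)$ ($p$-integrable on balls) with $\|u\|_{\dot{\mathcal B}^s_p(\mathcal X)}=\left(\int_{\mathcal X}\int_{\mathcal X}\frac{|u(x)-u(y)|^p}{d(x,y)^{sp}\,\mu(B(x,d(x,y)))}\,d\mu(y)\,d\mu(x)\right)^{1/p}<\infty$. Then $f$ induces an equivalence between $\dot M^{s_1}_{p,p}(\mathcal X)$ and $\dot M^{s_2}_{p,p}(\mathcal Y)$, and likewise between $\dot{\mathcal B}^{s_1}_{p}(\mathcal X)$ and $\dot{\mathcal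 B}^{s_2}_{p}(\mathcal Y)$, in the following sense (stated for either pair of spaces). There is a constant $C$ such that every $u$ in the space on $\mathcal Y$ is integrable on balls, and: the limit $\widetilde u(y)=\lim_{r\to0}\frac1{\mu_{\mathcal Y}(B(y,r))}\int_{B(y,r)}u\,d\mu_{\mathcal Y}$ exists off a set $N_u\subset\mathcal Y$ of Hausdorff dimension zero with $\mu_{\mathcal X}(f^{-1}(N_u))=0$ (put $\widetilde u=0$ on $N_u$); $\widetilde u=u$ almost everywhere; and $\widetilde u\circ f$ belongs to the corresponding space on $\mathcal X$ with $\|\widetilde u\circ f\|\le C\|u\|$. The same holds for $f^{-1}$, with the roles of $\mathcal X$ and $\mathcal Y$ exchanged, and the operators $u\mapsto\widetilde u\circ f$ and $v\mapsto\widetilde v\circ f^{-1}$ are inverse to each other modulo equality almost everywhere. -/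

import Mathlib

open MeasureTheory Set Filter Topology
open scoped ENNReal NNReal

namespace HajlaszBesov

noncomputable section

/-- A metric measure space (a Borel measure on a metric space all of whose balls have positive and
finite measure) which is Ahlfors `n`-regular: for some constants `0 < C₁ ≤ 1 ≤ C₂`,
`C₁ lam ^ n μ(B(x, r)) ≤ μ(B(x, lam r)) ≤ C₂ lam ^ n μ(B(x, r))`
for all `x`, all `0 < r < 2 diam X` and all `1 ≤ lam < 2 diam X / r`.
Every measure on the Borel σ-algebra, extended to all sets as an outer measure as in Mathlib, is
Borel regular. -/
structure IsAhlforsRegular {X : Type*} [MetricSpace X] [MeasurableSpace X] [BorelSpace X]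
    (μ : Measure X) (n : ℝ) : Prop where
  ball_pos : ∀ (x : X) (r : ℝ), 0 < r → 0 < μ (Metric.ball x r)
  ball_lt_top : ∀ (x : X) (r : ℝ), 0 < r → μ (Metric.ball x r) < ∞
  regular : ∃ C₁ C₂ : ℝ, 0 < C₁ ∧ C₁ ≤ 1 ∧ 1 ≤ C₂ ∧
    ∀ (x : X) (r lam : ℝ), 0 < r → ENNReal.ofReal r < 2 * Metric.ediam (univ : Set X) →
      1 ≤ lam → ENNReal.ofReal (lam * r) < 2 * Metric.ediam (univ : Set X) →
      ENNReal.ofReal (C₁ * lam ^ n) * μ (Metric.ball x r) ≤ μ (Metric.ball x (lam * r)) ∧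
      μ (Metric.ball x (lam * r)) ≤ ENNReal.ofReal (C₂ * lam ^ n) * μ (Metric.ball x r)

/-- A homeomorphism `f` is quasisymmetric if there is a homeomorphism `η` of `[0, ∞)` with
`d(f x, f a) / d(f x, f b) ≤ η (d(x, a) / d(x, b))` whenever `x ≠ b`. -/
def IsQuasisymmetric {X Y : Type*} [MetricSpace X] [MetricSpace Y] (f : X ≃ₜ Y) : Prop :=
  ∃ η : ℝ≥0 ≃ₜ ℝ≥0, ∀ a b x : X, x ≠ b →
    nndist (f x) (f a) / nndist (f x) (f b) ≤ η (nndist x a / nndist x b)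

section Spaces

variable {𝕜 X : Type*} [RCLike 𝕜] [MetricSpace X] [MeasurableSpace X]

/-- `g = (g_k)_{k ∈ ℤ}` is a fractional `s`-Hajłasz gradient of `u`. (Functions with values in
`[0, ∞]` are allowed; a sequence of finite mixed norm is finite off a null set.) -/
def IsFracHajlaszGradient (μ : Measure X) (s : ℝ) (u : X → 𝕜) (g : ℤ → X → ℝ≥0∞) : Prop :=
  (∀ k, AEMeasurable (g k) μ) ∧
  ∃ E : Set X, μ E = 0 ∧ ∀ (k : ℤ) (x y : X), x ∉ E → y ∉ E →
    (2 : ℝ) ^ (-k - 1) ≤ dist x y → dist x y < (2 : ℝ) ^ (-k) →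
    ‖u x - u y‖ₑ ≤ edist x y ^ s * (g k x + g k y)

/-- The `ℓ^q` (quasi-)norm of a two-sided sequence, `0 < q ≤ ∞`. -/
def lqNorm (q : ℝ≥0∞) (a : ℤ → ℝ≥0∞) : ℝ≥0∞ :=
  if q = ∞ then ⨆ k, a k else (∑' k, a k ^ q.toReal) ^ (1 / q.toReal)

/-- The (quasi-)norm of `L^p(X, ℓ^q)`, `0 < p < ∞`, `0 < q ≤ ∞`. -/
def LpLqNorm (μ : Measure X) (p : ℝ) (q : ℝ≥0∞) (g : ℤ → X → ℝ≥0∞) : ℝ≥0∞ :=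
  (∫⁻ x, lqNorm q (fun k => g k x) ^ p ∂μ) ^ (1 / p)

/-- The homogeneous Hajłasz–Triebel–Lizorkin (quasi-)seminorm `‖u‖_{Ṁ^s_{p,q}(X)}`. -/
def hajlaszNorm (μ : Measure X) (s p : ℝ) (q : ℝ≥0∞) (u : X → 𝕜) : ℝ≥0∞ :=
  ⨅ (g : ℤ → X → ℝ≥0∞) (_ : IsFracHajlaszGradient μ s u g), LpLqNorm μ p q g

/-- The homogeneous Hajłasz–Triebel–Lizorkin space `Ṁ^s_{p,q}(X)`. -/
def hajlaszSpace (𝕜 : Type*) [RCLike 𝕜] (μ : Measure X) (s p : ℝ) (q : ℝ≥0∞) : Set (X → 𝕜) :=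
  {u | AEMeasurable u μ ∧ hajlaszNorm μ s p q u < ∞}

/-- The seminorm of the Bourdon–Pajot Besov space `𝓑̇^s_p(X)`; the weight `V(x, y)` is
`μ(B(x, d(x, y)))`. -/
def besovNorm (μ : Measure X) (s p : ℝ) (u : X → 𝕜) : ℝ≥0∞ :=
  (∫⁻ x, ∫⁻ y, ‖u x - u y‖ₑ ^ p / (edist x y ^ (s * p) * μ (Metric.ball x (dist x y))) ∂μ ∂μ)
    ^ (1 / p)

/-- The Bourdon–Pajot Besov space `𝓑̇^s_p(X)`: functions that are `p`-integrable on balls and have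
finite seminorm. -/
def besovSpace (𝕜 : Type*) [RCLike 𝕜] (μ : Measure X) (s p : ℝ) : Set (X → 𝕜) :=
  {u | (∀ (x : X) (r : ℝ), MemLp u (ENNReal.ofReal p) (μ.restrict (Metric.ball x r))) ∧
    besovNorm μ s p u < ∞}

/-- The averages of `u` over the balls `B(x, r)` converge to `a` as `r → 0`. -/
def AveragesTendTo (μ : Measure X) (u : X → 𝕜) (x : X) (a : 𝕜) : Prop :=
  Tendsto (fun r : ℝ => ⨍ z in Metric.ball x r, u z ∂μ) (𝓝[>] 0) (𝓝 a)

/-- The set where the averages of `u` over small concentric balls do not converge. -/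
def divergenceSet (μ : Measure X) (u : X → 𝕜) : Set X :=
  {x | ¬ ∃ a, AveragesTendTo μ u x a}

open Classical in
/-- The precise representative of `u`: the limit of the averages of `u` over small balls where it
exists, and `0` elsewhere. -/
def preciseRep (μ : Measure X) (u : X → 𝕜) (x : X) : 𝕜 :=
  if h : ∃ a, AveragesTendTo μ u x a then h.choose else 0

end Spaces

section Equivalence

variable {𝕜 X Y : Type*} [RCLike 𝕜] [MetricSpace X] [MeasurableSpace X]
  [MetricSpace Y] [MeasurableSpace Y]

/-- `u ↦ ũ ∘ f` is a bounded operator from the space `FY` of functions on `Y` with seminorm `NY`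
to the space `FX` of functions on `X` with seminorm `NX`. Here `ũ` is the precise representative of
`u`: the averages of the locally integrable function `u` converge off a set of Hausdorff dimension
zero, whose preimage under `f` is a null set, and `ũ = u` almost everywhere. -/
def PullbackBounded (μX : Measure X) (μY : Measure Y) (f : X ≃ₜ Y)
    (FX : Set (X → 𝕜)) (NX : (X → 𝕜) → ℝ≥0∞) (FY : Set (Y → 𝕜)) (NY : (Y → 𝕜) → ℝ≥0∞) : Prop :=
  ∃ C : ℝ≥0, ∀ u ∈ FY,
    (∀ (y : Y) (r : ℝ), IntegrableOn u (Metric.ball y r) μY) ∧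
    dimH (divergenceSet μY u) = 0 ∧
    μX (f ⁻¹' divergenceSet μY u) = 0 ∧
    preciseRep μY u =ᵐ[μY] u ∧
    preciseRep μY u ∘ f ∈ FX ∧
    NX (preciseRep μY u ∘ f) ≤ C * NY u

/-- `f` induces an equivalence between `FX` and `FY`: `u ↦ ũ ∘ f` and `v ↦ ṽ ∘ f⁻¹` are bounded
operators `FY → FX` and `FX → FY` that are inverse to each other modulo equality almost
everywhere. -/
def InducesEquivalence (μX : Measure X) (μY : Measure Y) (f : X ≃ₜ Y)
    (FX : Set (X → 𝕜)) (NX : (X → 𝕜) → ℝ≥0∞) (FY : Set (Y → 𝕜)) (NY : (Y → 𝕜) → ℝ≥0∞) : Prop :=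
  PullbackBounded μX μY f FX NX FY NY ∧
  PullbackBounded μY μX f.symm FY NY FX NX ∧
  (∀ u ∈ FY, preciseRep μX (preciseRep μY u ∘ f) ∘ f.symm =ᵐ[μY] u) ∧
  (∀ v ∈ FX, preciseRep μY (preciseRep μX v ∘ f.symm) ∘ f =ᵐ[μX] v)

end Equivalence

end

end HajlaszBesov

open HajlaszBesov

/-!
On an Ahlfors `n`-regular space and for `s p = n`, both seminorms are comparable to the energy
`∬ |u(x) - u(y)|ᵖ μ(B(x, d(x, y)))⁻² dμ(y) dμ(x)`, in which the exponent `s` no longer occurs. A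
quasisymmetric `f : X → Y` maps balls to sets that are nearly balls, so this energy on `Y` is
comparable to that of `u ∘ f` on `X` for the pulled back measure `ν = μY ∘ f`, which is doubling
for the metric of `X`. Everything thus reduces to comparing the energies of two doubling measures
`μ` and `ν`, not necessarily mutually absolutely continuous, on one uniformly perfect space. If `u`
has finite `ν`-energy, its mean oscillations over the balls `B(x, q⁻ʲ)` are summable in `j`
off a set of dimension zero, so the `ν`-averages converge there. A telescoping sum bounds the
difference of two limits by the tails of the oscillation series, and since the `μ`- and
`ν`-measures of balls decay geometrically in `j`, integrating against `μ` instead of `ν` costs only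
a constant.
-/

namespace HajlaszBesov

noncomputable section

section Inequalities

lemma inv_le_mul_inv_of_le_mul {a b K : ℝ≥0∞} (hK0 : K ≠ 0) (hK : K ≠ ∞) (h : a ≤ K * b) :
    b⁻¹ ≤ K * a⁻¹ := by
  have hinv : K⁻¹ * b⁻¹ ≤ a⁻¹ := by
    rw [← ENNReal.mul_inv (.inl hK0) (.inl hK)]
    exact ENNReal.inv_le_inv' h
  calc b⁻¹ = K * (K⁻¹ * b⁻¹) := by rw [← mul_assoc, ENNReal.mul_inv_cancel hK0 hK, one_mul]
    _ ≤ K * a⁻¹ := by gcongr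

lemma tsum_mul_rpow_le {ι : Type*} {p : ℝ} (hp : 1 ≤ p) (c a : ι → ℝ≥0∞) :
    (∑' i, c i * a i) ^ p ≤ (∑' i, c i) ^ (p - 1) * ∑' i, c i * a i ^ p := by
  have hp0 : 0 < p := by linarith
  have hfinset (s : Finset ι) : ∑ i ∈ s, c i * a i ≤
      (∑' i, c i) ^ (1 - p⁻¹) * (∑' i, c i * a i ^ p) ^ p⁻¹ := by
    refine (ENNReal.inner_le_weight_mul_Lp_of_nonneg s hp c a).trans ?_
    gcongr
    · exact sub_nonneg.2 (inv_le_one_of_one_le₀ hp)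
    · exact ENNReal.sum_le_tsum s
    · exact ENNReal.sum_le_tsum s
  calc (∑' i, c i * a i) ^ p
      ≤ ((∑' i, c i) ^ (1 - p⁻¹) * (∑' i, c i * a i ^ p) ^ p⁻¹) ^ p := by
        rw [ENNReal.tsum_eq_iSup_sum]
        gcongr
        exact iSup_le hfinset
    _ = _ := by
        rw [ENNReal.mul_rpow_of_nonneg _ _ hp0.le, ENNReal.rpow_inv_rpow hp0.ne',
          ← ENNReal.rpow_mul, sub_mul, one_mul, inv_mul_cancel₀ hp0.ne']

lemma tsum_geometric_ne_top {σ : ℝ≥0∞} (hσ : σ < 1) : ∑' i : ℕ, σ ^ i ≠ ∞ := by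
  rw [ENNReal.tsum_geometric]
  exact ENNReal.inv_ne_top.2 (tsub_pos_of_lt hσ).ne'

lemma exists_tsum_rpow_le {p : ℝ} (hp : 1 ≤ p) {σ : ℝ≥0} (hσ0 : 0 < σ) (hσ : σ < 1) :
    ∃ C : ℝ≥0, ∀ a : ℕ → ℝ≥0∞,
      (∑' i, a i) ^ p ≤ C * ∑' i, ((σ : ℝ≥0∞)⁻¹) ^ i * a i ^ p := by
  have hp0 : 0 < p := by linarith
  -- Jensen's inequality for the weights `τ ^ i` with `τ ^ p = σ`
  obtain ⟨τ, hτ⟩ : ∃ τ : ℝ≥0, τ ^ p = σ := ⟨σ ^ p⁻¹, NNReal.rpow_inv_rpow hp0.ne' σ⟩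
  have hτ0 : τ ≠ 0 := by
    rintro rfl
    exact hσ0.ne' (by rw [← hτ, NNReal.zero_rpow hp0.ne'])
  have hτ1 : τ < 1 := by
    rw [← NNReal.rpow_lt_rpow_iff hp0, hτ, NNReal.one_rpow]
    exact hσ
  have hS : (∑' i : ℕ, (τ : ℝ≥0∞) ^ i) ^ (p - 1) ≠ ∞ :=
    ENNReal.rpow_ne_top_of_nonneg (by linarith) (tsum_geometric_ne_top (by exact_mod_cast hτ1))
  refine ⟨((∑' i : ℕ, (τ : ℝ≥0∞) ^ i) ^ (p - 1)).toNNReal, fun a => ?_⟩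
  rw [ENNReal.coe_toNNReal hS]
  have hcancel (i : ℕ) : (τ : ℝ≥0∞) ^ i * ((τ : ℝ≥0∞)⁻¹ ^ i * a i) = a i := by
    rw [← mul_assoc, ← mul_pow, ENNReal.mul_inv_cancel (by simpa) ENNReal.coe_ne_top, one_pow,
      one_mul]
  have hweight (i : ℕ) : (τ : ℝ≥0∞) ^ i * ((τ : ℝ≥0∞)⁻¹ ^ i * a i) ^ p ≤
      ((σ : ℝ≥0∞)⁻¹) ^ i * a i ^ p := by
    rw [← hτ, ENNReal.coe_rpow_of_nonneg _ hp0.le, ENNReal.mul_rpow_of_nonneg _ _ hp0.le,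
      ← ENNReal.inv_rpow, ← ENNReal.rpow_natCast (_ ^ p) i, ← ENNReal.rpow_mul, mul_comm p,
      ENNReal.rpow_mul, ENNReal.rpow_natCast]
    exact mul_le_of_le_one_left zero_le (pow_le_one₀ zero_le (by exact_mod_cast hτ1.le))
  calc (∑' i, a i) ^ p = (∑' i, (τ : ℝ≥0∞) ^ i * ((τ : ℝ≥0∞)⁻¹ ^ i * a i)) ^ p := by
        simp only [hcancel]
    _ ≤ (∑' i : ℕ, (τ : ℝ≥0∞) ^ i) ^ (p - 1) *
          ∑' i, (τ : ℝ≥0∞) ^ i * ((τ : ℝ≥0∞)⁻¹ ^ i * a i) ^ p := tsum_mul_rpow_le hp _ _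
    _ ≤ _ := mul_le_mul_right (ENNReal.tsum_le_tsum hweight) _

lemma tsum_int_eq_tsum_nat {f : ℤ → ℝ≥0∞} (m : ℤ) (hf : ∀ j, m < j → f j = 0) :
    ∑' j, f j = ∑' i : ℕ, f (m - i) := by
  have hinj : Function.Injective (fun i : ℕ => m - (i : ℤ)) := fun a b hab => by
    simp only at hab; omega
  refine (hinj.tsum_eq fun j hj => ?_).symm
  have : j ≤ m := not_lt.1 fun h => hj (hf j h)
  exact ⟨(m - j).toNat, by simp only; omega⟩

lemma enorm_sub_rpow_le {E : Type*} [SeminormedAddCommGroup E] {p : ℝ} (hp : 1 ≤ p) (a b c : E) :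
    ‖a - b‖ₑ ^ p ≤ 2 ^ (p - 1) * (‖a - c‖ₑ ^ p + ‖b - c‖ₑ ^ p) := by
  have htriangle : ‖a - b‖ₑ ≤ ‖a - c‖ₑ + ‖b - c‖ₑ := by
    rw [← sub_sub_sub_cancel_right a b c]
    exact enorm_sub_le
  exact (ENNReal.rpow_le_rpow htriangle (by linarith)).trans
    (ENNReal.rpow_add_le_mul_rpow_add_rpow _ _ hp)

end Inequalities

section Averages

variable {Ω E : Type*} [MeasurableSpace Ω] [NormedAddCommGroup E] {p : ℝ}
  {ν : Measure Ω} {w : Ω → E} {S T B : Set Ω}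

/-- The mean `p`-oscillation of `w` over `B`: the average of `|w x - w y| ^ p` over `B × B`. -/
def meanOscillation (ν : Measure Ω) (p : ℝ) (w : Ω → E) (B : Set Ω) : ℝ≥0∞ :=
  (ν B)⁻¹ ^ 2 * ∫⁻ x in B, ∫⁻ y in B, ‖w x - w y‖ₑ ^ p ∂ν ∂ν

lemma meanOscillation_le {K : ℝ≥0∞} (hK0 : K ≠ 0) (hK : K ≠ ∞) (hSB : S ⊆ B)
    (hS : ν B ≤ K * ν S) :
    meanOscillation ν p w S ≤ K ^ 2 * meanOscillation ν p w B := by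
  rw [meanOscillation, meanOscillation, ← mul_assoc, ← mul_pow]
  gcongr
  exact inv_le_mul_inv_of_le_mul hK0 hK hS

lemma isProbabilityMeasure_inv_smul_restrict (h0 : ν S ≠ 0) (ht : ν S ≠ ∞) :
    IsProbabilityMeasure ((ν S)⁻¹ • ν.restrict S) :=
  ⟨by simp [ENNReal.inv_mul_cancel h0 ht]⟩

lemma integrable_inv_smul_restrict (h0 : ν S ≠ 0) (hw : IntegrableOn w S ν) :
    Integrable w ((ν S)⁻¹ • ν.restrict S) :=
  hw.integrable.smul_measure (ENNReal.inv_ne_top.2 h0)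

variable [NormedSpace ℝ E]

lemma enorm_integral_rpow_le (P : Measure Ω) [IsProbabilityMeasure P] (hp : 1 ≤ p) (h : Ω → E) :
    ‖∫ x, h x ∂P‖ₑ ^ p ≤ ∫⁻ x, ‖h x‖ₑ ^ p ∂P := by
  have hp0 : 0 < p := by linarith
  by_cases hh : AEStronglyMeasurable h P
  · have hL1 := eLpNorm'_le_eLpNorm'_of_exponent_le one_pos hp P hh
    simp only [eLpNorm', ENNReal.rpow_one, div_one] at hL1
    refine (ENNReal.rpow_le_rpow ((enorm_integral_le_lintegral_enorm h).trans hL1) hp0.le).trans ?_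
    rw [one_div, ENNReal.rpow_inv_rpow hp0.ne']
  · rw [integral_undef fun hi => hh hi.aestronglyMeasurable, enorm_zero,
      ENNReal.zero_rpow_of_pos hp0]
    exact zero_le

variable [CompleteSpace E]

lemma enorm_integral_sub_const_rpow_le (P : Measure Ω) [IsProbabilityMeasure P] (hp : 1 ≤ p)
    {h : Ω → E} (hh : Integrable h P) (c : E) :
    ‖∫ x, h x ∂P - c‖ₑ ^ p ≤ ∫⁻ x, ‖h x - c‖ₑ ^ p ∂P := by
  have hsub : ∫ x, h x ∂P - c = ∫ x, (h x - c) ∂P := by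
    rw [integral_sub hh (integrable_const c), integral_const, probReal_univ, one_smul]
  rw [hsub]
  exact enorm_integral_rpow_le P hp _

lemma enorm_integral_sub_integral_rpow_le (P Q : Measure Ω) [IsProbabilityMeasure P]
    [IsProbabilityMeasure Q] (hp : 1 ≤ p) {h : Ω → E} (hP : Integrable h P)
    (hQ : Integrable h Q) :
    ‖∫ x, h x ∂P - ∫ x, h x ∂Q‖ₑ ^ p ≤ ∫⁻ x, ∫⁻ y, ‖h x - h y‖ₑ ^ p ∂Q ∂P := by
  refine (enorm_integral_sub_const_rpow_le P hp hP _).trans (lintegral_mono fun x => ?_)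
  simpa only [enorm_sub_rev] using enorm_integral_sub_const_rpow_le Q hp hQ (h x)

lemma enorm_setAverage_sub_const_rpow_le (hp : 1 ≤ p) (h0 : ν S ≠ 0) (ht : ν S ≠ ∞)
    (hw : IntegrableOn w S ν) (c : E) :
    ‖⨍ x in S, w x ∂ν - c‖ₑ ^ p ≤ (ν S)⁻¹ * ∫⁻ x in S, ‖w x - c‖ₑ ^ p ∂ν := by
  have := isProbabilityMeasure_inv_smul_restrict h0 ht
  rw [setAverage_eq']
  refine (enorm_integral_sub_const_rpow_le _ hp (integrable_inv_smul_restrict h0 hw) c).trans_eq ?_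
  rw [lintegral_smul_measure, smul_eq_mul]

lemma enorm_setAverage_sub_setAverage_rpow_le (hp : 1 ≤ p) (hS0 : ν S ≠ 0) (hS : ν S ≠ ∞)
    (hT0 : ν T ≠ 0) (hT : ν T ≠ ∞) (hwS : IntegrableOn w S ν) (hwT : IntegrableOn w T ν) :
    ‖⨍ x in S, w x ∂ν - ⨍ x in T, w x ∂ν‖ₑ ^ p ≤
      (ν S)⁻¹ * ((ν T)⁻¹ * ∫⁻ x in S, ∫⁻ y in T, ‖w x - w y‖ₑ ^ p ∂ν ∂ν) := by
  have := isProbabilityMeasure_inv_smul_restrict hS0 hS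
  have := isProbabilityMeasure_inv_smul_restrict hT0 hT
  rw [setAverage_eq', setAverage_eq']
  refine (enorm_integral_sub_integral_rpow_le _ _ hp (integrable_inv_smul_restrict hS0 hwS)
    (integrable_inv_smul_restrict hT0 hwT)).trans_eq ?_
  simp only [lintegral_smul_measure, smul_eq_mul]
  rw [lintegral_const_mul' _ _ (ENNReal.inv_ne_top.2 hT0)]

lemma enorm_setAverage_sub_setAverage_le (hp : 1 ≤ p) {K : ℝ≥0} (hK1 : 1 ≤ K) (hSB : S ⊆ B)
    (hTB : T ⊆ B) (hB0 : ν B ≠ 0) (hB : ν B ≠ ∞) (hS : ν B ≤ K * ν S) (hT : ν B ≤ K * ν T)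
    (hw : IntegrableOn w B ν) :
    ‖⨍ x in S, w x ∂ν - ⨍ x in T, w x ∂ν‖ₑ ≤ K ^ 2 * meanOscillation ν p w B ^ (1 / p) := by
  have hp0 : 0 < p := by linarith
  have hK0 : (K : ℝ≥0∞) ≠ 0 := by exact_mod_cast (zero_lt_one.trans_le hK1).ne'
  have hS0 : ν S ≠ 0 := fun h => hB0 (by simpa [h] using hS)
  have hT0 : ν T ≠ 0 := fun h => hB0 (by simpa [h] using hT)
  have hpow : ‖⨍ x in S, w x ∂ν - ⨍ x in T, w x ∂ν‖ₑ ^ p ≤ K ^ 2 * meanOscillation ν p w B :=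
    calc _ ≤ (ν S)⁻¹ * ((ν T)⁻¹ * ∫⁻ x in S, ∫⁻ y in T, ‖w x - w y‖ₑ ^ p ∂ν ∂ν) :=
          enorm_setAverage_sub_setAverage_rpow_le hp hS0 (measure_ne_top_of_subset hSB hB) hT0
            (measure_ne_top_of_subset hTB hB) (hw.mono_set hSB) (hw.mono_set hTB)
      _ ≤ (K * (ν B)⁻¹) * ((K * (ν B)⁻¹) *
            ∫⁻ x in B, ∫⁻ y in B, ‖w x - w y‖ₑ ^ p ∂ν ∂ν) := by
          gcongr
          · exact inv_le_mul_inv_of_le_mul hK0 ENNReal.coe_ne_top hS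
          · exact inv_le_mul_inv_of_le_mul hK0 ENNReal.coe_ne_top hT
      _ = _ := by rw [meanOscillation]; ring
  have hroot : ((K : ℝ≥0∞) ^ 2) ^ (1 / p) ≤ K ^ 2 := by
    conv_rhs => rw [← ENNReal.rpow_one (_ ^ 2)]
    exact ENNReal.rpow_le_rpow_of_exponent_le (one_le_pow₀ (by exact_mod_cast hK1))
      ((div_le_one hp0).2 hp)
  calc ‖⨍ x in S, w x ∂ν - ⨍ x in T, w x ∂ν‖ₑ
      ≤ (K ^ 2 * meanOscillation ν p w B) ^ (1 / p) := by
        rwa [one_div, ENNReal.le_rpow_inv_iff hp0]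
    _ ≤ K ^ 2 * meanOscillation ν p w B ^ (1 / p) := by
        rw [ENNReal.mul_rpow_of_nonneg _ _ (by positivity)]
        gcongr

end Averages

section Metric

variable {X : Type*} [MetricSpace X]

lemma exists_isSeparated_isCover (X : Type*) [PseudoEMetricSpace X] (ε : ℝ≥0) :
    ∃ N : Set X, Metric.IsSeparated ε N ∧ Metric.IsCover ε univ N := by
  obtain ⟨N, hN⟩ := zorn_subset {N : Set X | Metric.IsSeparated ε N} fun c hc hchain =>
    ⟨⋃₀ c, (pairwise_sUnion hchain.directedOn).2 fun s hs => hc hs,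
      fun s hs => subset_sUnion_of_mem hs⟩
  exact ⟨N, hN.prop, Metric.IsCover.of_maximal_isSeparated (by simpa using hN)⟩

lemma disjoint_ball_of_isSeparated {N : Set X} {r : ℝ≥0} (hN : Metric.IsSeparated r N) {δ : ℝ}
    (hδ : 2 * δ ≤ r) {a b : X} (ha : a ∈ N) (hb : b ∈ N) (hab : a ≠ b) :
    Disjoint (Metric.ball a δ) (Metric.ball b δ) := by
  have hdist : (r : ℝ) < dist a b := by
    have : (r : ℝ≥0∞) < edist a b := hN ha hb hab
    rwa [edist_nndist, ENNReal.coe_lt_coe, ← NNReal.coe_lt_coe, coe_nndist] at this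
  exact Metric.ball_disjoint_ball (by linarith)

lemma isLocallyFiniteMeasure_of_measure_ball [MeasurableSpace X] (ν : Measure X)
    (fin : ∀ (x : X) (r : ℝ), 0 < r → ν (Metric.ball x r) < ∞) :
    IsLocallyFiniteMeasure ν :=
  ⟨fun x => ⟨Metric.ball x 1, Metric.ball_mem_nhds x one_pos, fin x 1 one_pos⟩⟩

variable [MeasurableSpace X] [BorelSpace X]

lemma countable_of_isSeparated (ν : Measure X)
    (pos : ∀ (x : X) (r : ℝ), 0 < r → 0 < ν (Metric.ball x r))
    (fin : ∀ (x : X) (r : ℝ), 0 < r → ν (Metric.ball x r) < ∞) {N : Set X} {r : ℝ≥0} (hr : 0 < r)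
    (hN : Metric.IsSeparated r N) : N.Countable := by
  rcases isEmpty_or_nonempty X with _ | ⟨⟨o⟩⟩
  · exact N.to_countable
  have hunion : N = ⋃ n : ℕ, N ∩ Metric.ball o n := by
    rw [← inter_iUnion, Metric.iUnion_ball_nat, inter_univ]
  rw [hunion]
  refine countable_iUnion fun n => ?_
  -- disjoint balls of positive measure inside a ball of finite measure
  have hcount := Measure.countable_meas_pos_of_disjoint_of_meas_iUnion_ne_top ν
    (As := fun a : ↥(N ∩ Metric.ball o n) => Metric.ball (a : X) (r / 2))
    (fun _ => measurableSet_ball)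
    (fun a b hab => disjoint_ball_of_isSeparated hN (by linarith) a.2.1 b.2.1
      fun h => hab (Subtype.ext h))
    (by
      refine measure_ne_top_of_subset (iUnion_subset fun a => ?_) (fin o (n + r) (by positivity)).ne
      refine Metric.ball_subset_ball' ?_
      have := Metric.mem_ball.1 a.2.2
      have : (0 : ℝ) < r := hr
      linarith)
  have huniv : {a : ↥(N ∩ Metric.ball o n) | 0 < ν (Metric.ball (a : X) (r / 2))} = univ :=
    eq_univ_of_forall fun a => pos _ _ (by positivity)
  rw [huniv] at hcount
  exact countable_coe_iff.1 (countable_univ_iff.1 hcount)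

lemma secondCountableTopology_of_measure_ball (ν : Measure X)
    (pos : ∀ (x : X) (r : ℝ), 0 < r → 0 < ν (Metric.ball x r))
    (fin : ∀ (x : X) (r : ℝ), 0 < r → ν (Metric.ball x r) < ∞) :
    SecondCountableTopology X := by
  refine Metric.secondCountable_of_almost_dense_set fun ε hε => ?_
  lift ε to ℝ≥0 using hε.le
  obtain ⟨N, hsep, hcover⟩ := exists_isSeparated_isCover X ε
  refine ⟨N, countable_of_isSeparated ν pos fin (by exact_mod_cast hε) hsep, fun x => ?_⟩
  obtain ⟨a, ha, hxa⟩ := hcover (mem_univ x)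
  exact ⟨a, ha, edist_le_coe.1 hxa⟩

end Metric

section HausdorffMeasure

lemma hausdorffMeasure_eq_zero_of_tsum_ne_top {X ι : Type*} [EMetricSpace X] [MeasurableSpace X]
    [BorelSpace X] [Countable ι] {d : ℝ} (hd : 0 < d) {t : ι → Set X}
    (ht : ∑' i, Metric.ediam (t i) ^ d ≠ ∞) {A : Set X}
    (hA : ∀ x ∈ A, ∃ᶠ i in cofinite, x ∈ t i) : μH[d] A = 0 := by
  have htail := ENNReal.tendsto_tsum_compl_atTop_zero ht
  have hzero := htail.ennrpow_const d⁻¹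
  rw [ENNReal.zero_rpow_of_pos (inv_pos.2 hd)] at hzero
  have hcover := Measure.hausdorffMeasure_le_liminf_tsum (l := atTop) d A
    (fun s : Finset ι => (∑' i : {i // i ∉ s}, Metric.ediam (t i) ^ d) ^ d⁻¹) hzero
    (ι := fun s : Finset ι => {i // i ∉ s}) (fun _ i => t i.1)
    (.of_forall fun s i => by
      rw [ENNReal.le_rpow_inv_iff hd]
      exact ENNReal.le_tsum (f := fun i : {i // i ∉ s} => Metric.ediam (t i) ^ d) i)
    (.of_forall fun s x hx => by
      obtain ⟨i, hxi, his⟩ := ((hA x hx).and_eventually s.finite_toSet.compl_mem_cofinite).exists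
      exact mem_iUnion.2 ⟨⟨i, by simpa using his⟩, hxi⟩)
  rw [htail.liminf_eq] at hcover
  exact nonpos_iff_eq_zero.1 hcover

end HausdorffMeasure

section Scale

/-- The radius `q ^ (-j)`. -/
def scale (q : ℝ) (j : ℤ) : ℝ := q ^ (-j)

variable {q : ℝ}

lemma scale_pos (hq : 2 ≤ q) (j : ℤ) : 0 < scale q j := zpow_pos (by linarith) _

lemma scale_sub_one (hq : 2 ≤ q) (j : ℤ) : scale q (j - 1) = q * scale q j := by
  have : q ≠ 0 := by linarith
  rw [scale, scale, neg_sub, sub_eq_add_neg, zpow_add₀ this, zpow_one]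

lemma scale_anti (hq : 2 ≤ q) : Antitone (scale q) := fun _ _ h =>
  zpow_le_zpow_right₀ (by linarith) (by omega)

lemma two_mul_scale_le (hq : 2 ≤ q) (j : ℤ) : 2 * scale q j ≤ scale q (j - 1) := by
  rw [scale_sub_one hq]
  exact mul_le_mul_of_nonneg_right hq (scale_pos hq j).le

lemma exists_scale (hq : 2 ≤ q) {d : ℝ} (hd : 0 < d) :
    ∃ k : ℤ, scale q (k + 1) ≤ d ∧ d < scale q k := by
  obtain ⟨n, hn₁, hn₂⟩ := exists_mem_Ico_zpow hd (show 1 < q by linarith)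
  refine ⟨-n - 1, ?_, ?_⟩
  · simpa [scale] using hn₁
  · simpa [scale, add_comm] using hn₂

lemma scale_natCast (q : ℝ) (n : ℕ) : scale q n = q⁻¹ ^ n := by simp [scale]

lemma tendsto_scale (hq : 2 ≤ q) : Tendsto (fun n : ℕ => scale q n) atTop (𝓝 0) := by
  simp only [scale_natCast]
  exact tendsto_pow_atTop_nhds_zero_of_lt_one (by positivity) (inv_lt_one_of_one_lt₀ (by linarith))

variable {X : Type*} [MetricSpace X]

/-- The ball of radius `q ^ (-j)`. -/
abbrev sball (q : ℝ) (j : ℤ) (x : X) : Set X := Metric.ball x (scale q j)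

lemma sball_subset_of_dist (hq : 2 ≤ q) {j : ℤ} {x y : X} (h : dist y x < scale q j) :
    sball q j y ⊆ sball q (j - 1) x := by
  refine Metric.ball_subset_ball' ?_
  have := two_mul_scale_le hq j
  linarith

lemma sball_anti (hq : 2 ≤ q) {i j : ℤ} (h : i ≤ j) (x : X) : sball q j x ⊆ sball q i x :=
  Metric.ball_subset_ball (scale_anti hq h)

/-- The scale `q ^ (-j)` is at most comparable to the diameter of the space. -/
def Admissible (X : Type*) [MetricSpace X] (q : ℝ) (j : ℤ) : Prop :=
  ∃ y z : X, scale q j ≤ q ^ 2 * dist y z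

lemma Admissible.mono (hq : 2 ≤ q) {i j : ℤ} (hij : i ≤ j) (h : Admissible X q i) :
    Admissible X q j := by
  obtain ⟨y, z, hyz⟩ := h
  exact ⟨y, z, (scale_anti hq hij).trans hyz⟩

lemma exists_admissible [Nontrivial X] (hq : 2 ≤ q) : ∃ J : ℕ, Admissible X q J := by
  obtain ⟨y, z, hyz⟩ := exists_pair_ne X
  have hd : 0 < q ^ 2 * dist y z := mul_pos (by positivity) (dist_pos.2 hyz)
  obtain ⟨J, hJ⟩ := ((tendsto_scale hq).eventually (gt_mem_nhds hd)).exists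
  exact ⟨J, y, z, hJ.le⟩

open Classical in
/-- The indicator of the set of admissible scales. -/
def adm (X : Type*) [MetricSpace X] (q : ℝ) (j : ℤ) : ℝ≥0∞ := if Admissible X q j then 1 else 0

lemma adm_eq_one {j : ℤ} (h : Admissible X q j) : adm X q j = 1 := if_pos h

lemma adm_eq_zero {j : ℤ} (h : ¬ Admissible X q j) : adm X q j = 0 := if_neg h

end Scale

section ScaleRegular

variable {X : Type*} [MetricSpace X] [MeasurableSpace X]

/-- A measure which is doubling and whose values on concentric balls decay geometrically, at the
scales up to the diameter of the space. -/
structure ScaleRegular (q : ℝ) (D θ : ℝ≥0) (ν : Measure X) : Prop where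
  two_le : 2 ≤ q
  one_le : 1 ≤ D
  theta_pos : 0 < θ
  theta_lt : θ < 1
  ball_pos : ∀ (x : X) (r : ℝ), 0 < r → 0 < ν (Metric.ball x r)
  ball_lt_top : ∀ (x : X) (r : ℝ), 0 < r → ν (Metric.ball x r) < ∞
  doubling : ∀ (x : X) (r : ℝ), 0 < r → ν (Metric.ball x (q * r)) ≤ D * ν (Metric.ball x r)
  decay : ∀ (x : X) (j : ℤ) (i : ℕ), Admissible X q j →
    ν (sball q (j + i) x) ≤ D * θ ^ i * ν (sball q j x)

namespace ScaleRegular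

variable {q : ℝ} {D θ : ℝ≥0} {ν : Measure X}

lemma coe_ne_zero (h : ScaleRegular q D θ ν) : (D : ℝ≥0∞) ≠ 0 := by
  exact_mod_cast (zero_lt_one.trans_le h.one_le).ne'

lemma coe_theta_lt_one (h : ScaleRegular q D θ ν) : (θ : ℝ≥0∞) < 1 := by
  exact_mod_cast h.theta_lt

lemma inv_one_sub_theta_ne_top (h : ScaleRegular q D θ ν) : (1 - θ : ℝ≥0∞)⁻¹ ≠ ∞ :=
  ENNReal.inv_ne_top.2 (tsub_pos_of_lt h.coe_theta_lt_one).ne'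

lemma measure_ne_zero (h : ScaleRegular q D θ ν) (j : ℤ) (x : X) : ν (sball q j x) ≠ 0 :=
  (h.ball_pos x _ (scale_pos h.two_le j)).ne'

lemma measure_ne_top (h : ScaleRegular q D θ ν) (j : ℤ) (x : X) : ν (sball q j x) ≠ ∞ :=
  (h.ball_lt_top x _ (scale_pos h.two_le j)).ne

lemma measure_sub_one_le (h : ScaleRegular q D θ ν) (j : ℤ) (x : X) :
    ν (sball q (j - 1) x) ≤ D * ν (sball q j x) := by
  rw [sball, scale_sub_one h.two_le]
  exact h.doubling x _ (scale_pos h.two_le j)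

lemma measure_le_of_dist (h : ScaleRegular q D θ ν) {j : ℤ} {x y : X}
    (hxy : dist x y < scale q j) : ν (sball q j x) ≤ D * ν (sball q j y) :=
  (measure_mono (sball_subset_of_dist h.two_le hxy)).trans (h.measure_sub_one_le j y)

lemma inv_le_of_dist (h : ScaleRegular q D θ ν) {j : ℤ} {x y : X}
    (hxy : dist x y < scale q j) : (ν (sball q j x))⁻¹ ≤ D * (ν (sball q j y))⁻¹ :=
  inv_le_mul_inv_of_le_mul h.coe_ne_zero ENNReal.coe_ne_top
    (h.measure_le_of_dist (by rwa [dist_comm]))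

lemma inv_le_sub_one (h : ScaleRegular q D θ ν) (j : ℤ) (x : X) :
    (ν (sball q j x))⁻¹ ≤ D * (ν (sball q (j - 1) x))⁻¹ :=
  inv_le_mul_inv_of_le_mul h.coe_ne_zero ENNReal.coe_ne_top (h.measure_sub_one_le j x)

lemma inv_decay (h : ScaleRegular q D θ ν) (x : X) (j : ℤ) (i : ℕ) (hj : Admissible X q j) :
    (ν (sball q j x))⁻¹ ≤ D * θ ^ i * (ν (sball q (j + i) x))⁻¹ := by
  refine inv_le_mul_inv_of_le_mul ?_ ?_ (h.decay x j i hj)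
  · exact mul_ne_zero h.coe_ne_zero (pow_ne_zero _ (by exact_mod_cast h.theta_pos.ne'))
  · exact ENNReal.mul_ne_top ENNReal.coe_ne_top (ENNReal.pow_ne_top ENNReal.coe_ne_top)

lemma isLocallyFiniteMeasure (h : ScaleRegular q D θ ν) : IsLocallyFiniteMeasure ν :=
  isLocallyFiniteMeasure_of_measure_ball ν h.ball_lt_top

lemma secondCountableTopology [BorelSpace X] (h : ScaleRegular q D θ ν) :
    SecondCountableTopology X :=
  secondCountableTopology_of_measure_ball ν h.ball_pos h.ball_lt_top

lemma adm_mul_inv_sq_le (h : ScaleRegular q D θ ν) {z : X} {k : ℤ} {d : ℝ} (hd : d < scale q k)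
    (i : ℕ) : adm X q (k + 1 - i) * (ν (sball q (k + 1 - i) z))⁻¹ ^ 2 ≤
      D ^ 4 * (ν (Metric.ball z d))⁻¹ ^ 2 * θ ^ i := by
  by_cases hi : Admissible X q (k + 1 - i)
  swap
  · simp [adm_eq_zero hi]
  have hlast : (ν (sball q (k + 1) z))⁻¹ ≤ D * (ν (Metric.ball z d))⁻¹ := by
    refine (h.inv_le_sub_one (k + 1) z).trans ?_
    rw [add_sub_cancel_right]
    gcongr
    exact Metric.ball_subset_ball hd.le
  calc adm X q (k + 1 - i) * (ν (sball q (k + 1 - i) z))⁻¹ ^ 2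
      ≤ 1 * (D * θ ^ i * (ν (sball q (k + 1) z))⁻¹) ^ 2 := by
        rw [adm_eq_one hi]
        gcongr
        simpa only [sub_add_cancel] using h.inv_decay z _ i hi
    _ ≤ 1 * (D * θ ^ i * (D * (ν (Metric.ball z d))⁻¹)) ^ 2 := by gcongr
    _ = D ^ 4 * (ν (Metric.ball z d))⁻¹ ^ 2 * (θ ^ i * θ ^ i) := by ring
    _ ≤ D ^ 4 * (ν (Metric.ball z d))⁻¹ ^ 2 * (1 * θ ^ i) := by
        gcongr
        exact pow_le_one₀ zero_le h.coe_theta_lt_one.le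
    _ = _ := by rw [one_mul]

lemma tsum_indicator_inv_sq_le (h : ScaleRegular q D θ ν) {z t : X} (hzt : z ≠ t) :
    ∑' j, (sball q (j - 1) z).indicator (fun _ => adm X q j * (ν (sball q j z))⁻¹ ^ 2) t ≤
      D ^ 4 * (1 - θ : ℝ≥0∞)⁻¹ * (ν (Metric.ball z (dist z t)))⁻¹ ^ 2 := by
  obtain ⟨k, hk₁, hk₂⟩ := exists_scale h.two_le (dist_pos.2 hzt)
  have hvanish (j : ℤ) (hj : k + 1 < j) : t ∉ sball q (j - 1) z := by
    rw [Metric.mem_ball', not_lt]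
    exact (scale_anti h.two_le (by omega)).trans hk₁
  rw [tsum_int_eq_tsum_nat (k + 1) fun j hj => indicator_of_notMem (hvanish j hj) _]
  calc _ ≤ ∑' i : ℕ, D ^ 4 * (ν (Metric.ball z (dist z t)))⁻¹ ^ 2 * (θ : ℝ≥0∞) ^ i :=
        ENNReal.tsum_le_tsum fun i =>
          (indicator_le_self' (fun _ _ => zero_le) t).trans (h.adm_mul_inv_sq_le hk₂ i)
    _ = _ := by
        rw [ENNReal.tsum_mul_left, ENNReal.tsum_geometric]
        ring

end ScaleRegular

end ScaleRegular

section Measurability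

lemma measurable_enorm_sub_rpow {E X : Type*} [NormedAddCommGroup E] [MeasurableSpace E]
    [OpensMeasurableSpace E] [MeasurableSub₂ E] [MeasurableSpace X] {w : X → E}
    (hw : Measurable w) (p : ℝ) :
    Measurable (Function.uncurry fun z t : X => ‖w z - w t‖ₑ ^ p) :=
  ((hw.comp measurable_fst).sub (hw.comp measurable_snd)).enorm.pow_const p

variable {X : Type*} [MetricSpace X] [MeasurableSpace X] [BorelSpace X]

lemma setLIntegral_ball_eq_lintegral_indicator {α : Type*} (ν : Measure X) (c : α → X)
    (G : α → X → ℝ≥0∞) (r : ℝ) (a : α) :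
    ∫⁻ z in Metric.ball (c a) r, G a z ∂ν =
      ∫⁻ z, {b : α × X | dist b.2 (c b.1) < r}.indicator (Function.uncurry G) (a, z) ∂ν := by
  rw [← lintegral_indicator measurableSet_ball]
  rfl

variable [SecondCountableTopology X]

lemma measurable_setLIntegral_ball {α : Type*} [MeasurableSpace α] (ν : Measure X) [SFinite ν]
    {c : α → X} (hc : Measurable c) {G : α → X → ℝ≥0∞} (hG : Measurable (Function.uncurry G))
    (r : ℝ) : Measurable fun a => ∫⁻ z in Metric.ball (c a) r, G a z ∂ν := by
  simp only [setLIntegral_ball_eq_lintegral_indicator]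
  have hs : MeasurableSet {b : α × X | dist b.2 (c b.1) < r} :=
    measurableSet_lt (measurable_snd.dist (hc.comp measurable_fst)) measurable_const
  exact (hG.indicator hs).lintegral_prod_right'

lemma measurable_measure_ball (ν : Measure X) [SFinite ν] (r : ℝ) :
    Measurable fun x => ν (Metric.ball x r) := by
  simpa only [setLIntegral_one, id] using
    measurable_setLIntegral_ball ν measurable_id (G := fun _ _ => 1) measurable_const r

lemma lintegral_setLIntegral_ball_swap (μ ν : Measure X) [SFinite μ] [SFinite ν]
    {K : X → X → ℝ≥0∞} (hK : Measurable (Function.uncurry K)) (r : ℝ) :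
    ∫⁻ x, ∫⁻ z in Metric.ball x r, K x z ∂ν ∂μ = ∫⁻ z, ∫⁻ x in Metric.ball z r, K x z ∂μ ∂ν := by
  have hs : MeasurableSet {b : X × X | dist b.2 b.1 < r} :=
    measurableSet_lt (measurable_snd.dist measurable_fst) measurable_const
  calc ∫⁻ x, ∫⁻ z in Metric.ball x r, K x z ∂ν ∂μ
      = ∫⁻ x, ∫⁻ z, {b : X × X | dist b.2 b.1 < r}.indicator (Function.uncurry K) (x, z) ∂ν ∂μ :=
        lintegral_congr fun x => setLIntegral_ball_eq_lintegral_indicator ν id K r x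
    _ = ∫⁻ z, ∫⁻ x, {b : X × X | dist b.2 b.1 < r}.indicator (Function.uncurry K) (x, z) ∂μ ∂ν :=
        lintegral_lintegral_swap (hK.indicator hs).aemeasurable
    _ = _ := lintegral_congr fun z => by
        rw [← lintegral_indicator measurableSet_ball]
        congr with x
        simp only [indicator, mem_ofPred_eq, Metric.mem_ball, dist_comm z x]
        rfl

lemma lintegral_inv_measure_ball_mul_setLIntegral_le {μ : Measure X} {r : ℝ} {D : ℝ≥0∞}
    (pos : ∀ x, μ (Metric.ball x r) ≠ 0) (fin : ∀ x, μ (Metric.ball x r) ≠ ∞)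
    (hD : ∀ x z, dist x z < r → (μ (Metric.ball x r))⁻¹ ≤ D * (μ (Metric.ball z r))⁻¹)
    (ν : Measure X) [SFinite μ] [SFinite ν] {h : X → ℝ≥0∞} (hh : Measurable h) :
    ∫⁻ x, (μ (Metric.ball x r))⁻¹ * ∫⁻ z in Metric.ball x r, h z ∂ν ∂μ ≤ D * ∫⁻ z, h z ∂ν := by
  have hm : Measurable fun x => (μ (Metric.ball x r))⁻¹ := (measurable_measure_ball μ _).inv
  have hinner (z : X) : ∫⁻ x in Metric.ball z r, (μ (Metric.ball x r))⁻¹ * h z ∂μ ≤ D * h z :=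
    calc ∫⁻ x in Metric.ball z r, (μ (Metric.ball x r))⁻¹ * h z ∂μ
        ≤ ∫⁻ _ in Metric.ball z r, D * (μ (Metric.ball z r))⁻¹ * h z ∂μ := by
          refine setLIntegral_mono measurable_const fun x hx => ?_
          gcongr
          exact hD x z hx
      _ = D * h z * ((μ (Metric.ball z r))⁻¹ * μ (Metric.ball z r)) := by
          rw [setLIntegral_const]
          ring
      _ = D * h z := by rw [ENNReal.inv_mul_cancel (pos z) (fin z), mul_one]
  calc ∫⁻ x, (μ (Metric.ball x r))⁻¹ * ∫⁻ z in Metric.ball x r, h z ∂ν ∂μ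
      = ∫⁻ x, ∫⁻ z in Metric.ball x r, (μ (Metric.ball x r))⁻¹ * h z ∂ν ∂μ := by
        simp only [lintegral_const_mul _ hh]
    _ = ∫⁻ z, ∫⁻ x in Metric.ball z r, (μ (Metric.ball x r))⁻¹ * h z ∂μ ∂ν :=
        lintegral_setLIntegral_ball_swap μ ν (K := fun x z => (μ (Metric.ball x r))⁻¹ * h z)
          ((hm.comp measurable_fst).mul (hh.comp measurable_snd)) _
    _ ≤ ∫⁻ z, D * h z ∂ν := lintegral_mono hinner
    _ = _ := lintegral_const_mul _ hh

lemma ScaleRegular.lintegral_inv_mul_setLIntegral_le {q : ℝ} {D θ : ℝ≥0} {μ : Measure X}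
    (hμ : ScaleRegular q D θ μ) (ν : Measure X) [SFinite μ] [SFinite ν] {h : X → ℝ≥0∞}
    (hh : Measurable h) (j : ℤ) :
    ∫⁻ x, (μ (sball q j x))⁻¹ * ∫⁻ z in sball q j x, h z ∂ν ∂μ ≤ D * ∫⁻ z, h z ∂ν :=
  lintegral_inv_measure_ball_mul_setLIntegral_le (hμ.measure_ne_zero j) (hμ.measure_ne_top j)
    (fun _ _ => hμ.inv_le_of_dist) ν hh

end Measurability

section Energies

variable {E X : Type*} [NormedAddCommGroup E] [MetricSpace X] [MeasurableSpace X]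

/-- The Besov energy of critical smoothness: when the smoothness `s` satisfies `s p = n`, Ahlfors
`n`-regularity turns the Besov weight into one that depends on the measure alone. -/
def energy (ν : Measure X) (p : ℝ) (w : X → E) : ℝ≥0∞ :=
  ∫⁻ z, ∫⁻ t, (ν (Metric.ball z (dist z t)))⁻¹ ^ 2 * ‖w z - w t‖ₑ ^ p ∂ν ∂ν

/-- The contribution to the inner integral of the energy of `w` at `z` of the points at distance
comparable to `q ^ (-j)`, enlarged to a full ball. -/
def diffEnergy (ν : Measure X) (q p : ℝ) (w : X → E) (j : ℤ) (z : X) : ℝ≥0∞ :=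
  adm X q j * (ν (sball q j z))⁻¹ ^ 2 * ∫⁻ t in sball q (j - 1) z, ‖w z - w t‖ₑ ^ p ∂ν

/-- The mean `p`-oscillation of `w` over the ball of radius `q ^ (-j)`, cut off at the diameter of
the space. -/
def oscEnergy (ν : Measure X) (q p : ℝ) (w : X → E) (j : ℤ) (x : X) : ℝ≥0∞ :=
  adm X q j * meanOscillation ν p w (sball q j x)

variable [MeasurableSpace E] [OpensMeasurableSpace E] [MeasurableSub₂ E] [BorelSpace X]
  {q p : ℝ} {D θ : ℝ≥0} {μ ν : Measure X} {w : X → E}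

lemma diffEnergy_eq_lintegral_indicator (ν : Measure X) (q p : ℝ) (hw : Measurable w) (j : ℤ)
    (z : X) : diffEnergy ν q p w j z =
      ∫⁻ t, (sball q (j - 1) z).indicator (fun _ => adm X q j * (ν (sball q j z))⁻¹ ^ 2) t *
        ‖w z - w t‖ₑ ^ p ∂ν := by
  have hm : Measurable fun t => ‖w z - w t‖ₑ ^ p :=
    (measurable_enorm_sub_rpow hw p).comp measurable_prodMk_left
  rw [diffEnergy, ← lintegral_const_mul _ hm, ← lintegral_indicator measurableSet_ball]
  exact lintegral_congr fun t => indicator_mul_left _ _ _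

lemma ScaleRegular.tsum_diffEnergy_le (h : ScaleRegular q D θ ν) (hp : 0 < p)
    (hw : Measurable w) (z : X) :
    ∑' j, diffEnergy ν q p w j z ≤ D ^ 4 * (1 - θ : ℝ≥0∞)⁻¹ *
      ∫⁻ t, (ν (Metric.ball z (dist z t)))⁻¹ ^ 2 * ‖w z - w t‖ₑ ^ p ∂ν := by
  have hm (j : ℤ) : AEMeasurable (fun t => (sball q (j - 1) z).indicator
      (fun _ => adm X q j * (ν (sball q j z))⁻¹ ^ 2) t * ‖w z - w t‖ₑ ^ p) ν :=
    ((measurable_const.indicator measurableSet_ball).mul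
      ((measurable_enorm_sub_rpow hw p).comp measurable_prodMk_left)).aemeasurable
  simp only [diffEnergy_eq_lintegral_indicator ν q p hw]
  rw [← lintegral_tsum hm, ← lintegral_const_mul' _ _
    (ENNReal.mul_ne_top (ENNReal.pow_ne_top ENNReal.coe_ne_top) h.inv_one_sub_theta_ne_top)]
  refine lintegral_mono fun t => ?_
  rw [ENNReal.tsum_mul_right]
  rcases eq_or_ne z t with rfl | hzt
  · simp [hp]
  · rw [← mul_assoc]
    gcongr
    exact h.tsum_indicator_inv_sq_le hzt

variable [SecondCountableTopology X]

lemma measurable_diffEnergy (ν : Measure X) [SFinite ν] (q p : ℝ) (hw : Measurable w) (j : ℤ) :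
    Measurable (diffEnergy ν q p w j) :=
  ((measurable_measure_ball ν _).inv.pow_const 2 |>.const_mul _).mul
    (measurable_setLIntegral_ball ν measurable_id (measurable_enorm_sub_rpow hw p) _)

lemma measurable_oscEnergy (ν : Measure X) [SFinite ν] (q p : ℝ) (hw : Measurable w) (j : ℤ) :
    Measurable (oscEnergy ν q p w j) := by
  refine (((measurable_measure_ball ν _).inv.pow_const 2).mul ?_).const_mul _
  refine measurable_setLIntegral_ball ν measurable_id ?_ _
  exact measurable_setLIntegral_ball ν (α := X × X) (c := Prod.fst) measurable_fst
    (G := fun b t => ‖w b.2 - w t‖ₑ ^ p)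
    ((measurable_enorm_sub_rpow hw p).comp
      ((measurable_snd.comp measurable_fst).prodMk measurable_snd)) _

namespace ScaleRegular

lemma tsum_lintegral_diffEnergy_le [SFinite ν] (h : ScaleRegular q D θ ν) (hp : 0 < p)
    (hw : Measurable w) :
    ∑' j, ∫⁻ z, diffEnergy ν q p w j z ∂ν ≤ D ^ 4 * (1 - θ : ℝ≥0∞)⁻¹ * energy ν p w := by
  rw [← lintegral_tsum fun j => (measurable_diffEnergy ν q p hw j).aemeasurable, energy,
    ← lintegral_const_mul' _ _
      (ENNReal.mul_ne_top (ENNReal.pow_ne_top ENNReal.coe_ne_top) h.inv_one_sub_theta_ne_top)]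
  exact lintegral_mono (h.tsum_diffEnergy_le hp hw)

variable [SFinite ν]

lemma oscEnergy_le (h : ScaleRegular q D θ ν) (p : ℝ) (hw : Measurable w) (j : ℤ) (x : X) :
    oscEnergy ν q p w j x ≤ D ^ 2 * ∫⁻ z in sball q j x, diffEnergy ν q p w j z ∂ν := by
  have hG := measurable_enorm_sub_rpow hw p
  rw [oscEnergy, meanOscillation, ← lintegral_const_mul _ (measurable_diffEnergy ν q p hw j),
    ← mul_assoc, ← lintegral_const_mul _ (measurable_setLIntegral_ball ν measurable_const hG _)]
  refine setLIntegral_mono ((measurable_diffEnergy ν q p hw j).const_mul _) fun z hz => ?_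
  rw [Metric.mem_ball'] at hz
  calc adm X q j * (ν (sball q j x))⁻¹ ^ 2 * ∫⁻ t in sball q j x, ‖w z - w t‖ₑ ^ p ∂ν
      ≤ adm X q j * (D * (ν (sball q j z))⁻¹) ^ 2 *
          ∫⁻ t in sball q (j - 1) z, ‖w z - w t‖ₑ ^ p ∂ν := by
        gcongr
        · exact h.inv_le_of_dist hz
        · exact sball_subset_of_dist h.two_le hz
    _ = _ := by
        rw [diffEnergy]
        ring

lemma lintegral_inv_mul_oscEnergy_le [SFinite μ] (hμ : ScaleRegular q D θ μ)
    (hν : ScaleRegular q D θ ν) (p : ℝ) (hw : Measurable w) (j : ℤ) :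
    ∫⁻ x, (μ (sball q j x))⁻¹ * oscEnergy ν q p w j x ∂μ ≤
      D ^ 3 * ∫⁻ z, diffEnergy ν q p w j z ∂ν :=
  calc ∫⁻ x, (μ (sball q j x))⁻¹ * oscEnergy ν q p w j x ∂μ
      ≤ ∫⁻ x, D ^ 2 *
          ((μ (sball q j x))⁻¹ * ∫⁻ z in sball q j x, diffEnergy ν q p w j z ∂ν) ∂μ := by
        refine lintegral_mono fun x => ?_
        rw [mul_left_comm]
        gcongr
        exact hν.oscEnergy_le p hw j x
    _ = D ^ 2 *
          ∫⁻ x, (μ (sball q j x))⁻¹ * ∫⁻ z in sball q j x, diffEnergy ν q p w j z ∂ν ∂μ :=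
        lintegral_const_mul' _ _ (ENNReal.pow_ne_top ENNReal.coe_ne_top)
    _ ≤ D ^ 2 * (D * ∫⁻ z, diffEnergy ν q p w j z ∂ν) := by
        gcongr
        exact hμ.lintegral_inv_mul_setLIntegral_le ν (measurable_diffEnergy ν q p hw j) j
    _ = _ := by ring

lemma tsum_lintegral_oscEnergy_le [SFinite μ] (hμ : ScaleRegular q D θ μ)
    (hν : ScaleRegular q D θ ν) (hp : 0 < p) (hw : Measurable w) :
    ∑' j, ∫⁻ x, (μ (sball q j x))⁻¹ * oscEnergy ν q p w j x ∂μ ≤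
      D ^ 7 * (1 - θ : ℝ≥0∞)⁻¹ * energy ν p w :=
  calc _ ≤ ∑' j, D ^ 3 * ∫⁻ z, diffEnergy ν q p w j z ∂ν :=
        ENNReal.tsum_le_tsum (hμ.lintegral_inv_mul_oscEnergy_le hν p hw)
    _ ≤ D ^ 3 * (D ^ 4 * (1 - θ : ℝ≥0∞)⁻¹ * energy ν p w) := by
        rw [ENNReal.tsum_mul_left]
        gcongr
        exact hν.tsum_lintegral_diffEnergy_le hp hw
    _ = _ := by ring

end ScaleRegular

end Energies

section Tails

variable {E X : Type*} [NormedAddCommGroup E] [MetricSpace X] [MeasurableSpace X]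

/-- The sum of the `p`-th roots of the mean oscillations of `w` over the balls centred at `x` of
radius at most `q ^ (-k)`: up to a constant, it bounds the oscillation of the averages of `w` over
these balls. -/
def tailSum (ν : Measure X) (q p : ℝ) (w : X → E) (k : ℤ) (x : X) : ℝ≥0∞ :=
  ∑' i : ℕ, oscEnergy ν q p w (k + i) x ^ (1 / p)

/-- The `p`-th roots of the mean oscillations of `w` over small balls centred at `x` are
summable. -/
def OscSummable (ν : Measure X) (q p : ℝ) (w : X → E) (x : X) : Prop :=
  ∃ J : ℕ, Admissible X q J ∧ tailSum ν q p w J x ≠ ∞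

/-- The average of `w` over the ball of radius `q ^ (-j)` centred at `x`. -/
def scaleAverage [NormedSpace ℝ E] (ν : Measure X) (q : ℝ) (w : X → E) (j : ℤ) (x : X) : E :=
  ⨍ z in sball q j x, w z ∂ν

variable {q p : ℝ} {D θ : ℝ≥0} {μ ν : Measure X} {w : X → E} {x y : X}

lemma tailSum_anti {k l : ℤ} (hkl : k ≤ l) : tailSum ν q p w l x ≤ tailSum ν q p w k x := by
  obtain ⟨m, rfl⟩ := Int.le.dest hkl
  refine le_trans (le_of_eq ?_) (ENNReal.tsum_comp_le_tsum_of_injective (add_right_injective m) _)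
  simp only [tailSum, Nat.cast_add, add_assoc]

lemma oscEnergy_rpow_le_tailSum (k : ℤ) :
    oscEnergy ν q p w k x ^ (1 / p) ≤ tailSum ν q p w k x := by
  simpa only [tailSum, Nat.cast_zero, add_zero] using
    ENNReal.le_tsum (f := fun i : ℕ => oscEnergy ν q p w (k + i) x ^ (1 / p)) 0

lemma measurable_tailSum [MeasurableSpace E] [OpensMeasurableSpace E] [MeasurableSub₂ E]
    [BorelSpace X] [SecondCountableTopology X] (ν : Measure X) [SFinite ν] (q p : ℝ)
    (hw : Measurable w) (k : ℤ) : Measurable (tailSum ν q p w k) :=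
  Measurable.tsum fun i => (measurable_oscEnergy ν q p hw (k + i)).pow_const _

lemma tendsto_atTop_int_iff {β : Type*} {f : ℤ → β} {l : Filter β} (J : ℕ) :
    Tendsto f atTop l ↔ Tendsto (fun i : ℕ => f (J + i)) atTop l := by
  rw [← Nat.map_cast_int_atTop, tendsto_map'_iff, ← tendsto_add_atTop_iff_nat J]
  simp only [Function.comp_def, Nat.cast_add, add_comm]

lemma OscSummable.tendsto_oscEnergy_rpow (hx : OscSummable ν q p w x) :
    Tendsto (fun j => oscEnergy ν q p w j x ^ (1 / p)) atTop (𝓝 0) := by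
  obtain ⟨J, -, hfin⟩ := hx
  exact (tendsto_atTop_int_iff J).2 (ENNReal.tendsto_atTop_zero_of_tsum_ne_top hfin)

namespace ScaleRegular

section TailEnergy

lemma exists_inv_mul_tailSum_rpow_le (hμ : ScaleRegular q D θ μ) (hp : 1 ≤ p) :
    ∃ C : ℝ≥0, ∀ (w : X → E) (x : X) (k : ℤ), Admissible X q k →
      (μ (sball q k x))⁻¹ * tailSum ν q p w k x ^ p ≤ C * ∑' i : ℕ, (NNReal.sqrt θ : ℝ≥0∞) ^ i *
        ((μ (sball q (k + i) x))⁻¹ * oscEnergy ν q p w (k + i) x) := by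
  have hp0 : 0 < p := by linarith
  have hσ0 : 0 < NNReal.sqrt θ := NNReal.sqrt_pos.2 hμ.theta_pos
  have hσ1 : NNReal.sqrt θ < 1 := by
    rw [← NNReal.sqrt_one]
    exact NNReal.sqrt_lt_sqrt.2 hμ.theta_lt
  have hσσ : (θ : ℝ≥0∞) = NNReal.sqrt θ * NNReal.sqrt θ := by
    rw [← ENNReal.coe_mul, NNReal.mul_self_sqrt]
  obtain ⟨C, hC⟩ := exists_tsum_rpow_le hp hσ0 hσ1
  refine ⟨C * D, fun w x k hk => ?_⟩
  generalize NNReal.sqrt θ = σ at hσ0 hσσ hC ⊢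
  have hσ : (σ : ℝ≥0∞) * (σ : ℝ≥0∞)⁻¹ = 1 :=
    ENNReal.mul_inv_cancel (by exact_mod_cast hσ0.ne') ENNReal.coe_ne_top
  -- half of the decay `θ ^ i` of the measures pays for Jensen's inequality
  have hterm (i : ℕ) : (μ (sball q k x))⁻¹ *
      ((σ : ℝ≥0∞)⁻¹ ^ i * (oscEnergy ν q p w (k + i) x ^ (1 / p)) ^ p) ≤
      D * ((σ : ℝ≥0∞) ^ i * ((μ (sball q (k + i) x))⁻¹ * oscEnergy ν q p w (k + i) x)) := by
    rw [one_div, ENNReal.rpow_inv_rpow hp0.ne']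
    calc (μ (sball q k x))⁻¹ * ((σ : ℝ≥0∞)⁻¹ ^ i * oscEnergy ν q p w (k + i) x)
        ≤ (D * θ ^ i * (μ (sball q (k + i) x))⁻¹) *
            ((σ : ℝ≥0∞)⁻¹ ^ i * oscEnergy ν q p w (k + i) x) := by
          gcongr
          exact hμ.inv_decay x k i hk
      _ = (σ * (σ : ℝ≥0∞)⁻¹) ^ i * (D * ((σ : ℝ≥0∞) ^ i *
            ((μ (sball q (k + i) x))⁻¹ * oscEnergy ν q p w (k + i) x))) := by
          rw [hσσ]
          ring
      _ = _ := by rw [hσ, one_pow, one_mul]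
  calc (μ (sball q k x))⁻¹ * tailSum ν q p w k x ^ p
      ≤ (μ (sball q k x))⁻¹ * (C * ∑' i : ℕ, (σ : ℝ≥0∞)⁻¹ ^ i *
          (oscEnergy ν q p w (k + i) x ^ (1 / p)) ^ p) := by
        gcongr
        exact hC _
    _ = C * ∑' i : ℕ, (μ (sball q k x))⁻¹ * ((σ : ℝ≥0∞)⁻¹ ^ i *
          (oscEnergy ν q p w (k + i) x ^ (1 / p)) ^ p) := by
        rw [mul_left_comm, ENNReal.tsum_mul_left]
    _ ≤ C * ∑' i : ℕ, D * ((σ : ℝ≥0∞) ^ i *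
          ((μ (sball q (k + i) x))⁻¹ * oscEnergy ν q p w (k + i) x)) :=
        mul_le_mul_right (ENNReal.tsum_le_tsum hterm) _
    _ = _ := by rw [ENNReal.tsum_mul_left, ENNReal.coe_mul, mul_assoc]

lemma exists_tsum_tailSum_le (hμ : ScaleRegular q D θ μ) (hp : 1 ≤ p) :
    ∃ C : ℝ≥0, ∀ (w : X → E) (x : X),
      ∑' k, adm X q k * ((μ (sball q k x))⁻¹ * tailSum ν q p w k x ^ p) ≤
        C * ∑' j, (μ (sball q j x))⁻¹ * oscEnergy ν q p w j x := by
  obtain ⟨C, hC⟩ := hμ.exists_inv_mul_tailSum_rpow_le (ν := ν) (E := E) hp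
  set σ := NNReal.sqrt θ
  have hσ : (σ : ℝ≥0∞) < 1 := by
    rw [← ENNReal.coe_one, ENNReal.coe_lt_coe, ← NNReal.sqrt_one]
    exact NNReal.sqrt_lt_sqrt.2 hμ.theta_lt
  refine ⟨C * (∑' i : ℕ, (σ : ℝ≥0∞) ^ i).toNNReal, fun w x => ?_⟩
  rw [ENNReal.coe_mul, ENNReal.coe_toNNReal (tsum_geometric_ne_top hσ), mul_assoc]
  set g : ℤ → ℝ≥0∞ := fun j => (μ (sball q j x))⁻¹ * oscEnergy ν q p w j x
  have hterm (k : ℤ) : adm X q k * ((μ (sball q k x))⁻¹ * tailSum ν q p w k x ^ p) ≤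
      C * ∑' i : ℕ, (σ : ℝ≥0∞) ^ i * g (k + i) := by
    by_cases hk : Admissible X q k
    · rw [adm_eq_one hk, one_mul]
      exact hC w x k hk
    · rw [adm_eq_zero hk, zero_mul]
      exact zero_le
  refine (ENNReal.tsum_le_tsum hterm).trans_eq ?_
  rw [ENNReal.tsum_mul_left, ENNReal.tsum_comm, ← ENNReal.tsum_mul_right]
  congr 2 with i
  rw [ENNReal.tsum_mul_left]
  congr 1
  exact (Equiv.addRight (i : ℤ)).tsum_eq g

variable [MeasurableSpace E] [OpensMeasurableSpace E] [MeasurableSub₂ E] [BorelSpace X]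
  [SecondCountableTopology X] [SFinite μ] [SFinite ν]

lemma exists_tsum_lintegral_tailSum_le (hμ : ScaleRegular q D θ μ) (hν : ScaleRegular q D θ ν)
    (hp : 1 ≤ p) : ∃ C : ℝ≥0, ∀ w : X → E, Measurable w →
      ∑' k, ∫⁻ x, adm X q k * ((μ (sball q k x))⁻¹ * tailSum ν q p w k x ^ p) ∂μ ≤
        C * energy ν p w := by
  obtain ⟨C, hC⟩ := hμ.exists_tsum_tailSum_le (ν := ν) (E := E) hp
  refine ⟨C * (D ^ 7 * ((1 - (θ : ℝ≥0∞))⁻¹).toNNReal), fun w hw => ?_⟩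
  have hm (k : ℤ) : Measurable fun x => (μ (sball q k x))⁻¹ := (measurable_measure_ball μ _).inv
  have hmTail (k : ℤ) : AEMeasurable
      (fun x => adm X q k * ((μ (sball q k x))⁻¹ * tailSum ν q p w k x ^ p)) μ :=
    (((hm k).mul ((measurable_tailSum ν q p hw k).pow_const p)).const_mul _).aemeasurable
  have hmOsc (k : ℤ) :
      AEMeasurable (fun x => (μ (sball q k x))⁻¹ * oscEnergy ν q p w k x) μ :=
    ((hm k).mul (measurable_oscEnergy ν q p hw k)).aemeasurable
  rw [← lintegral_tsum hmTail]
  calc _ ≤ ∫⁻ x, C * ∑' j, (μ (sball q j x))⁻¹ * oscEnergy ν q p w j x ∂μ :=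
        lintegral_mono (hC w)
    _ = C * ∑' j, ∫⁻ x, (μ (sball q j x))⁻¹ * oscEnergy ν q p w j x ∂μ := by
        rw [lintegral_const_mul' _ _ ENNReal.coe_ne_top, lintegral_tsum hmOsc]
    _ ≤ C * (D ^ 7 * (1 - θ : ℝ≥0∞)⁻¹ * energy ν p w) := by
        gcongr
        exact hμ.tsum_lintegral_oscEnergy_le hν (by linarith) hw
    _ = _ := by
        push_cast [ENNReal.coe_toNNReal hμ.inv_one_sub_theta_ne_top]
        ring

lemma ae_oscSummable [Nontrivial X] (hμ : ScaleRegular q D θ μ) (hν : ScaleRegular q D θ ν)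
    (hp : 1 ≤ p) (hw : Measurable w) (hfin : energy ν p w ≠ ∞) :
    ∀ᵐ x ∂μ, OscSummable ν q p w x := by
  obtain ⟨J, hJ⟩ := exists_admissible (X := X) hμ.two_le
  obtain ⟨C, hC⟩ := hμ.exists_tsum_lintegral_tailSum_le hν (E := E) hp
  have hint : ∫⁻ x, adm X q J * ((μ (sball q J x))⁻¹ * tailSum ν q p w J x ^ p) ∂μ ≠ ∞ :=
    ne_top_of_le_ne_top (ENNReal.mul_ne_top ENNReal.coe_ne_top hfin)
      ((ENNReal.le_tsum (J : ℤ)).trans (hC w hw))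
  have hm : Measurable fun x => adm X q J * ((μ (sball q J x))⁻¹ * tailSum ν q p w J x ^ p) :=
    ((measurable_measure_ball μ _).inv.mul
      ((measurable_tailSum ν q p hw J).pow_const p)).const_mul _
  filter_upwards [ae_lt_top hm hint] with x hx
  refine ⟨J, hJ, fun htop => hx.ne ?_⟩
  rw [htop, adm_eq_one hJ, one_mul, ENNReal.top_rpow_of_pos (by linarith),
    ENNReal.mul_top (ENNReal.inv_ne_zero.2 (hμ.measure_ne_top _ _))]

lemma ae_tendsto_diffEnergy (hν : ScaleRegular q D θ ν) (hp : 0 < p) (hw : Measurable w)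
    (hfin : energy ν p w ≠ ∞) :
    ∀ᵐ x ∂ν, Tendsto (fun j => diffEnergy ν q p w j x) atTop (𝓝 0) := by
  have hint : ∫⁻ z, ∑' j, diffEnergy ν q p w j z ∂ν ≠ ∞ := by
    rw [lintegral_tsum fun j => (measurable_diffEnergy ν q p hw j).aemeasurable]
    exact ne_top_of_le_ne_top (ENNReal.mul_ne_top (ENNReal.mul_ne_top
      (ENNReal.pow_ne_top ENNReal.coe_ne_top) hν.inv_one_sub_theta_ne_top) hfin)
      (hν.tsum_lintegral_diffEnergy_le hp hw)
  filter_upwards [ae_lt_top (Measurable.tsum fun j => measurable_diffEnergy ν q p hw j) hint]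
    with x hx
  refine (ENNReal.tendsto_cofinite_zero_of_tsum_ne_top hx.ne).mono_left ?_
  rw [Int.cofinite_eq]
  exact le_sup_right

end TailEnergy

section Averages

variable [NormedSpace ℝ E] [CompleteSpace E]

lemma enorm_average_sub_succ_le (h : ScaleRegular q D θ ν) (hp : 1 ≤ p)
    (hint : ∀ x r, IntegrableOn w (Metric.ball x r) ν) {k : ℤ} (hk : Admissible X q k) :
    ‖scaleAverage ν q w k x - scaleAverage ν q w (k + 1) x‖ₑ ≤
      D ^ 2 * oscEnergy ν q p w k x ^ (1 / p) := by
  rw [oscEnergy, adm_eq_one hk, one_mul]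
  refine enorm_setAverage_sub_setAverage_le hp h.one_le subset_rfl
    (sball_anti h.two_le (by omega) x) (h.measure_ne_zero _ _) (h.measure_ne_top _ _) ?_ ?_
    (hint _ _)
  · exact le_mul_of_one_le_left zero_le (by exact_mod_cast h.one_le)
  · simpa only [add_sub_cancel_right] using h.measure_sub_one_le (k + 1) x

lemma edist_average_add_le (h : ScaleRegular q D θ ν) (hp : 1 ≤ p)
    (hint : ∀ x r, IntegrableOn w (Metric.ball x r) ν) {k : ℤ} (hk : Admissible X q k) (i : ℕ) :
    edist (scaleAverage ν q w (k + i) x) (scaleAverage ν q w (k + (i + 1 : ℕ)) x) ≤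
      D ^ 2 * oscEnergy ν q p w (k + i) x ^ (1 / p) := by
  rw [edist_eq_enorm_sub, Nat.cast_add_one, ← add_assoc]
  exact h.enorm_average_sub_succ_le hp hint (hk.mono h.two_le (by omega))

lemma enorm_average_sub_average_le (h : ScaleRegular q D θ ν) (hp : 1 ≤ p)
    (hint : ∀ x r, IntegrableOn w (Metric.ball x r) ν) {k : ℤ} (hk : Admissible X q (k - 1))
    (hxy : dist x y < scale q k) :
    ‖scaleAverage ν q w k x - scaleAverage ν q w k y‖ₑ ≤
      D ^ 4 * oscEnergy ν q p w (k - 1) x ^ (1 / p) := by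
  have hD : (1 : ℝ≥0∞) ≤ D := by exact_mod_cast h.one_le
  have hx := h.measure_sub_one_le k x
  have hy : ν (sball q (k - 1) x) ≤ D ^ 2 * ν (sball q k y) := by
    refine hx.trans ?_
    rw [pow_two, mul_assoc]
    gcongr
    exact h.measure_le_of_dist hxy
  rw [oscEnergy, adm_eq_one hk, one_mul]
  refine (enorm_setAverage_sub_setAverage_le (K := D ^ 2) hp (one_le_pow₀ h.one_le)
    (sball_anti h.two_le (by omega) x) (sball_subset_of_dist h.two_le (by rwa [dist_comm]))
    (h.measure_ne_zero (k - 1) x) (h.measure_ne_top (k - 1) x) ?_ ?_ (hint _ _)).trans_eq ?_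
  · refine hx.trans ?_
    rw [ENNReal.coe_pow]
    gcongr
    exact le_self_pow hD two_ne_zero
  · rwa [ENNReal.coe_pow]
  · rw [ENNReal.coe_pow, ← pow_mul]

lemma enorm_average_sub_limit_le (h : ScaleRegular q D θ ν) (hp : 1 ≤ p)
    (hint : ∀ x r, IntegrableOn w (Metric.ball x r) ν) {k : ℤ} (hk : Admissible X q k) {a : E}
    (ha : Tendsto (scaleAverage ν q w · x) atTop (𝓝 a)) :
    ‖scaleAverage ν q w k x - a‖ₑ ≤ D ^ 2 * tailSum ν q p w k x := by
  have hshift : Tendsto (fun i : ℕ => k + (i : ℤ)) atTop atTop :=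
    tendsto_atTop_add_const_left _ _ tendsto_natCast_atTop_atTop
  have htelescope := edist_le_tsum_of_edist_le_of_tendsto₀ _ (h.edist_average_add_le hp hint hk)
    (ha.comp hshift)
  rwa [ENNReal.tsum_mul_left, edist_eq_enorm_sub, Nat.cast_zero, add_zero] at htelescope

lemma exists_tendsto_average (h : ScaleRegular q D θ ν) (hp : 1 ≤ p)
    (hint : ∀ x r, IntegrableOn w (Metric.ball x r) ν) (hx : OscSummable ν q p w x) :
    ∃ a, Tendsto (scaleAverage ν q w · x) atTop (𝓝 a) := by
  obtain ⟨J, hJ, hfin⟩ := hx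
  have hcauchy := cauchySeq_of_edist_le_of_tsum_ne_top _ (h.edist_average_add_le hp hint hJ) (by
    rw [ENNReal.tsum_mul_left]
    exact ENNReal.mul_ne_top (ENNReal.pow_ne_top ENNReal.coe_ne_top) hfin)
  obtain ⟨a, ha⟩ := cauchySeq_tendsto_of_complete hcauchy
  exact ⟨a, (tendsto_atTop_int_iff J).2 ha⟩

lemma tendsto_setAverage (h : ScaleRegular q D θ ν) (hp : 1 ≤ p)
    (hint : ∀ x r, IntegrableOn w (Metric.ball x r) ν) (hx : OscSummable ν q p w x) {a : E}
    (ha : Tendsto (scaleAverage ν q w · x) atTop (𝓝 a))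
    {ι : Type*} {l : Filter ι} {S : ι → Set X} {K : ℝ≥0} (hK : 1 ≤ K)
    (hS : ∀ k₀ : ℤ, ∀ᶠ i in l, ∃ k ≥ k₀, S i ⊆ sball q k x ∧ ν (sball q k x) ≤ K * ν (S i)) :
    Tendsto (fun i => ⨍ z in S i, w z ∂ν) l (𝓝 a) := by
  obtain ⟨J, hJ, -⟩ := id hx
  have hosc : Tendsto (fun j => K ^ 2 * oscEnergy ν q p w j x ^ (1 / p)) atTop (𝓝 0) := by
    simpa only [mul_zero] using ENNReal.Tendsto.const_mul (a := (K : ℝ≥0∞) ^ 2)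
      hx.tendsto_oscEnergy_rpow (.inr (ENNReal.pow_ne_top ENNReal.coe_ne_top))
  rw [EMetric.tendsto_nhds]
  intro ε hε
  have hε' : 0 < ε / 2 := ENNReal.half_pos hε.ne'
  obtain ⟨k₀, hk₀⟩ := eventually_atTop.1
    (((EMetric.tendsto_nhds.1 ha _ hε').and (hosc.eventually (gt_mem_nhds hε'))).and
      (eventually_ge_atTop (J : ℤ)))
  filter_upwards [hS k₀] with i ⟨k, hk, hsub, hmeas⟩
  obtain ⟨⟨hlim, hsmall⟩, hJk⟩ := hk₀ k hk
  have hcompare : edist (⨍ z in S i, w z ∂ν) (scaleAverage ν q w k x) ≤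
      K ^ 2 * oscEnergy ν q p w k x ^ (1 / p) := by
    rw [edist_eq_enorm_sub, oscEnergy, adm_eq_one (hJ.mono h.two_le hJk), one_mul]
    exact enorm_setAverage_sub_setAverage_le hp hK hsub subset_rfl (h.measure_ne_zero _ _)
      (h.measure_ne_top _ _) hmeas (le_mul_of_one_le_left zero_le (by exact_mod_cast hK))
      (hint _ _)
  calc edist (⨍ z in S i, w z ∂ν) a
      ≤ edist (⨍ z in S i, w z ∂ν) (scaleAverage ν q w k x) + edist (scaleAverage ν q w k x) a :=
        edist_triangle _ _ _
    _ < ε / 2 + ε / 2 := ENNReal.add_lt_add (hcompare.trans_lt hsmall) hlim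
    _ = ε := ENNReal.add_halves ε

lemma enorm_average_sub_rpow_le_diffEnergy (hν : ScaleRegular q D θ ν) (hp : 1 ≤ p)
    (hint : ∀ x r, IntegrableOn w (Metric.ball x r) ν) {J j : ℤ} (hJ : Admissible X q J)
    (hj : J ≤ j) :
    ‖scaleAverage ν q w j x - w x‖ₑ ^ p ≤
      ν (sball q J x) * diffEnergy ν q p w (j + 1) x := by
  have hinv : (ν (sball q j x))⁻¹ ≤ ν (sball q J x) * (ν (sball q (j + 1) x))⁻¹ ^ 2 :=
    calc (ν (sball q j x))⁻¹ ≤ (ν (sball q (j + 1) x))⁻¹ :=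
          ENNReal.inv_le_inv' (measure_mono (sball_anti hν.two_le (by omega) x))
      _ = ν (sball q (j + 1) x) * (ν (sball q (j + 1) x))⁻¹ ^ 2 := by
          rw [pow_two, ← mul_assoc,
            ENNReal.mul_inv_cancel (hν.measure_ne_zero _ _) (hν.measure_ne_top _ _), one_mul]
      _ ≤ _ := by
          gcongr
          exact sball_anti hν.two_le (by omega) x
  refine (enorm_setAverage_sub_const_rpow_le hp (hν.measure_ne_zero _ _) (hν.measure_ne_top _ _)
    (hint _ _) _).trans ?_
  rw [diffEnergy, adm_eq_one (hJ.mono hν.two_le (by omega)), one_mul, add_sub_cancel_right,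
    ← mul_assoc]
  simp only [enorm_sub_rev (w x)]
  gcongr

lemma ae_tendsto_average [MeasurableSpace E] [OpensMeasurableSpace E] [MeasurableSub₂ E]
    [BorelSpace X] [SecondCountableTopology X] [SFinite ν] [Nontrivial X]
    (hν : ScaleRegular q D θ ν) (hp : 1 ≤ p) (hw : Measurable w)
    (hint : ∀ x r, IntegrableOn w (Metric.ball x r) ν) (hfin : energy ν p w ≠ ∞) :
    ∀ᵐ x ∂ν, Tendsto (scaleAverage ν q w · x) atTop (𝓝 (w x)) := by
  have hp0 : 0 < p := by linarith
  obtain ⟨J, hJ⟩ := exists_admissible (X := X) hν.two_le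
  filter_upwards [hν.ae_tendsto_diffEnergy hp0 hw hfin] with x hx
  have hbound : Tendsto (fun j => (ν (sball q J x) * diffEnergy ν q p w (j + 1) x) ^ (1 / p))
      atTop (𝓝 0) := by
    have := (ENNReal.Tendsto.const_mul
      (hx.comp (tendsto_atTop_add_const_right _ (1 : ℤ) tendsto_id)) (a := ν (sball q J x))
      (.inr (hν.measure_ne_top _ _))).ennrpow_const (1 / p)
    rwa [mul_zero, ENNReal.zero_rpow_of_pos (by positivity)] at this
  rw [tendsto_iff_edist_tendsto_0]
  refine tendsto_of_tendsto_of_tendsto_of_le_of_le' tendsto_const_nhds hbound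
    (.of_forall fun _ => zero_le) ?_
  filter_upwards [eventually_ge_atTop (J : ℤ)] with j hj
  rw [edist_eq_enorm_sub, one_div, ENNReal.le_rpow_inv_iff hp0]
  exact hν.enorm_average_sub_rpow_le_diffEnergy hp hint hJ hj

end Averages

end ScaleRegular

end Tails

section Integrability

variable {E X : Type*} [NormedAddCommGroup E] [MetricSpace X] [MeasurableSpace X]
  {ν : Measure X} {p : ℝ} {w : X → E}

lemma isFiniteMeasure_restrict_ball
    (fin : ∀ (x : X) (r : ℝ), 0 < r → ν (Metric.ball x r) < ∞) (x : X) (r : ℝ) :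
    IsFiniteMeasure (ν.restrict (Metric.ball x r)) := by
  refine ⟨?_⟩
  rw [Measure.restrict_apply_univ]
  refine (measure_mono (Metric.ball_subset_ball ?_)).trans_lt (fin x (|r| + 1) (by positivity))
  linarith [le_abs_self r]

lemma exists_lintegral_ball_enorm_sub_lt_top [OpensMeasurableSpace X] [Nonempty X]
    (pos : ∀ (x : X) (r : ℝ), 0 < r → 0 < ν (Metric.ball x r))
    (fin : ∀ (x : X) (r : ℝ), 0 < r → ν (Metric.ball x r) < ∞) (hfin : energy ν p w ≠ ∞) :
    ∃ z, ∀ x r, ∫⁻ t in Metric.ball x r, ‖w z - w t‖ₑ ^ p ∂ν < ∞ := by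
  obtain ⟨z, hz⟩ : ∃ z,
      ∫⁻ t, (ν (Metric.ball z (dist z t)))⁻¹ ^ 2 * ‖w z - w t‖ₑ ^ p ∂ν ≠ ∞ := by
    by_contra! h
    have hν : ν univ ≠ 0 :=
      ((pos (Classical.arbitrary X) 1 one_pos).trans_le (measure_mono (subset_univ _))).ne'
    refine hfin ?_
    simp only [energy, h, lintegral_const]
    exact ENNReal.top_mul hν
  refine ⟨z, fun x r => ?_⟩
  set m := ν (Metric.ball z (|r| + dist x z + 1))
  have hmt : m ≠ ∞ := (fin z _ (by positivity)).ne
  have hm0 : m ≠ 0 := (pos z _ (by positivity)).ne'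
  have hweighted : m⁻¹ ^ 2 * ∫⁻ t in Metric.ball x r, ‖w z - w t‖ₑ ^ p ∂ν < ∞ := by
    refine lt_of_le_of_lt ?_ hz.lt_top
    rw [← lintegral_const_mul' _ _ (ENNReal.pow_ne_top (ENNReal.inv_ne_top.2 hm0))]
    refine (setLIntegral_mono' measurableSet_ball fun t ht => ?_).trans
      (setLIntegral_le_lintegral (Metric.ball x r) _)
    gcongr
    refine measure_mono (Metric.ball_subset_ball ?_)
    have hxt := Metric.mem_ball'.1 ht
    linarith [le_abs_self r, dist_triangle_left z t x]
  exact ENNReal.lt_top_of_mul_ne_top_right hweighted.ne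
    (pow_ne_zero _ (ENNReal.inv_ne_zero.2 hmt))

lemma memLp_ball_of_energy_ne_top [OpensMeasurableSpace X]
    (pos : ∀ (x : X) (r : ℝ), 0 < r → 0 < ν (Metric.ball x r))
    (fin : ∀ (x : X) (r : ℝ), 0 < r → ν (Metric.ball x r) < ∞) (hp : 0 < p)
    (hw : AEStronglyMeasurable w ν) (hfin : energy ν p w ≠ ∞) (x : X) (r : ℝ) :
    MemLp w (ENNReal.ofReal p) (ν.restrict (Metric.ball x r)) := by
  have := isFiniteMeasure_restrict_ball fin x r
  have : Nonempty X := ⟨x⟩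
  obtain ⟨z, hz⟩ := exists_lintegral_ball_enorm_sub_lt_top pos fin hfin
  have hsub : MemLp (fun t => w z - w t) (ENNReal.ofReal p) (ν.restrict (Metric.ball x r)) := by
    refine ⟨aestronglyMeasurable_const.sub hw.restrict, ?_⟩
    rw [eLpNorm_lt_top_iff_lintegral_rpow_enorm_lt_top (ENNReal.ofReal_pos.2 hp).ne'
      ENNReal.ofReal_ne_top, ENNReal.toReal_ofReal hp.le]
    exact hz x r
  simpa only [Pi.sub_def, sub_sub_cancel] using (memLp_const (w z)).sub hsub

lemma integrableOn_ball_of_energy_ne_top [OpensMeasurableSpace X]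
    (pos : ∀ (x : X) (r : ℝ), 0 < r → 0 < ν (Metric.ball x r))
    (fin : ∀ (x : X) (r : ℝ), 0 < r → ν (Metric.ball x r) < ∞)
    (hp : 1 ≤ p) (hw : AEStronglyMeasurable w ν) (hfin : energy ν p w ≠ ∞) (x : X) (r : ℝ) :
    IntegrableOn w (Metric.ball x r) ν := by
  have := isFiniteMeasure_restrict_ball fin x r
  refine (memLp_ball_of_energy_ne_top pos fin (by linarith) hw hfin x r).integrable ?_
  exact ENNReal.one_le_ofReal.2 hp

end Integrability

section Limits

lemma exists_admissible_scale {X : Type*} [MetricSpace X] {q : ℝ} {x y : X}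
    (hq : 2 ≤ q) (hxy : x ≠ y) :
    ∃ k, Admissible X q (k - 1) ∧ scale q (k + 1) ≤ dist x y ∧ dist x y < scale q k := by
  obtain ⟨k, hk, hk'⟩ := exists_scale hq (dist_pos.2 hxy)
  refine ⟨k, ⟨x, y, ?_⟩, hk, hk'⟩
  have hscale : scale q (k - 1) = q ^ 2 * scale q (k + 1) := by
    have hsucc := scale_sub_one hq (k + 1)
    rw [add_sub_cancel_right] at hsucc
    rw [scale_sub_one hq k, hsucc]
    ring
  rw [hscale]
  gcongr

variable {E X : Type*} [NormedAddCommGroup E] [NormedSpace ℝ E] [CompleteSpace E] [MetricSpace X]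
  [MeasurableSpace X] {q p : ℝ} {D θ : ℝ≥0} {μ ν : Measure X} {w v : X → E} {x y : X}

namespace ScaleRegular

lemma enorm_limit_sub_average_le (h : ScaleRegular q D θ ν) (hp : 1 ≤ p)
    (hint : ∀ x r, IntegrableOn w (Metric.ball x r) ν) {k : ℤ} (hk : Admissible X q (k - 1))
    (hxy : dist x y < scale q k) {b : E} (hb : Tendsto (scaleAverage ν q w · y) atTop (𝓝 b)) :
    ‖b - scaleAverage ν q w k x‖ₑ ≤ 2 * D ^ 4 * tailSum ν q p w (k - 1) y := by
  have hD : (1 : ℝ≥0∞) ≤ D := by exact_mod_cast h.one_le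
  have hlimit := h.enorm_average_sub_limit_le hp hint (hk.mono h.two_le (by omega : k - 1 ≤ k)) hb
  have hcentres := h.enorm_average_sub_average_le hp hint hk (x := y) (y := x)
    (by rwa [dist_comm])
  rw [← sub_sub_sub_cancel_left _ _ (scaleAverage ν q w k y)]
  refine enorm_sub_le.trans ((add_le_add hcentres hlimit).trans ?_)
  calc _ ≤ D ^ 4 * tailSum ν q p w (k - 1) y + D ^ 4 * tailSum ν q p w (k - 1) y := by
        gcongr
        · exact oscEnergy_rpow_le_tailSum _
        · norm_num
        · exact tailSum_anti (by omega)
    _ = _ := by ring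

lemma enorm_limit_sub_average_rpow_le (h : ScaleRegular q D θ ν) (hp : 1 ≤ p)
    (hint : ∀ x r, IntegrableOn w (Metric.ball x r) ν) {k : ℤ} (hk : Admissible X q (k - 1))
    (hxy : dist x y < scale q k) {b : E} (hb : Tendsto (scaleAverage ν q w · y) atTop (𝓝 b)) :
    ‖b - scaleAverage ν q w k x‖ₑ ^ p ≤
      ((2 * D ^ 4) ^ p : ℝ≥0) * tailSum ν q p w (k - 1) y ^ p := by
  have hp0 : 0 ≤ p := by linarith
  rw [ENNReal.coe_rpow_of_nonneg _ hp0, ← ENNReal.mul_rpow_of_nonneg _ _ hp0]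
  exact_mod_cast ENNReal.rpow_le_rpow (h.enorm_limit_sub_average_le hp hint hk hxy hb) hp0

lemma enorm_limit_sub_limit_rpow_le (h : ScaleRegular q D θ ν) (hp : 1 ≤ p)
    (hint : ∀ x r, IntegrableOn w (Metric.ball x r) ν) {k : ℤ} (hk : Admissible X q (k - 1))
    (hxy : dist x y < scale q k) {a b : E} (ha : Tendsto (scaleAverage ν q w · x) atTop (𝓝 a))
    (hb : Tendsto (scaleAverage ν q w · y) atTop (𝓝 b)) :
    ‖a - b‖ₑ ^ p ≤ (2 ^ (p - 1) * (2 * D ^ 4) ^ p : ℝ≥0) *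
      (tailSum ν q p w (k - 1) x ^ p + tailSum ν q p w (k - 1) y ^ p) := by
  have hx := h.enorm_limit_sub_average_rpow_le hp hint hk (x := x)
    (by rw [dist_self]; exact scale_pos h.two_le k) ha
  have hy := h.enorm_limit_sub_average_rpow_le hp hint hk hxy hb
  rw [ENNReal.coe_mul, ENNReal.coe_rpow_of_nonneg 2 (by linarith), mul_assoc, mul_add]
  exact (enorm_sub_rpow_le hp a b (scaleAverage ν q w k x)).trans (by gcongr; norm_num)

end ScaleRegular

lemma ScaleRegular.inv_ball_le (h : ScaleRegular q D θ μ) {k : ℤ} {r : ℝ}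
    (hr : scale q (k + 1) ≤ r) :
    (μ (Metric.ball x r))⁻¹ ≤ D ^ 2 * (μ (sball q (k - 1) x))⁻¹ :=
  calc (μ (Metric.ball x r))⁻¹ ≤ (μ (sball q (k + 1) x))⁻¹ :=
        ENNReal.inv_le_inv' (measure_mono (Metric.ball_subset_ball hr))
    _ ≤ D * (μ (sball q k x))⁻¹ := by
        simpa only [add_sub_cancel_right] using h.inv_le_sub_one (k + 1) x
    _ ≤ D * (D * (μ (sball q (k - 1) x))⁻¹) := by
        gcongr
        exact h.inv_le_sub_one _ _
    _ = _ := by ring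

/-- The contribution of the scale `q ^ (-k)` to the energy, with respect to `μ`, of the limit of
the `ν`-averages of `w`. -/
def tailKernel (μ ν : Measure X) (q p : ℝ) (w : X → E) (k : ℤ) (x y : X) : ℝ≥0∞ :=
  (μ (sball q k x))⁻¹ ^ 2 *
    (adm X q k * tailSum ν q p w k x ^ p + adm X q k * tailSum ν q p w k y ^ p)

lemma ScaleRegular.mul_enorm_limit_sub_limit_rpow_le (hμ : ScaleRegular q D θ μ)
    (hν : ScaleRegular q D θ ν) (hp : 1 ≤ p) (hint : ∀ x r, IntegrableOn w (Metric.ball x r) ν)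
    (hx : Tendsto (scaleAverage ν q w · x) atTop (𝓝 (v x)))
    (hy : Tendsto (scaleAverage ν q w · y) atTop (𝓝 (v y))) :
    (μ (Metric.ball x (dist x y)))⁻¹ ^ 2 * ‖v x - v y‖ₑ ^ p ≤
      (D ^ 4 * (2 ^ (p - 1) * (2 * D ^ 4) ^ p) : ℝ≥0) *
        ∑' k, (sball q k x).indicator (tailKernel μ ν q p w k x) y := by
  rcases eq_or_ne x y with rfl | hxy
  · rw [sub_self, enorm_zero, ENNReal.zero_rpow_of_pos (by linarith), mul_zero]
    exact zero_le
  obtain ⟨k, hadm, hk, hk'⟩ := exists_admissible_scale hμ.two_le hxy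
  have hmem : y ∈ sball q (k - 1) x := by
    rw [Metric.mem_ball, dist_comm]
    exact hk'.trans_le (scale_anti hμ.two_le (by omega))
  refine le_trans ?_ (mul_le_mul_right (ENNReal.le_tsum (k - 1)) _)
  rw [indicator_of_mem hmem, tailKernel, adm_eq_one hadm, one_mul, one_mul]
  refine (mul_le_mul' (pow_le_pow_left' (hμ.inv_ball_le hk) 2)
    (hν.enorm_limit_sub_limit_rpow_le hp hint hadm hk' hx hy)).trans_eq ?_
  rw [ENNReal.coe_mul _ (_ * _), ENNReal.coe_pow]
  ring

section Energy

variable [BorelSpace X] [SecondCountableTopology X] [SFinite μ] [SFinite ν]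

lemma ScaleRegular.lintegral_setLIntegral_add_le (hμ : ScaleRegular q D θ μ) {h : X → ℝ≥0∞}
    (hh : Measurable h) (k : ℤ) :
    ∫⁻ x, ∫⁻ y in sball q k x, (μ (sball q k x))⁻¹ ^ 2 * (h x + h y) ∂μ ∂μ ≤
      (1 + D ^ 2) * ∫⁻ x, (μ (sball q k x))⁻¹ * h x ∂μ := by
  have hm : Measurable fun x => (μ (sball q k x))⁻¹ * h x :=
    (measurable_measure_ball μ _).inv.mul hh
  have hcentre (x : X) : (μ (sball q k x))⁻¹ ^ 2 * (h x * μ (sball q k x)) =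
      (μ (sball q k x))⁻¹ * h x := by
    rw [pow_two, mul_comm (h x), mul_assoc, ← mul_assoc _ (μ _),
      ENNReal.inv_mul_cancel (hμ.measure_ne_zero k x) (hμ.measure_ne_top k x), one_mul]
  have hpoint (x : X) : (μ (sball q k x))⁻¹ ^ 2 * ∫⁻ y in sball q k x, h y ∂μ ≤
      D * ((μ (sball q k x))⁻¹ * ∫⁻ y in sball q k x, (μ (sball q k y))⁻¹ * h y ∂μ) := by
    rw [pow_two, mul_assoc, mul_left_comm (D : ℝ≥0∞), ← lintegral_const_mul _ hh,
      ← lintegral_const_mul _ hm]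
    refine mul_le_mul_right (setLIntegral_mono (hm.const_mul _) fun y hy => ?_) _
    rw [← mul_assoc]
    gcongr
    exact hμ.inv_le_of_dist (by rwa [dist_comm])
  calc _ = ∫⁻ x, (μ (sball q k x))⁻¹ * h x +
          (μ (sball q k x))⁻¹ ^ 2 * ∫⁻ y in sball q k x, h y ∂μ ∂μ := by
        congr with x
        rw [lintegral_const_mul _ (hh.const_add (h x)), lintegral_add_left measurable_const,
          setLIntegral_const, mul_add, hcentre]
    _ ≤ ∫⁻ x, (μ (sball q k x))⁻¹ * h x + D * ((μ (sball q k x))⁻¹ *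
          ∫⁻ y in sball q k x, (μ (sball q k y))⁻¹ * h y ∂μ) ∂μ := by
        exact lintegral_mono fun x => add_le_add_right (hpoint x) _
    _ ≤ ∫⁻ x, (μ (sball q k x))⁻¹ * h x ∂μ +
          D * (D * ∫⁻ x, (μ (sball q k x))⁻¹ * h x ∂μ) := by
        rw [lintegral_add_left hm, lintegral_const_mul' _ _ ENNReal.coe_ne_top]
        gcongr
        exact hμ.lintegral_inv_mul_setLIntegral_le μ hm k
    _ = _ := by ring

lemma lintegral_tsum_indicator_sball {F : ℤ → X → X → ℝ≥0∞}
    (hF : ∀ k, Measurable (Function.uncurry (F k))) :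
    ∫⁻ x, ∫⁻ y, ∑' k, (sball q k x).indicator (F k x) y ∂μ ∂μ =
      ∑' k, ∫⁻ x, ∫⁻ y in sball q k x, F k x y ∂μ ∂μ := by
  have hm (k : ℤ) : AEMeasurable (fun x => ∫⁻ y in sball q k x, F k x y ∂μ) μ :=
    (measurable_setLIntegral_ball μ measurable_id (hF k) _).aemeasurable
  rw [← lintegral_tsum hm]
  congr with x
  have hmx (k : ℤ) : AEMeasurable ((sball q k x).indicator (F k x)) μ :=
    (((hF k).comp measurable_prodMk_left).indicator measurableSet_ball).aemeasurable
  rw [lintegral_tsum hmx]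
  congr with k
  exact lintegral_indicator measurableSet_ball _

lemma measurable_tailKernel {E : Type*} [NormedAddCommGroup E] [MeasurableSpace E]
    [OpensMeasurableSpace E] [MeasurableSub₂ E] {w : X → E} (hw : Measurable w) (k : ℤ) :
    Measurable (Function.uncurry (tailKernel μ ν q p w k)) := by
  have hm : Measurable fun x => adm X q k * tailSum ν q p w k x ^ p :=
    ((measurable_tailSum ν q p hw k).pow_const p).const_mul _
  exact (((measurable_measure_ball μ _).inv.comp measurable_fst).pow_const 2).mul
    ((hm.comp measurable_fst).add (hm.comp measurable_snd))

variable [MeasurableSpace E] [OpensMeasurableSpace E] [MeasurableSub₂ E]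

lemma ScaleRegular.exists_energy_limit_le (hμ : ScaleRegular q D θ μ)
    (hν : ScaleRegular q D θ ν) (hp : 1 ≤ p) : ∃ C : ℝ≥0, ∀ w v : X → E, Measurable w →
      (∀ x r, IntegrableOn w (Metric.ball x r) ν) →
      (∀ᵐ x ∂μ, Tendsto (scaleAverage ν q w · x) atTop (𝓝 (v x))) →
      energy μ p v ≤ C * energy ν p w := by
  obtain ⟨C, hC⟩ := hμ.exists_tsum_lintegral_tailSum_le hν (E := E) hp
  set M : ℝ≥0 := D ^ 4 * (2 ^ (p - 1) * (2 * D ^ 4) ^ p)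
  refine ⟨M * ((1 + D ^ 2) * C), fun w v hw hint hv => ?_⟩
  have hm (k : ℤ) : Measurable fun x => adm X q k * tailSum ν q p w k x ^ p :=
    ((measurable_tailSum ν q p hw k).pow_const p).const_mul _
  calc energy μ p v
      ≤ ∫⁻ x, ∫⁻ y, M * ∑' k, (sball q k x).indicator (tailKernel μ ν q p w k x) y ∂μ ∂μ := by
        refine lintegral_mono_ae ?_
        filter_upwards [hv] with x hx
        refine lintegral_mono_ae ?_
        filter_upwards [hv] with y hy
        exact hμ.mul_enorm_limit_sub_limit_rpow_le hν hp hint hx hy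
    _ = M * ∑' k, ∫⁻ x, ∫⁻ y in sball q k x, tailKernel μ ν q p w k x y ∂μ ∂μ := by
        simp only [lintegral_const_mul' _ _ ENNReal.coe_ne_top]
        rw [lintegral_tsum_indicator_sball (measurable_tailKernel hw)]
    _ ≤ M * ∑' k, (1 + D ^ 2) *
          ∫⁻ x, (μ (sball q k x))⁻¹ * (adm X q k * tailSum ν q p w k x ^ p) ∂μ :=
        mul_le_mul_right (ENNReal.tsum_le_tsum fun k =>
          hμ.lintegral_setLIntegral_add_le (hm k) k) _
    _ ≤ M * ((1 + D ^ 2) * (C * energy ν p w)) := by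
        simp only [ENNReal.tsum_mul_left, mul_left_comm (_⁻¹) (adm _ _ _)]
        gcongr
        exact hC w hw
    _ = _ := by
        push_cast
        ring

end Energy

section AverageOfLimit

lemma ScaleRegular.enorm_setAverage_limit_sub_average_rpow_le (hμ : ScaleRegular q D θ μ)
    (hν : ScaleRegular q D θ ν) (hp : 1 ≤ p) [OpensMeasurableSpace X]
    (hint : ∀ x r, IntegrableOn w (Metric.ball x r) ν)
    (hintv : ∀ x r, IntegrableOn v (Metric.ball x r) μ)
    (hv : ∀ᵐ x ∂μ, Tendsto (scaleAverage ν q w · x) atTop (𝓝 (v x))) {k : ℤ}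
    (hk : Admissible X q (k - 1)) (x : X) :
    ‖scaleAverage μ q v k x - scaleAverage ν q w k x‖ₑ ^ p ≤ (D ^ 2 * (2 * D ^ 4) ^ p : ℝ≥0) *
      ∫⁻ z in sball q (k - 1) x,
        (μ (sball q (k - 1) z))⁻¹ * tailSum ν q p w (k - 1) z ^ p ∂μ := by
  refine (enorm_setAverage_sub_const_rpow_le hp (hμ.measure_ne_zero _ _) (hμ.measure_ne_top _ _)
    (hintv _ _) _).trans ?_
  have hpoint : ∀ᵐ z ∂μ, z ∈ sball q k x →
      (μ (sball q k x))⁻¹ * ‖v z - scaleAverage ν q w k x‖ₑ ^ p ≤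
        (D ^ 2 * (2 * D ^ 4) ^ p : ℝ≥0) *
          ((μ (sball q (k - 1) z))⁻¹ * tailSum ν q p w (k - 1) z ^ p) := by
    filter_upwards [hv] with z hz hzx
    rw [Metric.mem_ball'] at hzx
    calc _ ≤ D * (D * (μ (sball q (k - 1) z))⁻¹) *
          (((2 * D ^ 4) ^ p : ℝ≥0) * tailSum ν q p w (k - 1) z ^ p) := by
          gcongr
          · exact (hμ.inv_le_of_dist hzx).trans (by gcongr; exact hμ.inv_le_sub_one _ _)
          · exact hν.enorm_limit_sub_average_rpow_le hp hint hk hzx hz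
      _ = _ := by
        rw [ENNReal.coe_mul, ENNReal.coe_pow]
        ring
  rw [← lintegral_const_mul' _ _ (ENNReal.inv_ne_top.2 (hμ.measure_ne_zero _ _)),
    ← lintegral_const_mul' _ _ ENNReal.coe_ne_top]
  exact (setLIntegral_mono_ae' measurableSet_ball hpoint).trans
    (lintegral_mono_set (sball_anti hμ.two_le (by omega) x))

variable [BorelSpace X] [SecondCountableTopology X] [SFinite μ] [SFinite ν]

lemma ScaleRegular.ae_tendsto_setLIntegral (hν : ScaleRegular q D θ ν) {h : ℤ → X → ℝ≥0∞}
    (hh : ∀ k, Measurable (h k)) (hfin : ∑' k, ∫⁻ x, h k x ∂μ ≠ ∞) :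
    ∀ᵐ x ∂ν, Tendsto (fun k => ∫⁻ z in sball q k x, h k z ∂μ) atTop (𝓝 0) := by
  set G : ℤ → X → ℝ≥0∞ := fun k x => (ν (sball q k x))⁻¹ * ∫⁻ z in sball q k x, h k z ∂μ
  have hGm (k : ℤ) : Measurable (G k) := (measurable_measure_ball ν _).inv.mul
    (measurable_setLIntegral_ball μ measurable_id (G := fun _ z => h k z)
      ((hh k).comp measurable_snd) _)
  have hGfin : ∫⁻ x, ∑' k, G k x ∂ν ≠ ∞ := by
    rw [lintegral_tsum fun k => (hGm k).aemeasurable]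
    refine ne_top_of_le_ne_top ?_ (ENNReal.tsum_le_tsum fun k =>
      hν.lintegral_inv_mul_setLIntegral_le μ (hh k) k)
    rw [ENNReal.tsum_mul_left]
    exact ENNReal.mul_ne_top ENNReal.coe_ne_top hfin
  filter_upwards [ae_lt_top (Measurable.tsum hGm) hGfin] with x hx
  have hG : Tendsto (fun k => ν (sball q 0 x) * G k x) atTop (𝓝 0) := by
    rw [← mul_zero (ν (sball q 0 x))]
    refine ENNReal.Tendsto.const_mul ((ENNReal.tendsto_cofinite_zero_of_tsum_ne_top
      hx.ne).mono_left ?_) (.inr (hν.measure_ne_top _ _))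
    rw [Int.cofinite_eq]
    exact le_sup_right
  refine tendsto_of_tendsto_of_tendsto_of_le_of_le' tendsto_const_nhds hG
    (Eventually.of_forall fun _ => zero_le) ?_
  filter_upwards [eventually_ge_atTop 0] with k hk
  calc ∫⁻ z in sball q k x, h k z ∂μ = ν (sball q k x) * G k x := by
        rw [← mul_assoc, ENNReal.mul_inv_cancel (hν.measure_ne_zero _ _)
          (hν.measure_ne_top _ _), one_mul]
    _ ≤ ν (sball q 0 x) * G k x := by
        gcongr
        exact sball_anti hν.two_le hk x

variable [MeasurableSpace E] [OpensMeasurableSpace E] [MeasurableSub₂ E]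

lemma ScaleRegular.ae_tendsto_average_limit [Nontrivial X] (hμ : ScaleRegular q D θ μ)
    (hν : ScaleRegular q D θ ν) (hp : 1 ≤ p) (hw : Measurable w)
    (hint : ∀ x r, IntegrableOn w (Metric.ball x r) ν) (hfin : energy ν p w ≠ ∞)
    (hintv : ∀ x r, IntegrableOn v (Metric.ball x r) μ)
    (hv : ∀ᵐ x ∂μ, Tendsto (scaleAverage ν q w · x) atTop (𝓝 (v x))) :
    ∀ᵐ x ∂ν, Tendsto (fun j : ℤ => edist (scaleAverage μ q v j x) (scaleAverage ν q w j x))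
      atTop (𝓝 0) := by
  have hp0 : 0 < p := by linarith
  obtain ⟨J, hJ⟩ := exists_admissible (X := X) hν.two_le
  obtain ⟨C, hC⟩ := hμ.exists_tsum_lintegral_tailSum_le hν (E := E) hp
  set h : ℤ → X → ℝ≥0∞ := fun k x =>
    adm X q k * ((μ (sball q k x))⁻¹ * tailSum ν q p w k x ^ p) with h_def
  have hm (k : ℤ) : Measurable (h k) := ((measurable_measure_ball μ _).inv.mul
    ((measurable_tailSum ν q p hw k).pow_const p)).const_mul _
  have hhfin : ∑' k, ∫⁻ x, h k x ∂μ ≠ ∞ :=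
    ne_top_of_le_ne_top (ENNReal.mul_ne_top ENNReal.coe_ne_top hfin) (hC w hw)
  set M : ℝ≥0 := D ^ 2 * (2 * D ^ 4) ^ p
  filter_upwards [hν.ae_tendsto_setLIntegral hm hhfin] with x hx
  have hbound : Tendsto (fun k => (M * ∫⁻ z in sball q (k - 1) x, h (k - 1) z ∂μ) ^ (1 / p))
      atTop (𝓝 0) := by
    have hshift : Tendsto (fun j : ℤ => j - 1) atTop atTop :=
      tendsto_atTop_add_const_right _ (-1) tendsto_id
    have hrpow := (ENNReal.Tendsto.const_mul (a := (M : ℝ≥0∞)) (hx.comp hshift)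
      (.inr ENNReal.coe_ne_top)).ennrpow_const (1 / p)
    rwa [mul_zero, ENNReal.zero_rpow_of_pos (by positivity)] at hrpow
  refine tendsto_of_tendsto_of_tendsto_of_le_of_le' tendsto_const_nhds hbound
    (Eventually.of_forall fun _ => zero_le) ?_
  filter_upwards [eventually_ge_atTop ((J : ℤ) + 1)] with k hk
  have hadm : Admissible X q (k - 1) := hJ.mono hν.two_le (by omega)
  rw [edist_eq_enorm_sub, one_div, ENNReal.le_rpow_inv_iff hp0]
  simpa only [h_def, adm_eq_one hadm, one_mul] using
    hμ.enorm_setAverage_limit_sub_average_rpow_le hν hp hint hintv hv hadm x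

end AverageOfLimit

end Limits

section Dimension

variable {E X : Type*} [NormedAddCommGroup E] [MetricSpace X] [MeasurableSpace X] {q p : ℝ}
  {D θ : ℝ≥0} {ν : Measure X} {w : X → E}

lemma frequently_scale_rpow_lt_oscEnergy [Nontrivial X] (hq : 2 ≤ q) (hp : 0 < p) {x : X}
    (hx : ¬ OscSummable ν q p w x) {d : ℝ} (hd : 0 < d) :
    ∃ᶠ j : ℕ in atTop, ENNReal.ofReal (scale q j) ^ d < oscEnergy ν q p w j x := by
  intro hsmall
  obtain ⟨J, hJ⟩ := exists_admissible (X := X) hq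
  obtain ⟨n, hn⟩ := eventually_atTop.1 hsmall
  set ρ := ENNReal.ofReal q⁻¹
  have hρ1 : ρ ^ (d / p) < 1 :=
    ENNReal.rpow_lt_one (ENNReal.ofReal_lt_one.2 (inv_lt_one_of_one_lt₀ (by linarith)))
      (by positivity)
  have hscale (i : ℕ) : ENNReal.ofReal (scale q i) = ρ ^ i := by
    rw [scale_natCast, ENNReal.ofReal_pow (by positivity)]
  have hterm (i : ℕ) :
      oscEnergy ν q p w ((max J n : ℕ) + i) x ^ (1 / p) ≤ (ρ ^ (d / p)) ^ i := by
    have hosc := not_lt.1 (hn (max J n + i) (by omega))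
    rw [hscale, Nat.cast_add] at hosc
    calc _ ≤ ((ρ ^ (max J n + i)) ^ d) ^ (1 / p) := ENNReal.rpow_le_rpow hosc (by positivity)
      _ = (ρ ^ (d / p)) ^ (max J n + i) := by
        simp only [← ENNReal.rpow_natCast, ← ENNReal.rpow_mul]
        congr 1
        ring
      _ ≤ _ := pow_le_pow_right_of_le_one' hρ1.le (by omega)
  exact hx ⟨max J n, hJ.mono hq (by simp),
    ne_top_of_le_ne_top (tsum_geometric_ne_top hρ1) (ENNReal.tsum_le_tsum hterm)⟩

namespace ScaleRegular

lemma oscEnergy_le_oscEnergy_sub_two (h : ScaleRegular q D θ ν) {j : ℤ}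
    (hj : Admissible X q (j - 2)) {x y : X} (hxy : dist x y < 2 * scale q j) :
    oscEnergy ν q p w j x ≤ D ^ 6 * oscEnergy ν q p w (j - 2) y := by
  have hj2 : j - 2 = j - 1 - 1 := by ring
  have hmid := two_mul_scale_le h.two_le j
  have hfar := two_mul_scale_le h.two_le (j - 1)
  rw [← hj2] at hfar
  have hsub : sball q j x ⊆ sball q (j - 2) y :=
    Metric.ball_subset_ball' (by linarith [scale_pos h.two_le j])
  have hmeasure : ν (sball q (j - 2) y) ≤ D ^ 3 * ν (sball q j x) :=
    calc ν (sball q (j - 2) y) ≤ D * ν (sball q (j - 2) x) :=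
          h.measure_le_of_dist (by
            rw [dist_comm]
            linarith [scale_pos h.two_le j])
      _ ≤ D * (D * (D * ν (sball q j x))) := by
          gcongr
          rw [hj2]
          refine (h.measure_sub_one_le _ _).trans ?_
          gcongr
          exact h.measure_sub_one_le _ _
      _ = _ := by ring
  rw [oscEnergy, oscEnergy, adm_eq_one hj, adm_eq_one (hj.mono h.two_le (by omega)), one_mul,
    one_mul]
  refine (meanOscillation_le (pow_ne_zero 3 h.coe_ne_zero) (ENNReal.pow_ne_top ENNReal.coe_ne_top)
    hsub hmeasure).trans_eq ?_
  rw [← pow_mul]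

variable [BorelSpace X]

lemma oscEnergy_le_setLIntegral (h : ScaleRegular q D θ ν) {j : ℤ} (hj : Admissible X q (j - 2))
    {x a : X} (hxa : dist x a ≤ scale q j) :
    oscEnergy ν q p w j x ≤ D ^ 10 * ∫⁻ y in sball q (j + 1) a,
      (ν (sball q (j - 2) y))⁻¹ * oscEnergy ν q p w (j - 2) y ∂ν := by
  have hsucc : scale q (j + 1) < scale q j := by
    have := two_mul_scale_le h.two_le (j + 1)
    rw [add_sub_cancel_right] at this
    linarith [scale_pos h.two_le (j + 1)]
  have hpoint : ∀ y ∈ sball q (j + 1) a, (ν (sball q (j + 1) a))⁻¹ * oscEnergy ν q p w j x ≤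
      D ^ 10 * ((ν (sball q (j - 2) y))⁻¹ * oscEnergy ν q p w (j - 2) y) := by
    intro y hy
    have hinv : (ν (sball q (j + 1) a))⁻¹ ≤ D ^ 4 * (ν (sball q (j - 2) y))⁻¹ :=
      calc (ν (sball q (j + 1) a))⁻¹ ≤ D * (ν (sball q (j + 1) y))⁻¹ :=
            h.inv_le_of_dist (by rwa [dist_comm])
        _ ≤ D * (D * (D * (D * (ν (sball q (j + 1 - 1 - 1 - 1) y))⁻¹))) := by
            gcongr
            refine (h.inv_le_sub_one _ _).trans (mul_le_mul_right ?_ _)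
            exact (h.inv_le_sub_one _ _).trans (mul_le_mul_right (h.inv_le_sub_one _ _) _)
        _ = _ := by ring_nf
    have hosc := h.oscEnergy_le_oscEnergy_sub_two (p := p) (w := w) hj (x := x) (y := y) (by
      linarith [dist_triangle_right x y a, Metric.mem_ball.1 hy])
    exact (mul_le_mul' hinv hosc).trans_eq (by ring)
  calc oscEnergy ν q p w j x
      = ∫⁻ _ in sball q (j + 1) a, (ν (sball q (j + 1) a))⁻¹ * oscEnergy ν q p w j x ∂ν := by
        rw [setLIntegral_const, mul_right_comm,
          ENNReal.inv_mul_cancel (h.measure_ne_zero _ _) (h.measure_ne_top _ _), one_mul]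
    _ ≤ _ := by
        rw [← lintegral_const_mul' _ _ (ENNReal.pow_ne_top ENNReal.coe_ne_top)]
        exact setLIntegral_mono' measurableSet_ball hpoint

variable [MeasurableSpace E] [OpensMeasurableSpace E] [MeasurableSub₂ E] [SFinite ν]
  [SecondCountableTopology X]

lemma tsum_setLIntegral_oscEnergy_ne_top (h : ScaleRegular q D θ ν) (hp : 0 < p)
    (hw : Measurable w) (hfin : energy ν p w ≠ ∞) {N : ℕ → Set X} (hcount : ∀ j, (N j).Countable)
    (hN : ∀ j : ℕ, Metric.IsSeparated (scale q j).toNNReal (N j)) :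
    ∑' i : Σ j : ℕ, N j, ∫⁻ y in sball q (i.1 + 1) (i.2 : X),
      (ν (sball q (i.1 - 2) y))⁻¹ * oscEnergy ν q p w (i.1 - 2) y ∂ν ≠ ∞ := by
  set g : ℤ → X → ℝ≥0∞ := fun j y => (ν (sball q j y))⁻¹ * oscEnergy ν q p w j y
  have hnet (j : ℕ) : ∑' a : N j, ∫⁻ y in sball q (j + 1) (a : X), g (j - 2) y ∂ν ≤
      ∫⁻ y, g (j - 2) y ∂ν := by
    have := (hcount j).to_subtype
    have hscale := two_mul_scale_le h.two_le (j + 1)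
    rw [add_sub_cancel_right] at hscale
    rw [← lintegral_iUnion (fun _ => measurableSet_ball) fun a b hab =>
      disjoint_ball_of_isSeparated (hN j) (by rwa [Real.coe_toNNReal _ (scale_pos h.two_le _).le])
        a.2 b.2 (Subtype.coe_injective.ne hab)]
    exact setLIntegral_le_lintegral _ _
  rw [ENNReal.tsum_sigma']
  refine ne_top_of_le_ne_top ?_ (ENNReal.tsum_le_tsum hnet)
  have hinj : Function.Injective fun j : ℕ => (j : ℤ) - 2 :=
    sub_left_injective.comp Nat.cast_injective
  refine ne_top_of_le_ne_top ?_
    (ENNReal.tsum_comp_le_tsum_of_injective hinj fun j => ∫⁻ y, g j y ∂ν)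
  exact ne_top_of_le_ne_top (ENNReal.mul_ne_top (ENNReal.mul_ne_top
    (ENNReal.pow_ne_top ENNReal.coe_ne_top) h.inv_one_sub_theta_ne_top) hfin)
    (h.tsum_lintegral_oscEnergy_le h hp hw)

lemma hausdorffMeasure_not_oscSummable [Nontrivial X] (h : ScaleRegular q D θ ν) (hp : 0 < p)
    (hw : Measurable w) (hfin : energy ν p w ≠ ∞) {d : ℝ} (hd : 0 < d) :
    μH[d] {x | ¬ OscSummable ν q p w x} = 0 := by
  choose N hsep hcover using fun j : ℕ => exists_isSeparated_isCover X (scale q j).toNNReal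
  have hcount (j : ℕ) : (N j).Countable :=
    countable_of_isSeparated ν h.ball_pos h.ball_lt_top
      (Real.toNNReal_pos.2 (scale_pos h.two_le j)) (hsep j)
  have (j : ℕ) : Countable (N j) := (hcount j).to_subtype
  obtain ⟨J, hJ⟩ := exists_admissible (X := X) h.two_le
  set F : (Σ j : ℕ, N j) → ℝ≥0∞ := fun i => D ^ 10 * ∫⁻ y in sball q (i.1 + 1) (i.2 : X),
      (ν (sball q (i.1 - 2) y))⁻¹ * oscEnergy ν q p w (i.1 - 2) y ∂ν with F_def
  have hF : ∑' i, F i ≠ ∞ := by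
    rw [F_def, ENNReal.tsum_mul_left]
    exact ENNReal.mul_ne_top (ENNReal.pow_ne_top ENNReal.coe_ne_top)
      (h.tsum_setLIntegral_oscEnergy_ne_top hp hw hfin hcount hsep)
  let t : {i // ENNReal.ofReal (scale q (i : Σ j : ℕ, N j).1) ^ d < F i} → Set X :=
    fun i => Metric.closedBall i.1.2 (scale q i.1.1)
  have hdiam (i) : Metric.ediam (t i) ^ d ≤ 2 ^ d * F i :=
    calc Metric.ediam (t i) ^ d ≤ (2 * ENNReal.ofReal (scale q i.1.1)) ^ d := by
          gcongr
          change Metric.ediam (Metric.closedBall _ (scale q i.1.1)) ≤ _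
          rw [← Metric.closedEBall_ofReal (scale_pos h.two_le _).le]
          exact Metric.ediam_closedEBall_le
      _ = 2 ^ d * ENNReal.ofReal (scale q i.1.1) ^ d := ENNReal.mul_rpow_of_nonneg _ _ hd.le
      _ ≤ 2 ^ d * F i := mul_le_mul_right i.2.le _
  refine hausdorffMeasure_eq_zero_of_tsum_ne_top hd (t := t) (ne_top_of_le_ne_top ?_
    (ENNReal.tsum_le_tsum hdiam)) fun x hx => frequently_cofinite_iff_infinite.2 ?_
  · rw [ENNReal.tsum_mul_left]
    exact ENNReal.mul_ne_top (ENNReal.rpow_ne_top_of_nonneg hd.le ENNReal.ofNat_ne_top)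
      (ne_top_of_le_ne_top hF (ENNReal.tsum_comp_le_tsum_of_injective Subtype.val_injective F))
  · have hlarge := Nat.frequently_atTop_iff_infinite.1
      ((frequently_scale_rpow_lt_oscEnergy h.two_le hp hx hd).and_eventually
        (eventually_ge_atTop (J + 2)))
    refine Infinite.of_image (fun i => i.1.1) (hlarge.mono ?_)
    rintro j ⟨hj, hJj⟩
    obtain ⟨a, ha, hxa⟩ := hcover j (mem_univ x)
    have hdist : dist x a ≤ scale q j := by
      have hedist : edist x a ≤ ENNReal.ofReal (scale q j) := hxa
      rwa [edist_dist, ENNReal.ofReal_le_ofReal_iff (scale_pos h.two_le j).le] at hedist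
    exact ⟨⟨⟨j, a, ha⟩, hj.trans_le (h.oscEnergy_le_setLIntegral
      (hJ.mono h.two_le (by omega)) hdist)⟩, hdist, rfl⟩

lemma dimH_not_oscSummable [Nontrivial X] (h : ScaleRegular q D θ ν) (hp : 0 < p)
    (hw : Measurable w) (hfin : energy ν p w ≠ ∞) :
    dimH {x | ¬ OscSummable ν q p w x} = 0 := by
  refine le_antisymm (le_of_forall_gt fun c hc => ?_) zero_le
  obtain ⟨d, hd0, hdc⟩ := ENNReal.lt_iff_exists_nnreal_btwn.1 hc
  refine (dimH_le_of_hausdorffMeasure_ne_top (d := d) ?_).trans_lt hdc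
  rw [h.hausdorffMeasure_not_oscSummable hp hw hfin (by exact_mod_cast hd0)]
  exact ENNReal.zero_ne_top

end ScaleRegular

end Dimension

section Doubling

variable {X : Type*} [MetricSpace X]

/-- Annuli `B(x, r) \ B(x, r / κ)` are nonempty unless `B(x, r)` is the whole space. -/
def IsUniformlyPerfect (X : Type*) [MetricSpace X] (κ : ℝ) : Prop :=
  1 < κ ∧ ∀ (x : X) (r : ℝ), 0 < r → (∃ y, r ≤ dist x y) → ∃ b, r / κ ≤ dist x b ∧ dist x b < r

lemma IsUniformlyPerfect.exists_le_dist_lt {κ : ℝ} (hX : IsUniformlyPerfect X κ) {x y : X} {r : ℝ}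
    (hr : 0 < r) (hy : r ≤ dist x y) : ∃ b, r ≤ dist x b ∧ dist x b < κ * r := by
  have hκ : 0 < κ := zero_lt_one.trans hX.1
  rcases lt_or_ge (dist x y) (κ * r) with hnear | hfar
  · exact ⟨y, hy, hnear⟩
  · obtain ⟨b, hb, hb'⟩ := hX.2 x (κ * r) (by positivity) ⟨y, hfar⟩
    exact ⟨b, by rwa [mul_div_cancel_left₀ r hκ.ne'] at hb, hb'⟩

lemma Admissible.exists_two_mul_scale_le_dist {q : ℝ} (hq : 2 ≤ q) {j : ℤ}
    (hj : Admissible X q j) (x : X) : ∃ y, 2 * scale q (j + 4) ≤ dist x y := by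
  obtain ⟨y, z, hyz⟩ := hj
  obtain ⟨y', hy'⟩ : ∃ y', dist y z ≤ 2 * dist x y' := by
    by_contra! hlt
    linarith [hlt y, hlt z, dist_triangle_left y z x]
  refine ⟨y', ?_⟩
  have hscale : scale q j = q ^ 3 * scale q (j + 3) := by
    simp only [scale, neg_add, zpow_add₀ (by linarith : q ≠ 0)]
    field_simp
  have hhalf := two_mul_scale_le hq (j + 4)
  rw [show j + 4 - 1 = j + 3 by ring] at hhalf
  have hq2 : 0 < q ^ 2 := by positivity
  have hq3 : q ^ 2 * (q * scale q (j + 3)) ≤ q ^ 2 * dist y z :=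
    calc q ^ 2 * (q * scale q (j + 3)) = scale q j := by rw [hscale]; ring
      _ ≤ q ^ 2 * dist y z := hyz
  have := le_of_mul_le_mul_left hq3 hq2
  nlinarith [scale_pos hq (j + 3)]

variable [MeasurableSpace X] {ν : Measure X}

/-- A doubling measure: balls have positive and finite measure, and concentric balls of comparable
radii have comparable measures. -/
structure IsDoubling (ν : Measure X) : Prop where
  ball_pos : ∀ (x : X) (r : ℝ), 0 < r → 0 < ν (Metric.ball x r)
  ball_lt_top : ∀ (x : X) (r : ℝ), 0 < r → ν (Metric.ball x r) < ∞
  exists_measure_ball_mul_le : ∀ l : ℝ, ∃ D : ℝ≥0, ∀ (x : X) (r : ℝ), 0 < r →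
    ν (Metric.ball x (l * r)) ≤ D * ν (Metric.ball x r)

lemma le_div_add_one_mul_of_add_le {a b c : ℝ≥0∞} {D : ℝ≥0} (hac : a + b ≤ c) (hab : a ≤ D * b) :
    a ≤ (D / (D + 1) : ℝ≥0) * c := by
  rw [ENNReal.coe_div (by positivity), ENNReal.coe_add, ENNReal.coe_one, ENNReal.mul_comm_div,
    mul_div_assoc', ENNReal.le_div_iff_mul_le (by simp) (by simp)]
  calc a * (D + 1) = D * a + a := by ring
    _ ≤ D * a + D * b := add_le_add_right hab _
    _ ≤ D * c := by rw [← mul_add]; exact mul_le_mul_right hac _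

lemma IsUniformlyPerfect.measure_ball_le_mul [BorelSpace X] {κ : ℝ} (hX : IsUniformlyPerfect X κ)
    {D : ℝ≥0} (hD : ∀ (x : X) (r : ℝ), 0 < r →
      ν (Metric.ball x ((2 * κ + 1) * r)) ≤ D * ν (Metric.ball x r))
    {x y : X} {r : ℝ} (hr : 0 < r) (hy : 2 * r ≤ dist x y) :
    ν (Metric.ball x r) ≤ (D / (D + 1) : ℝ≥0) * ν (Metric.ball x ((2 * κ + 1) * r)) := by
  obtain ⟨b, hb, hb'⟩ := hX.exists_le_dist_lt (by positivity : 0 < 2 * r) hy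
  have hdisj : Disjoint (Metric.ball x r) (Metric.ball b r) :=
    Metric.ball_disjoint_ball (by linarith)
  refine le_div_add_one_mul_of_add_le (b := ν (Metric.ball b r)) ?_ ?_
  · rw [← measure_union hdisj measurableSet_ball]
    refine measure_mono (union_subset (Metric.ball_subset_ball ?_) (Metric.ball_subset_ball' ?_))
    · nlinarith [hX.1]
    · rw [dist_comm]
      linarith
  · exact (measure_mono (Metric.ball_subset_ball' (by linarith))).trans (hD b r hr)

lemma pow_three_mul_measure_sball_le {q : ℝ} (hq : 2 ≤ q) {θ : ℝ≥0} (hθ : θ ≤ 1) {j : ℤ} {x : X}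
    (hstep : ∀ i : ℕ, 4 ≤ i → ν (sball q (j + i) x) ≤ θ * ν (sball q (j + i - 1) x)) (i : ℕ) :
    θ ^ 3 * ν (sball q (j + i) x) ≤ θ ^ i * ν (sball q j x) := by
  have hθ' : (θ : ℝ≥0∞) ≤ 1 := by exact_mod_cast hθ
  rcases le_or_gt i 3 with hi | hi
  · exact mul_le_mul' (pow_le_pow_right_of_le_one' hθ' hi)
      (measure_mono (sball_anti hq (by omega) x))
  · induction i, hi using Nat.le_induction with
    | base =>
      refine (mul_le_mul_right (hstep 4 le_rfl) _).trans ?_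
      rw [← mul_assoc, ← pow_succ]
      exact mul_le_mul_right (measure_mono (sball_anti hq (by omega) x)) _
    | succ i hi ih =>
      have hs := hstep (i + 1) (by omega)
      rw [Nat.cast_succ, ← add_assoc, add_sub_cancel_right] at hs
      rw [Nat.cast_succ, ← add_assoc]
      calc θ ^ 3 * ν (sball q (j + i + 1) x) ≤ θ ^ 3 * (θ * ν (sball q (j + i) x)) :=
            mul_le_mul_right hs _
        _ = θ * (θ ^ 3 * ν (sball q (j + i) x)) := by ring
        _ ≤ θ * (θ ^ i * ν (sball q j x)) := mul_le_mul_right ih _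
        _ = θ ^ (i + 1) * ν (sball q j x) := by ring

lemma IsDoubling.exists_scaleRegular [BorelSpace X] {κ : ℝ} (hX : IsUniformlyPerfect X κ)
    (hν : IsDoubling ν) : ∃ D θ : ℝ≥0, ScaleRegular (2 * κ + 1) D θ ν := by
  have hq : 2 ≤ 2 * κ + 1 := by linarith [hX.1]
  obtain ⟨D₀, hD₀⟩ := hν.exists_measure_ball_mul_le (2 * κ + 1)
  set D := max D₀ 1
  have hD (x : X) (r : ℝ) (hr : 0 < r) :
      ν (Metric.ball x ((2 * κ + 1) * r)) ≤ D * ν (Metric.ball x r) :=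
    (hD₀ x r hr).trans (mul_le_mul_left (by exact_mod_cast le_max_left _ _) _)
  have hD1 : 1 ≤ D := le_max_right _ _
  set θ : ℝ≥0 := D / (D + 1)
  have hθ0 : 0 < θ := div_pos (zero_lt_one.trans_le hD1) (by positivity)
  have hθ1 : θ < 1 := (div_lt_one (by positivity)).2 (lt_add_of_pos_right _ one_pos)
  have hθinv : 1 ≤ θ⁻¹ ^ 3 := one_le_pow₀ ((one_le_inv₀ hθ0).2 hθ1.le)
  refine ⟨D * θ⁻¹ ^ 3, θ, hq, one_le_mul hD1 hθinv, hθ0, hθ1, hν.ball_pos, hν.ball_lt_top,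
    fun x r hr => (hD x r hr).trans (mul_le_mul_left ?_ _), fun x j i hj => ?_⟩
  · exact_mod_cast le_mul_of_one_le_right zero_le hθinv
  have hstep (i : ℕ) (hi : 4 ≤ i) : ν (sball (2 * κ + 1) (j + i) x) ≤
      θ * ν (sball (2 * κ + 1) (j + i - 1) x) := by
    obtain ⟨y, hy⟩ := hj.exists_two_mul_scale_le_dist hq x
    have hi' := scale_anti hq (show j + 4 ≤ j + i by omega)
    rw [sball, sball, scale_sub_one hq]
    exact hX.measure_ball_le_mul hD (scale_pos hq _) (by linarith : _ ≤ dist x y)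
  have hcube : (θ : ℝ≥0∞) ^ 3 ≠ 0 := by exact_mod_cast (pow_pos hθ0 3).ne'
  calc ν (sball (2 * κ + 1) (j + i) x)
      ≤ ((θ : ℝ≥0∞) ^ 3)⁻¹ * (θ ^ i * ν (sball (2 * κ + 1) j x)) := by
        rw [← ENNReal.div_eq_inv_mul, ENNReal.le_div_iff_mul_le (Or.inl hcube)
          (Or.inl (ENNReal.pow_ne_top ENNReal.coe_ne_top)), mul_comm]
        exact pow_three_mul_measure_sball_le hq hθ1.le hstep i
    _ ≤ D * (((θ : ℝ≥0∞) ^ 3)⁻¹ * (θ ^ i * ν (sball (2 * κ + 1) j x))) :=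
        le_mul_of_one_le_left zero_le (by exact_mod_cast hD1)
    _ = _ := by
        rw [ENNReal.coe_mul, ENNReal.coe_pow, ENNReal.coe_inv hθ0.ne', ENNReal.inv_pow]
        ring

lemma ScaleRegular.mono {q : ℝ} {D D' θ θ' : ℝ≥0} (h : ScaleRegular q D θ ν) (hD : D ≤ D')
    (hθ : θ ≤ θ') (hθ' : θ' < 1) : ScaleRegular q D' θ' ν where
  two_le := h.two_le
  one_le := h.one_le.trans hD
  theta_pos := h.theta_pos.trans_le hθ
  theta_lt := hθ'
  ball_pos := h.ball_pos
  ball_lt_top := h.ball_lt_top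
  doubling x r hr := (h.doubling x r hr).trans (by gcongr)
  decay x j i hj := (h.decay x j i hj).trans (by gcongr)

lemma IsUniformlyPerfect.exists_scaleRegular_pair [BorelSpace X] {κ : ℝ}
    (hX : IsUniformlyPerfect X κ) {μ ν : Measure X} (hμ : IsDoubling μ) (hν : IsDoubling ν) :
    ∃ (q : ℝ) (D θ : ℝ≥0), ScaleRegular q D θ μ ∧ ScaleRegular q D θ ν := by
  obtain ⟨D₁, θ₁, h₁⟩ := hμ.exists_scaleRegular hX
  obtain ⟨D₂, θ₂, h₂⟩ := hν.exists_scaleRegular hX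
  have hθ := max_lt h₁.theta_lt h₂.theta_lt
  exact ⟨_, _, _, h₁.mono (le_max_left D₁ D₂) (le_max_left θ₁ θ₂) hθ,
    h₂.mono (le_max_right D₁ D₂) (le_max_right θ₁ θ₂) hθ⟩

end Doubling

section Ahlfors

variable {X : Type*} [MetricSpace X]

lemma ball_eq_univ_of_ediam_lt {x : X} {r : ℝ}
    (h : Metric.ediam (univ : Set X) < ENNReal.ofReal r) : Metric.ball x r = univ := by
  refine eq_univ_of_forall fun y => ?_
  have hyx := (Metric.edist_le_ediam_of_mem (mem_univ y) (mem_univ x)).trans_lt h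
  rw [edist_dist] at hyx
  exact (ENNReal.ofReal_lt_ofReal_iff'.1 hyx).1

lemma ofReal_dist_lt_two_mul_ediam [Nontrivial X] (x y : X) :
    ENNReal.ofReal (dist x y) < 2 * Metric.ediam (univ : Set X) := by
  have hpos : 0 < Metric.ediam (univ : Set X) := Metric.ediam_pos_iff.2 nontrivial_univ
  have hle : edist x y ≤ Metric.ediam (univ : Set X) :=
    Metric.edist_le_ediam_of_mem (mem_univ x) (mem_univ y)
  rw [← edist_dist, two_mul]
  rcases eq_or_ne (edist x y) 0 with h0 | h0
  · rw [h0]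
    exact hpos.trans_le le_self_add
  · exact (ENNReal.lt_add_right (edist_ne_top x y) h0).trans_le (add_le_add hle hle)

lemma exists_radius_between_ediam [Nontrivial X] (h : Metric.ediam (univ : Set X) ≠ ∞) :
    ∃ R : ℝ, 0 < R ∧ Metric.ediam (univ : Set X) < ENNReal.ofReal R ∧
      ENNReal.ofReal R < 2 * Metric.ediam (univ : Set X) := by
  have hpos : 0 < Metric.ediam (univ : Set X) := Metric.ediam_pos_iff.2 nontrivial_univ
  obtain ⟨R, -, hR, hR'⟩ := ENNReal.lt_iff_exists_real_btwn.1
    ((ENNReal.lt_add_right h hpos.ne').trans_eq (two_mul _).symm)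
  exact ⟨R, ENNReal.ofReal_pos.1 (hpos.trans hR), hR, hR'⟩

namespace IsAhlforsRegular

variable [MeasurableSpace X] [BorelSpace X] {μ : Measure X} {n : ℝ}

lemma exists_le_measureReal_ball (h : IsAhlforsRegular μ n) :
    ∃ c : ℝ, 0 < c ∧ ∀ (x : X) (r R : ℝ), 0 < r → r ≤ R →
      ENNReal.ofReal R < 2 * Metric.ediam (univ : Set X) →
      c * (R / r) ^ n * μ.real (Metric.ball x r) ≤ μ.real (Metric.ball x R) := by
  obtain ⟨C₁, _, hC₁, -, -, hreg⟩ := h.regular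
  refine ⟨C₁, hC₁, fun x r R hr hrR hR => ?_⟩
  have hR0 := hr.trans_le hrR
  have heq : R / r * r = R := div_mul_cancel₀ R hr.ne'
  have hle := (hreg x r (R / r) hr ((ENNReal.ofReal_le_ofReal hrR).trans_lt hR)
    ((one_le_div hr).2 hrR) (by rwa [heq])).1
  rw [heq] at hle
  have := ENNReal.toReal_mono (h.ball_lt_top x R hR0).ne hle
  rwa [ENNReal.toReal_mul, ENNReal.toReal_ofReal (by positivity)] at this

lemma exists_measureReal_ball_le [Nontrivial X] (h : IsAhlforsRegular μ n) (hn : 0 < n) :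
    ∃ C : ℝ, 0 < C ∧ ∀ (x : X) (r R : ℝ), 0 < r → r ≤ R →
      μ.real (Metric.ball x R) ≤ C * (R / r) ^ n * μ.real (Metric.ball x r) := by
  obtain ⟨_, C, -, -, hC, hreg⟩ := h.regular
  have hsmall (x : X) (r R : ℝ) (hr : 0 < r) (hrR : r ≤ R)
      (hR : ENNReal.ofReal R < 2 * Metric.ediam (univ : Set X)) :
      μ.real (Metric.ball x R) ≤ C * (R / r) ^ n * μ.real (Metric.ball x r) := by
    have hR0 := hr.trans_le hrR
    have heq : R / r * r = R := div_mul_cancel₀ R hr.ne'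
    have hle := (hreg x r (R / r) hr ((ENNReal.ofReal_le_ofReal hrR).trans_lt hR)
      ((one_le_div hr).2 hrR) (by rwa [heq])).2
    rw [heq] at hle
    have := ENNReal.toReal_mono
      (ENNReal.mul_ne_top ENNReal.ofReal_ne_top (h.ball_lt_top x r hr).ne) hle
    rwa [ENNReal.toReal_mul, ENNReal.toReal_ofReal (by positivity)] at this
  refine ⟨C, zero_lt_one.trans_le hC, fun x r R hr hrR => ?_⟩
  rcases lt_or_ge (ENNReal.ofReal R) (2 * Metric.ediam (univ : Set X)) with hR | hR
  · exact hsmall x r R hr hrR hR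
  obtain ⟨S, -, hS, hS'⟩ := exists_radius_between_ediam (X := X) fun htop => by
    rw [htop, ENNReal.mul_top two_ne_zero, top_le_iff] at hR
    exact ENNReal.ofReal_ne_top hR
  have hSR : S ≤ R := ENNReal.ofReal_le_ofReal_iff'.1 (hS'.le.trans hR) |>.resolve_right
    fun hS0 => by simp [ENNReal.ofReal_of_nonpos hS0] at hS
  have huniv (ρ : ℝ) (hρ : S ≤ ρ) : Metric.ball x ρ = univ :=
    ball_eq_univ_of_ediam_lt (hS.trans_le (ENNReal.ofReal_le_ofReal hρ))
  rcases le_or_gt r S with hrS | hrS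
  · calc μ.real (Metric.ball x R) = μ.real (Metric.ball x S) := by
          rw [huniv R hSR, huniv S le_rfl]
      _ ≤ C * (S / r) ^ n * μ.real (Metric.ball x r) := hsmall x r S hr hrS hS'
      _ ≤ C * (R / r) ^ n * μ.real (Metric.ball x r) := by
          gcongr
          exact div_nonneg (hr.le.trans hrS) hr.le
  · rw [huniv R hSR, huniv r hrS.le]
    exact le_mul_of_one_le_left measureReal_nonneg (one_le_mul_of_one_le_of_one_le hC
      (Real.one_le_rpow ((one_le_div hr).2 hrR) hn.le))

lemma isDoubling [Nontrivial X] (h : IsAhlforsRegular μ n) (hn : 0 < n) : IsDoubling μ where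
  ball_pos := h.ball_pos
  ball_lt_top := h.ball_lt_top
  exists_measure_ball_mul_le l := by
    obtain ⟨C, hC, hle⟩ := h.exists_measureReal_ball_le hn
    refine ⟨(C * max l 1 ^ n).toNNReal, fun x r hr => ?_⟩
    have : 0 < max l 1 := lt_max_of_lt_right one_pos
    have hlr := hle x r (max l 1 * r) hr (le_mul_of_one_le_left hr.le (le_max_right _ _))
    rw [mul_div_cancel_right₀ _ hr.ne'] at hlr
    calc μ (Metric.ball x (l * r)) ≤ μ (Metric.ball x (max l 1 * r)) :=
          measure_mono (Metric.ball_subset_ball (by gcongr; exact le_max_left _ _))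
      _ = ENNReal.ofReal (μ.real (Metric.ball x (max l 1 * r))) :=
          (ofReal_measureReal (h.ball_lt_top x _ (by positivity)).ne).symm
      _ ≤ ENNReal.ofReal (C * max l 1 ^ n * μ.real (Metric.ball x r)) :=
          ENNReal.ofReal_le_ofReal hlr
      _ = ENNReal.ofReal (C * max l 1 ^ n) * μ (Metric.ball x r) := by
          rw [ENNReal.ofReal_mul (by positivity), ofReal_measureReal (h.ball_lt_top x r hr).ne]

lemma exists_isUniformlyPerfect (h : IsAhlforsRegular μ n) (hn : 0 < n) :
    ∃ κ, IsUniformlyPerfect X κ := by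
  obtain ⟨c, hc, hle⟩ := h.exists_le_measureReal_ball
  obtain ⟨κ, hκ, hcκ⟩ := (((tendsto_rpow_atTop hn).const_mul_atTop hc).eventually_gt_atTop 1).and
    (eventually_gt_atTop 1) |>.exists.imp fun κ hκ => hκ.symm
  have : 0 < κ := zero_lt_one.trans hκ
  refine ⟨κ, hκ, fun x r hr ⟨y, hy⟩ => ?_⟩
  by_contra! hempty
  have hsub : Metric.ball x r ⊆ Metric.ball x (r / κ) := fun b hb => by
    rw [Metric.mem_ball'] at hb ⊢
    by_contra! hfar
    exact (hempty b hfar).not_gt hb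
  have hpos : 0 < μ.real (Metric.ball x (r / κ)) :=
    ENNReal.toReal_pos (h.ball_pos x _ (by positivity)).ne' (h.ball_lt_top x _ (by positivity)).ne
  have : Nontrivial X := ⟨x, y, dist_pos.1 (hr.trans_le hy)⟩
  have hgrow := hle x (r / κ) r (by positivity) (div_le_self hr.le hκ.le)
    ((ENNReal.ofReal_le_ofReal hy).trans_lt (ofReal_dist_lt_two_mul_ediam x y))
  rw [div_div_cancel₀ hr.ne'] at hgrow
  have hmono := measureReal_mono hsub (h.ball_lt_top x _ (by positivity)).ne
  nlinarith

lemma exists_rpow_mul_measureReal_ball_le [Nontrivial X] (h : IsAhlforsRegular μ n) (hn : 0 < n) :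
    ∃ K : ℝ, 0 < K ∧ ∀ (x y : X) (r ρ : ℝ), 0 < r → 0 < ρ →
      ENNReal.ofReal r < 2 * Metric.ediam (univ : Set X) →
      ENNReal.ofReal ρ < 2 * Metric.ediam (univ : Set X) →
      ρ ^ n * μ.real (Metric.ball x r) ≤ K * r ^ n * μ.real (Metric.ball y ρ) := by
  obtain ⟨c, hc, hlower⟩ := h.exists_le_measureReal_ball
  obtain ⟨C, hC, hupper⟩ := h.exists_measureReal_ball_le hn
  refine ⟨C * 2 ^ n / c, by positivity, fun x y r ρ hr hρ hr' hρ' => ?_⟩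
  set R := max (max r ρ) (dist x y)
  have hrR : r ≤ R := (le_max_left _ _).trans (le_max_left _ _)
  have hρR : ρ ≤ R := (le_max_right _ _).trans (le_max_left _ _)
  have hxyR : dist x y ≤ R := le_max_right _ _
  have hR0 : 0 < R := hr.trans_le hrR
  have hR : ENNReal.ofReal R < 2 * Metric.ediam (univ : Set X) := by
    simp only [R, ENNReal.ofReal_max]
    exact max_lt (max_lt hr' hρ') (ofReal_dist_lt_two_mul_ediam x y)
  have hbound : c * (R / r) ^ n * μ.real (Metric.ball x r) ≤
      C * (2 * R / ρ) ^ n * μ.real (Metric.ball y ρ) :=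
    calc c * (R / r) ^ n * μ.real (Metric.ball x r) ≤ μ.real (Metric.ball x R) :=
          hlower x r R hr hrR hR
      _ ≤ μ.real (Metric.ball y (2 * R)) :=
          measureReal_mono (Metric.ball_subset_ball' (by linarith))
            (h.ball_lt_top y _ (by positivity)).ne
      _ ≤ C * (2 * R / ρ) ^ n * μ.real (Metric.ball y ρ) := hupper y ρ (2 * R) hρ (by linarith)
  rw [Real.div_rpow hR0.le hr.le, Real.div_rpow (by positivity) hρ.le,
    Real.mul_rpow zero_le_two hR0.le] at hbound
  have hrn : 0 < r ^ n := Real.rpow_pos_of_pos hr n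
  have hρn : 0 < ρ ^ n := Real.rpow_pos_of_pos hρ n
  have hRn : 0 < R ^ n := Real.rpow_pos_of_pos hR0 n
  have hscaled := mul_le_mul_of_nonneg_right hbound
    (show 0 ≤ r ^ n * ρ ^ n / (R ^ n * c) by positivity)
  field_simp at hscaled ⊢
  linarith

lemma exists_edist_rpow_comparable [Nontrivial X] (h : IsAhlforsRegular μ n) (hn : 0 < n) :
    ∃ c : ℝ≥0, 0 < c ∧ ∀ x y : X, x ≠ y →
      edist x y ^ n ≤ c * μ (Metric.ball x (dist x y)) ∧
      μ (Metric.ball x (dist x y)) ≤ c * edist x y ^ n := by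
  obtain ⟨K, hK0, hK⟩ := h.exists_rpow_mul_measureReal_ball_le hn
  obtain ⟨o, o', hoo⟩ := exists_pair_ne X
  set ρ := dist o o'
  have hρ0 : 0 < ρ := dist_pos.2 hoo
  have hm0 : 0 < μ.real (Metric.ball o ρ) :=
    ENNReal.toReal_pos (h.ball_pos o ρ hρ0).ne' (h.ball_lt_top o ρ hρ0).ne
  set A := K * ρ ^ n / μ.real (Metric.ball o ρ)
  set B := K * μ.real (Metric.ball o ρ) / ρ ^ n
  have hA0 : 0 < A := by positivity
  have hAB : 0 < max A B := lt_max_of_lt_left hA0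
  refine ⟨(max A B).toNNReal, Real.toNNReal_pos.2 hAB, fun x y hxy => ?_⟩
  change _ ≤ ENNReal.ofReal (max A B) * _ ∧ _ ≤ ENNReal.ofReal (max A B) * _
  have hd0 : 0 < dist x y := dist_pos.2 hxy
  have hdist := ofReal_dist_lt_two_mul_ediam x y
  have hρ := ofReal_dist_lt_two_mul_ediam o o'
  rw [← ofReal_measureReal (h.ball_lt_top x _ hd0).ne, edist_dist, ENNReal.ofReal_rpow_of_pos hd0,
    ← ENNReal.ofReal_mul hAB.le, ← ENNReal.ofReal_mul hAB.le]
  refine ⟨ENNReal.ofReal_le_ofReal ?_, ENNReal.ofReal_le_ofReal ?_⟩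
  · calc dist x y ^ n ≤ A * μ.real (Metric.ball x (dist x y)) := by
          rw [div_mul_eq_mul_div, le_div_iff₀ hm0]
          exact hK o x ρ (dist x y) hρ0 hd0 hρ hdist
      _ ≤ max A B * μ.real (Metric.ball x (dist x y)) :=
          mul_le_mul_of_nonneg_right (le_max_left A B) measureReal_nonneg
  · calc μ.real (Metric.ball x (dist x y)) ≤ B * dist x y ^ n := by
          rw [div_mul_eq_mul_div, le_div_iff₀ (by positivity)]
          linarith [hK x o (dist x y) ρ hd0 hρ0 hdist hρ]
      _ ≤ max A B * dist x y ^ n := mul_le_mul_of_nonneg_right (le_max_right A B) (by positivity)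

end IsAhlforsRegular

end Ahlfors

section Quasisymmetric

lemma strictMono_homeomorph_nnreal (η : ℝ≥0 ≃ₜ ℝ≥0) : StrictMono η := by
  refine (η.continuous.strictMono_of_inj η.injective).resolve_right fun hanti => ?_
  obtain ⟨t, ht⟩ := η.surjective (η 0 + 1)
  exact (lt_add_one (η 0)).not_ge (ht ▸ hanti.antitone zero_le)

lemma homeomorph_nnreal_pos (η : ℝ≥0 ≃ₜ ℝ≥0) {t : ℝ≥0} (ht : 0 < t) : 0 < η t :=
  zero_le.trans_lt (strictMono_homeomorph_nnreal η ht)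

variable {X Y : Type*} [MetricSpace X] [MetricSpace Y] {f : X ≃ₜ Y} {η η' : ℝ → ℝ}

/-- Ratios of distances between three points grow at most by the gauge `η` under `f`. Compared with
quasisymmetry, `η` is not required to be a homeomorphism, so that the notion visibly passes to
`f⁻¹`. -/
structure HasControlledDistortion (f : X ≃ₜ Y) (η : ℝ → ℝ) : Prop where
  gauge_pos : ∀ t, 0 < t → 0 < η t
  dist_le : ∀ (x a b : X) (t : ℝ), 0 < t → x ≠ a → dist x b ≤ t * dist x a →
    dist (f x) (f b) ≤ η t * dist (f x) (f a)

lemma IsQuasisymmetric.exists_hasControlledDistortion (hf : IsQuasisymmetric f) :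
    ∃ η, HasControlledDistortion f η := by
  obtain ⟨η, hη⟩ := hf
  refine ⟨fun t => η t.toNNReal, fun t ht => ?_, fun x a b t ht hxa hb => ?_⟩
  · exact_mod_cast homeomorph_nnreal_pos η (Real.toNNReal_pos.2 ht)
  have hfd : 0 < nndist (f x) (f a) := dist_pos.2 (f.injective.ne hxa)
  have hratio : nndist x b / nndist x a ≤ t.toNNReal := by
    rw [← NNReal.coe_le_coe, NNReal.coe_div, coe_nndist, coe_nndist, Real.coe_toNNReal t ht.le]
    exact (div_le_iff₀ (dist_pos.2 hxa)).2 hb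
  have hle := (hη b a x hxa).trans ((strictMono_homeomorph_nnreal η).monotone hratio)
  exact_mod_cast (div_le_iff₀ hfd).1 hle

lemma IsQuasisymmetric.exists_hasControlledDistortion_symm (hf : IsQuasisymmetric f) :
    ∃ η, HasControlledDistortion f.symm η := by
  obtain ⟨η, hη⟩ := hf
  have hpos (t : ℝ) (ht : 0 < t) : 0 < η.symm (t⁻¹).toNNReal :=
    homeomorph_nnreal_pos η.symm (Real.toNNReal_pos.2 (inv_pos.2 ht))
  refine ⟨fun t => ((η.symm (t⁻¹).toNNReal)⁻¹ : ℝ≥0), fun t ht => ?_, fun x a b t ht hxa hb => ?_⟩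
  · exact_mod_cast inv_pos.2 (hpos t ht)
  obtain ⟨x, rfl⟩ := f.surjective x
  obtain ⟨a, rfl⟩ := f.surjective a
  obtain ⟨b, rfl⟩ := f.surjective b
  simp only [Homeomorph.symm_apply_apply]
  rcases eq_or_ne x b with rfl | hxb
  · rw [dist_self]
    positivity
  have hfb : 0 < dist (f x) (f b) := dist_pos.2 (f.injective.ne hxb)
  have hratio : (t⁻¹).toNNReal ≤ nndist (f x) (f a) / nndist (f x) (f b) := by
    rw [← NNReal.coe_le_coe, NNReal.coe_div, coe_nndist, coe_nndist,
      Real.coe_toNNReal _ (inv_pos.2 ht).le, le_div_iff₀ hfb, inv_mul_le_iff₀ ht]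
    exact hb
  have hle : η.symm (t⁻¹).toNNReal ≤ nndist x a / nndist x b := by
    rw [← (strictMono_homeomorph_nnreal η).le_iff_le, η.apply_symm_apply]
    exact hratio.trans (hη a b x hxb)
  rw [le_div_iff₀ (show 0 < nndist x b from dist_pos.2 hxb), mul_comm, ← le_div_iff₀ (hpos t ht),
    div_eq_inv_mul] at hle
  exact_mod_cast hle

namespace HasControlledDistortion

lemma preimage_ball_subset (hf : HasControlledDistortion f η) {x a : X} {r t : ℝ} (ht : 0 < t)
    (hxa : x ≠ a) (hr : dist x a ≤ t * r) :
    f ⁻¹' Metric.ball (f x) (dist (f x) (f a) / η t) ⊆ Metric.ball x r := by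
  intro b hb
  rw [mem_preimage, Metric.mem_ball', lt_div_iff₀' (hf.gauge_pos t ht)] at hb
  rw [Metric.mem_ball']
  by_contra! hfar
  have hle : dist x a ≤ t * dist x b := hr.trans (by gcongr)
  have hxb : x ≠ b := by
    rintro rfl
    rw [dist_self, mul_zero] at hle
    exact (dist_pos.2 hxa).not_ge hle
  exact (hf.dist_le x b a t ht hxb hle).not_gt hb

lemma ball_subset_preimage (hf : HasControlledDistortion f η) {x a : X} {r t : ℝ} (ht : 0 < t)
    (hxa : x ≠ a) (hr : r ≤ t * dist x a) :
    Metric.ball x r ⊆ f ⁻¹' Metric.ball (f x) ((η t + 1) * dist (f x) (f a)) := by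
  intro b hb
  rw [Metric.mem_ball'] at hb
  rw [mem_preimage, Metric.mem_ball']
  have hle := hf.dist_le x a b t ht hxa (hb.le.trans hr)
  linarith [dist_pos.2 (f.injective.ne hxa)]

end HasControlledDistortion

variable [MeasurableSpace X] [MeasurableSpace Y] {ν : Measure X} {μY : Measure Y}

/-- The preimages under `f` of small balls are, up to a set of comparable measure, balls of radius
`q⁻ᵏ`. -/
def ComparableBalls (f : X ≃ₜ Y) (ν : Measure X) (q : ℝ) : Prop :=
  ∃ K : ℝ≥0, ∀ (x : X) (k₀ : ℤ), ∀ᶠ ρ in 𝓝[>] (0 : ℝ), ∃ k ≥ k₀,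
    f ⁻¹' Metric.ball (f x) ρ ⊆ sball q k x ∧
      ν (sball q k x) ≤ K * ν (f ⁻¹' Metric.ball (f x) ρ)

variable [BorelSpace X] [BorelSpace Y]

namespace HasControlledDistortion

lemma exists_measure_ball_mul_le (hf : HasControlledDistortion f η) {κ : ℝ}
    (hX : IsUniformlyPerfect X κ) (hν : MeasurePreserving f ν μY) (hY : IsDoubling μY) (l : ℝ) :
    ∃ D : ℝ≥0, ∀ (x : X) (r : ℝ), 0 < r →
      ν (Metric.ball x (l * r)) ≤ D * ν (Metric.ball x r) := by
  have hκ : 0 < κ := zero_lt_one.trans hX.1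
  have hηκ := hf.gauge_pos κ hκ
  have hl : 0 < max l 1 := lt_max_of_lt_right one_pos
  obtain ⟨D, hD⟩ := hY.exists_measure_ball_mul_le ((η (max l 1) + 1) * η κ)
  refine ⟨max D 1, fun x r hr => ?_⟩
  by_cases hball : ∃ y, r ≤ dist x y
  · obtain ⟨y, hy⟩ := hball
    obtain ⟨a, hra, haκ⟩ := hX.exists_le_dist_lt hr hy
    have hxa : x ≠ a := dist_pos.1 (hr.trans_le hra)
    have hlr : l * r ≤ max l 1 * dist x a := by
      gcongr
      exact le_max_left _ _
    calc ν (Metric.ball x (l * r))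
        ≤ ν (f ⁻¹' Metric.ball (f x) ((η (max l 1) + 1) * η κ * (dist (f x) (f a) / η κ))) := by
          rw [mul_assoc, mul_div_cancel₀ _ hηκ.ne']
          exact measure_mono (hf.ball_subset_preimage hl hxa hlr)
      _ ≤ D * ν (f ⁻¹' Metric.ball (f x) (dist (f x) (f a) / η κ)) := by
          rw [hν.measure_preimage_emb f.measurableEmbedding,
            hν.measure_preimage_emb f.measurableEmbedding]
          exact hD _ _ (div_pos (dist_pos.2 (f.injective.ne hxa)) hηκ)
      _ ≤ (max D 1 : ℝ≥0) * ν (Metric.ball x r) :=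
          mul_le_mul' (by exact_mod_cast le_max_left D 1)
            (measure_mono (hf.preimage_ball_subset hκ hxa haκ.le))
  · have huniv : Metric.ball x r = univ :=
      eq_univ_of_forall fun y => Metric.mem_ball'.2 (not_le.1 fun hy => hball ⟨y, hy⟩)
    rw [huniv]
    exact (measure_mono (subset_univ _)).trans
      (le_mul_of_one_le_left zero_le (by exact_mod_cast le_max_right D 1))

lemma isDoubling [Nontrivial X] (hf : HasControlledDistortion f η) {κ : ℝ}
    (hX : IsUniformlyPerfect X κ) (hν : MeasurePreserving f ν μY) (hY : IsDoubling μY) :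
    IsDoubling ν where
  ball_pos x r hr := by
    obtain ⟨a, ha⟩ := exists_ne x
    have ht : 0 < dist x a / r := div_pos (dist_pos.2 ha.symm) hr
    refine lt_of_lt_of_le ?_ (measure_mono
      (hf.preimage_ball_subset ht ha.symm (div_mul_cancel₀ _ hr.ne').ge))
    rw [hν.measure_preimage_emb f.measurableEmbedding]
    exact hY.ball_pos _ _ (div_pos (dist_pos.2 (f.injective.ne ha.symm)) (hf.gauge_pos _ ht))
  ball_lt_top x r hr := by
    obtain ⟨a, ha⟩ := exists_ne x
    have hd : 0 < dist x a := dist_pos.2 ha.symm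
    have ht : 0 < r / dist x a := div_pos hr hd
    refine (measure_mono
      (hf.ball_subset_preimage ht ha.symm (div_mul_cancel₀ _ hd.ne').ge)).trans_lt ?_
    rw [hν.measure_preimage_emb f.measurableEmbedding]
    exact hY.ball_lt_top _ _
      (mul_pos (add_pos (hf.gauge_pos _ ht) one_pos) (dist_pos.2 (f.injective.ne ha.symm)))
  exists_measure_ball_mul_le := hf.exists_measure_ball_mul_le hX hν hY

lemma exists_measure_ball_dist_le (hf : HasControlledDistortion f η)
    (hν : MeasurePreserving f ν μY) (hY : IsDoubling μY) :
    ∃ D : ℝ≥0, ∀ z t : X, z ≠ t → μY (Metric.ball (f z) (dist (f z) (f t))) ≤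
      D * ν (Metric.ball z (dist z t)) := by
  have hη := hf.gauge_pos 1 one_pos
  obtain ⟨D, hD⟩ := hY.exists_measure_ball_mul_le (η 1)
  refine ⟨D, fun z t hzt => ?_⟩
  have hle := hD (f z) (dist (f z) (f t) / η 1) (div_pos (dist_pos.2 (f.injective.ne hzt)) hη)
  rw [mul_div_cancel₀ _ hη.ne',
    ← hν.measure_preimage_emb f.measurableEmbedding (Metric.ball (f z) (dist (f z) (f t) / η 1))]
    at hle
  exact hle.trans (mul_le_mul_right
    (measure_mono (hf.preimage_ball_subset one_pos hzt (one_mul _).ge)) _)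

lemma comparableBalls [Nontrivial Y] (hf : HasControlledDistortion f η)
    (hf' : HasControlledDistortion f.symm η') {κ : ℝ} (hκ : IsUniformlyPerfect Y κ)
    (hν : MeasurePreserving f ν μY) (hY : IsDoubling μY) {q : ℝ} (hq : 2 ≤ q) :
    ComparableBalls f ν q := by
  have hκ0 : 0 < κ := zero_lt_one.trans hκ.1
  have hη' := hf'.gauge_pos κ hκ0
  set A := q * (η' κ + 1)
  have hA : 0 < A := by positivity
  have hηA := hf.gauge_pos A hA
  obtain ⟨D, hD⟩ := hY.exists_measure_ball_mul_le (η A + 1)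
  refine ⟨D, fun x k₀ => ?_⟩
  obtain ⟨y, hy⟩ := exists_ne (f x)
  obtain ⟨δ, hδ, hδs⟩ := Metric.continuousAt_iff.1 (f.symm.continuous.continuousAt (x := f x))
    (scale q k₀ / (η' κ + 1)) (div_pos (scale_pos hq k₀) (by positivity))
  filter_upwards [Ioo_mem_nhdsGT (lt_min hδ (dist_pos.2 hy.symm))] with ρ ⟨hρ, hρδ⟩
  rw [lt_min_iff] at hρδ
  obtain ⟨c, hc, hcρ⟩ := hκ.2 (f x) ρ hρ ⟨y, hρδ.2.le⟩
  obtain ⟨a, rfl⟩ := f.surjective c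
  have hxa : x ≠ a := by
    rintro rfl
    rw [dist_self] at hc
    exact (div_pos hρ hκ0).not_ge hc
  set r := (η' κ + 1) * dist x a
  have hr : r < scale q k₀ := by
    have := hδs ((dist_comm _ _).trans_lt (hcρ.trans hρδ.1))
    rwa [f.symm_apply_apply, f.symm_apply_apply, dist_comm, lt_div_iff₀' (by positivity)] at this
  obtain ⟨k, hkr, hrk⟩ := exists_scale hq (mul_pos (by positivity) (dist_pos.2 hxa) : 0 < r)
  refine ⟨k, ?_, ?_, ?_⟩
  · by_contra! hk
    exact (hkr.trans_lt hr).not_ge (scale_anti hq hk)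
  · have hsub := hf'.ball_subset_preimage hκ0 (f.injective.ne hxa) ((div_le_iff₀' hκ0).1 hc)
    simp only [f.symm_apply_apply] at hsub
    exact fun b hb => Metric.ball_subset_ball hrk.le (by simpa using hsub hb)
  · have hkA : scale q k ≤ A * dist x a := by
      have hstep := scale_sub_one hq (k + 1)
      rw [add_sub_cancel_right] at hstep
      rw [hstep, mul_assoc]
      gcongr
    rw [hν.measure_preimage_emb f.measurableEmbedding]
    refine le_trans ?_ (hD (f x) ρ hρ)
    rw [← hν.measure_preimage_emb f.measurableEmbedding]
    exact measure_mono ((hf.ball_subset_preimage hA hxa hkA).trans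
      (preimage_mono (Metric.ball_subset_ball (by gcongr))))

end HasControlledDistortion

end Quasisymmetric

section Representatives

variable {𝕜 X : Type*} [RCLike 𝕜] [MetricSpace X] [MeasurableSpace X] {μ : Measure X}
  {u v : X → 𝕜} {x : X} {a : 𝕜}

lemma AveragesTendTo.preciseRep_eq (h : AveragesTendTo μ u x a) : preciseRep μ u x = a := by
  have hex : ∃ a, AveragesTendTo μ u x a := ⟨a, h⟩
  rw [preciseRep, dif_pos hex]
  exact tendsto_nhds_unique hex.choose_spec h

lemma averagesTendTo_preciseRep (h : x ∉ divergenceSet μ u) :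
    AveragesTendTo μ u x (preciseRep μ u x) := by
  obtain ⟨a, ha⟩ := not_not.1 h
  rwa [ha.preciseRep_eq]

lemma averagesTendTo_congr (h : u =ᵐ[μ] v) : AveragesTendTo μ u = AveragesTendTo μ v := by
  ext x a
  have hball (r : ℝ) : ⨍ z in Metric.ball x r, u z ∂μ = ⨍ z in Metric.ball x r, v z ∂μ :=
    average_congr (ae_restrict_of_ae h)
  simp only [AveragesTendTo, hball]

lemma divergenceSet_congr (h : u =ᵐ[μ] v) : divergenceSet μ u = divergenceSet μ v := by
  simp only [divergenceSet, averagesTendTo_congr h]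

lemma preciseRep_congr (h : u =ᵐ[μ] v) : preciseRep μ u = preciseRep μ v := by
  ext x
  by_cases hex : ∃ a, AveragesTendTo μ u x a
  · obtain ⟨a, ha⟩ := hex
    rw [ha.preciseRep_eq, AveragesTendTo.preciseRep_eq (averagesTendTo_congr h ▸ ha)]
  · rw [preciseRep, preciseRep, dif_neg hex, dif_neg (averagesTendTo_congr h ▸ hex)]

lemma energy_congr (p : ℝ) (h : u =ᵐ[μ] v) : energy μ p u = energy μ p v := by
  refine lintegral_congr_ae ?_
  filter_upwards [h] with x hx
  refine lintegral_congr_ae ?_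
  filter_upwards [h] with y hy
  rw [hx, hy]

lemma AveragesTendTo.tendsto_scaleAverage {q : ℝ} (hq : 2 ≤ q) (h : AveragesTendTo μ u x a) :
    Tendsto (scaleAverage μ q u · x) atTop (𝓝 a) :=
  (tendsto_atTop_int_iff 0).2 <| by
    simpa [Function.comp_def, scaleAverage, sball] using h.comp (tendsto_nhdsWithin_iff.2
      ⟨tendsto_scale hq, Eventually.of_forall fun n => scale_pos hq n⟩)

lemma measurable_setAverage_ball [BorelSpace X] [SecondCountableTopology X] (μ : Measure X)
    [SFinite μ] (hu : Measurable u) (r : ℝ) :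
    Measurable fun x => ⨍ z in Metric.ball x r, u z ∂μ := by
  simp only [setAverage_eq]
  refine Measurable.smul (measurable_measure_ball μ r).ennreal_toReal.inv ?_
  have hindicator (x : X) : ∫ z in Metric.ball x r, u z ∂μ =
      ∫ z, {b : X × X | dist b.2 b.1 < r}.indicator (fun b => u b.2) (x, z) ∂μ := by
    rw [← integral_indicator measurableSet_ball]
    congr with z
  simp only [hindicator]
  have hs : MeasurableSet {b : X × X | dist b.2 b.1 < r} :=
    measurableSet_lt (measurable_snd.dist measurable_fst) measurable_const
  exact (((hu.comp measurable_snd).indicator hs).stronglyMeasurable.integral_prod_right').measurable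

end Representatives

section Transport

lemma setAverage_preimage_of_measurePreserving {E X Y : Type*} [NormedAddCommGroup E]
    [NormedSpace ℝ E] [MeasurableSpace X] [MeasurableSpace Y] {ν : Measure X} {μ : Measure Y}
    {f : X → Y} (hf : MeasurePreserving f ν μ) (hf' : MeasurableEmbedding f) (u : Y → E)
    (B : Set Y) : ⨍ x in f ⁻¹' B, u (f x) ∂ν = ⨍ y in B, u y ∂μ := by
  rw [setAverage_eq, setAverage_eq, measureReal_def, measureReal_def, hf.measure_preimage_emb hf',
    hf.setIntegral_preimage_emb hf']

variable {𝕜 X Y : Type*} [RCLike 𝕜] [MetricSpace X] [MeasurableSpace X]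
  [MetricSpace Y] [MeasurableSpace Y]

/-- The setting in which `u ↦ ũ ∘ f` is bounded: `ν` is the measure `μY` of the target pulled back
to the domain, regular at the same scales as the measure `μX` of the domain, and balls of the target
are comparable for `ν` to balls of the domain. -/
structure PullbackRegular (μX ν : Measure X) (μY : Measure Y) (f : X ≃ₜ Y) (q : ℝ) (D θ : ℝ≥0) :
    Prop where
  measurePreserving : MeasurePreserving f ν μY
  regular_left : ScaleRegular q D θ μX
  regular_right : ScaleRegular q D θ ν
  comparableBalls : ComparableBalls f ν q
  exists_measure_ball_dist_le : ∃ c : ℝ≥0, ∀ z t : X, z ≠ t →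
    μY (Metric.ball (f z) (dist (f z) (f t))) ≤ c * ν (Metric.ball z (dist z t))

variable [BorelSpace X] [BorelSpace Y] {μX ν : Measure X} {μY : Measure Y} {f : X ≃ₜ Y}
  {u : Y → 𝕜} {q p : ℝ} {D θ : ℝ≥0}

namespace PullbackRegular

lemma exists_energy_comp_le (h : PullbackRegular μX ν μY f q D θ) (𝕜 : Type*) [RCLike 𝕜]
    (hp : 0 < p) : ∃ C : ℝ≥0, ∀ u : Y → 𝕜, energy ν p (u ∘ f) ≤ C * energy μY p u := by
  obtain ⟨c, hc⟩ := h.exists_measure_ball_dist_le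
  refine ⟨(max c 1) ^ 2, fun u => ?_⟩
  have hemb := f.measurableEmbedding
  have htop : (((max c 1) ^ 2 : ℝ≥0) : ℝ≥0∞) ≠ ∞ := ENNReal.coe_ne_top
  rw [energy, energy, ← h.measurePreserving.lintegral_comp_emb hemb,
    ← lintegral_const_mul' _ _ htop]
  refine lintegral_mono fun z => ?_
  rw [← h.measurePreserving.lintegral_comp_emb hemb, ← lintegral_const_mul' _ _ htop]
  refine lintegral_mono fun t => ?_
  rcases eq_or_ne z t with rfl | hzt
  · simp [hp]
  have hinv : (ν (Metric.ball z (dist z t)))⁻¹ ≤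
      (max c 1 : ℝ≥0) * (μY (Metric.ball (f z) (dist (f z) (f t))))⁻¹ :=
    inv_le_mul_inv_of_le_mul (by exact_mod_cast (zero_lt_one.trans_le (le_max_right c 1)).ne')
      ENNReal.coe_ne_top ((hc z t hzt).trans (by gcongr; exact le_max_left c 1))
  rw [ENNReal.coe_pow, ← mul_assoc, ← mul_pow]
  gcongr
  exact le_rfl

lemma energy_comp_ne_top (h : PullbackRegular μX ν μY f q D θ) (hp : 0 < p)
    (hfin : energy μY p u ≠ ∞) : energy ν p (u ∘ f) ≠ ∞ := by
  obtain ⟨C, hC⟩ := h.exists_energy_comp_le 𝕜 hp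
  exact ne_top_of_le_ne_top (ENNReal.mul_ne_top ENNReal.coe_ne_top hfin) (hC u)

lemma integrableOn_ball (h : PullbackRegular μX ν μY f q D θ) (hp : 1 ≤ p) (hu : Measurable u)
    (hfin : energy μY p u ≠ ∞) (x : X) (r : ℝ) : IntegrableOn (u ∘ f) (Metric.ball x r) ν :=
  integrableOn_ball_of_energy_ne_top h.regular_right.ball_pos h.regular_right.ball_lt_top hp
    (hu.comp f.continuous.measurable).aestronglyMeasurable
    (h.energy_comp_ne_top (zero_lt_one.trans_le hp) hfin) x r

lemma exists_averagesTendTo (h : PullbackRegular μX ν μY f q D θ) (hp : 1 ≤ p) (hu : Measurable u)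
    (hfin : energy μY p u ≠ ∞) {x : X} (hx : OscSummable ν q p (u ∘ f) x) :
    ∃ a, Tendsto (scaleAverage ν q (u ∘ f) · x) atTop (𝓝 a) ∧ AveragesTendTo μY u (f x) a := by
  have hint := h.integrableOn_ball hp hu hfin
  obtain ⟨a, ha⟩ := h.regular_right.exists_tendsto_average hp hint hx
  obtain ⟨K, hK⟩ := h.comparableBalls
  have hball (k₀ : ℤ) : ∀ᶠ ρ in 𝓝[>] (0 : ℝ), ∃ k ≥ k₀, f ⁻¹' Metric.ball (f x) ρ ⊆ sball q k x ∧
      ν (sball q k x) ≤ (max K 1 : ℝ≥0) * ν (f ⁻¹' Metric.ball (f x) ρ) := by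
    filter_upwards [hK x k₀] with ρ ⟨k, hk, hsub, hle⟩
    exact ⟨k, hk, hsub, hle.trans (by gcongr; exact le_max_left K 1)⟩
  exact ⟨a, ha, (h.regular_right.tendsto_setAverage hp hint hx ha (le_max_right K 1) hball).congr
    fun r => setAverage_preimage_of_measurePreserving h.measurePreserving f.measurableEmbedding u _⟩

variable [Nontrivial X]

lemma ae_averagesTendTo (h : PullbackRegular μX ν μY f q D θ) (hp : 1 ≤ p) (hu : Measurable u)
    (hfin : energy μY p u ≠ ∞) :
    ∀ᵐ x ∂μX, Tendsto (scaleAverage ν q (u ∘ f) · x) atTop (𝓝 (preciseRep μY u (f x))) ∧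
      f x ∉ divergenceSet μY u := by
  have := h.regular_left.secondCountableTopology
  have := h.regular_left.isLocallyFiniteMeasure
  have := h.regular_right.isLocallyFiniteMeasure
  filter_upwards [h.regular_left.ae_oscSummable h.regular_right hp
    (hu.comp f.continuous.measurable)
    (h.energy_comp_ne_top (zero_lt_one.trans_le hp) hfin)] with x hx
  obtain ⟨a, ha, hu⟩ := h.exists_averagesTendTo hp hu hfin hx
  rw [hu.preciseRep_eq]
  exact ⟨ha, fun hdiv => hdiv ⟨a, hu⟩⟩

lemma measure_preimage_divergenceSet (h : PullbackRegular μX ν μY f q D θ) (hp : 1 ≤ p)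
    (hu : Measurable u) (hfin : energy μY p u ≠ ∞) : μX (f ⁻¹' divergenceSet μY u) = 0 :=
  measure_eq_zero_iff_ae_notMem.2 ((h.ae_averagesTendTo hp hu hfin).mono fun _ hx => hx.2)

lemma aemeasurable_preciseRep_comp (h : PullbackRegular μX ν μY f q D θ) (hp : 1 ≤ p)
    (hu : Measurable u) (hfin : energy μY p u ≠ ∞) : AEMeasurable (preciseRep μY u ∘ f) μX := by
  have := h.regular_left.secondCountableTopology
  have := h.regular_right.isLocallyFiniteMeasure
  have hmeas (n : ℕ) : Measurable (scaleAverage ν q (u ∘ f) n) :=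
    measurable_setAverage_ball ν (hu.comp f.continuous.measurable) _
  refine aemeasurable_of_tendsto_metrizable_ae' (fun n => (hmeas n).aemeasurable) ?_
  filter_upwards [h.ae_averagesTendTo hp hu hfin] with x hx
  exact hx.1.comp tendsto_natCast_atTop_atTop

lemma exists_energy_preciseRep_comp_le (h : PullbackRegular μX ν μY f q D θ) (𝕜 : Type*)
    [RCLike 𝕜] (hp : 1 ≤ p) : ∃ C : ℝ≥0, ∀ u : Y → 𝕜, Measurable u → energy μY p u ≠ ∞ →
      energy μX p (preciseRep μY u ∘ f) ≤ C * energy μY p u := by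
  have := h.regular_left.secondCountableTopology
  have := h.regular_left.isLocallyFiniteMeasure
  have := h.regular_right.isLocallyFiniteMeasure
  obtain ⟨C, hC⟩ := h.exists_energy_comp_le 𝕜 (zero_lt_one.trans_le hp)
  obtain ⟨C', hC'⟩ := h.regular_left.exists_energy_limit_le h.regular_right (E := 𝕜) hp
  refine ⟨C' * C, fun u hu hfin => ?_⟩
  calc energy μX p (preciseRep μY u ∘ f) ≤ C' * energy ν p (u ∘ f) :=
        hC' _ _ (hu.comp f.continuous.measurable) (h.integrableOn_ball hp hu hfin)
          ((h.ae_averagesTendTo hp hu hfin).mono fun _ hx => hx.1)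
    _ ≤ C' * (C * energy μY p u) := mul_le_mul_right (hC u) _
    _ = (C' * C : ℝ≥0) * energy μY p u := by rw [ENNReal.coe_mul, mul_assoc]

lemma ae_tendsto_average_preciseRep_comp (h : PullbackRegular μX ν μY f q D θ) (hp : 1 ≤ p)
    (hu : Measurable u) (hfin : energy μY p u ≠ ∞)
    (hint : ∀ x r, IntegrableOn (preciseRep μY u ∘ f) (Metric.ball x r) μX) :
    ∀ᵐ y ∂μY, Tendsto (scaleAverage μX q (preciseRep μY u ∘ f) · (f.symm y)) atTop
      (𝓝 (u y)) := by
  have := h.regular_left.secondCountableTopology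
  have := h.regular_left.isLocallyFiniteMeasure
  have := h.regular_right.isLocallyFiniteMeasure
  have hw := hu.comp f.continuous.measurable
  have hintw := h.integrableOn_ball hp hu hfin
  have hfinw := h.energy_comp_ne_top (zero_lt_one.trans_le hp) hfin
  have hdist := h.regular_left.ae_tendsto_average_limit h.regular_right hp hw hintw hfinw hint
    ((h.ae_averagesTendTo hp hu hfin).mono fun _ hx => hx.1)
  have hlim := h.regular_right.ae_tendsto_average hp hw hintw hfinw
  have hsymm : MeasurePreserving f.symm μY ν :=
    MeasurePreserving.symm f.toMeasurableEquiv h.measurePreserving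
  filter_upwards [hsymm.quasiMeasurePreserving.ae (hdist.and hlim)] with y ⟨hdisty, hlimy⟩
  simp only [Function.comp_apply, Homeomorph.apply_symm_apply] at hlimy
  rw [tendsto_iff_edist_tendsto_0] at hlimy ⊢
  exact tendsto_of_tendsto_of_tendsto_of_le_of_le tendsto_const_nhds
    (by simpa using hdisty.add hlimy) (fun _ => zero_le) fun j => edist_triangle _ _ _

end PullbackRegular

end Transport

section Identity

variable {𝕜 X : Type*} [RCLike 𝕜] [MetricSpace X] [MeasurableSpace X] {μ : Measure X} {u : X → 𝕜}
  {q p : ℝ} {D θ : ℝ≥0}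

namespace ScaleRegular

lemma comparableBalls_refl (h : ScaleRegular q D θ μ) :
    ComparableBalls (Homeomorph.refl X) μ q := by
  refine ⟨D, fun x k₀ => ?_⟩
  filter_upwards [Ioo_mem_nhdsGT (scale_pos h.two_le k₀)] with ρ ⟨hρ, hρk⟩
  obtain ⟨k, hkρ, hρk'⟩ := exists_scale h.two_le hρ
  refine ⟨k, ?_, Metric.ball_subset_ball hρk'.le, ?_⟩
  · by_contra! hk
    exact (hkρ.trans_lt hρk).not_ge (scale_anti h.two_le hk)
  · have hle := h.measure_sub_one_le (k + 1) x
    rw [add_sub_cancel_right] at hle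
    exact hle.trans (mul_le_mul_right (measure_mono (Metric.ball_subset_ball hkρ)) _)

lemma pullbackRegular_refl (h : ScaleRegular q D θ μ) :
    PullbackRegular μ μ μ (Homeomorph.refl X) q D θ where
  measurePreserving := MeasurePreserving.id μ
  regular_left := h
  regular_right := h
  comparableBalls := h.comparableBalls_refl
  exists_measure_ball_dist_le := ⟨1, fun _ _ _ => by rw [ENNReal.coe_one, one_mul]; exact le_rfl⟩

variable [BorelSpace X] [Nontrivial X]

lemma dimH_divergenceSet (h : ScaleRegular q D θ μ) (hp : 1 ≤ p) (hu : Measurable u)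
    (hfin : energy μ p u ≠ ∞) : dimH (divergenceSet μ u) = 0 := by
  have := h.secondCountableTopology
  have := h.isLocallyFiniteMeasure
  refine le_antisymm ((dimH_mono fun y hy hosc => ?_).trans
    (h.dimH_not_oscSummable (zero_lt_one.trans_le hp) hu hfin).le) zero_le
  obtain ⟨a, -, ha⟩ := h.pullbackRegular_refl.exists_averagesTendTo hp hu hfin hosc
  exact hy ⟨a, ha⟩

lemma preciseRep_ae_eq (h : ScaleRegular q D θ μ) (hp : 1 ≤ p) (hu : Measurable u)
    (hfin : energy μ p u ≠ ∞) : preciseRep μ u =ᵐ[μ] u := by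
  have := h.secondCountableTopology
  have := h.isLocallyFiniteMeasure
  have hint := h.pullbackRegular_refl.integrableOn_ball hp hu hfin
  filter_upwards [h.pullbackRegular_refl.ae_averagesTendTo hp hu hfin,
    h.ae_tendsto_average hp hu hint hfin] with y hrep hlim
  exact tendsto_nhds_unique hrep.1 hlim

end ScaleRegular

end Identity

section EnergySpaces

/-- The space `F` consists of the measurable functions of finite energy, and its seminorm `N` is
comparable to the `p`-th root of the energy. -/
structure IsEnergySpace {𝕜 X : Type*} [RCLike 𝕜] [MetricSpace X] [MeasurableSpace X]
    (μ : Measure X) (p : ℝ) (F : Set (X → 𝕜)) (N : (X → 𝕜) → ℝ≥0∞) : Prop where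
  mem_iff : ∀ u, u ∈ F ↔ AEMeasurable u μ ∧ energy μ p u ≠ ∞
  exists_le : ∃ c : ℝ≥0, ∀ u, AEMeasurable u μ → N u ≤ c * energy μ p u ^ (1 / p)
  exists_ge : ∃ c : ℝ≥0, ∀ u, AEMeasurable u μ → energy μ p u ^ (1 / p) ≤ c * N u

variable {𝕜 X Y : Type*} [RCLike 𝕜] [MetricSpace X] [MeasurableSpace X]
  [MetricSpace Y] [MeasurableSpace Y] {μX ν : Measure X} {μY : Measure Y}
  {f : X ≃ₜ Y} {p : ℝ} {FX : Set (X → 𝕜)} {NX : (X → 𝕜) → ℝ≥0∞} {FY : Set (Y → 𝕜)}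
  {NY : (Y → 𝕜) → ℝ≥0∞}

namespace IsEnergySpace

lemma exists_measurable (hF : IsEnergySpace μX p FX NX) {u : X → 𝕜} (hu : u ∈ FX) :
    ∃ w, Measurable w ∧ u =ᵐ[μX] w ∧ energy μX p w ≠ ∞ := by
  obtain ⟨hmeas, hfin⟩ := (hF.mem_iff u).1 hu
  rw [energy_congr p hmeas.ae_eq_mk] at hfin
  exact ⟨hmeas.mk u, hmeas.measurable_mk, hmeas.ae_eq_mk, hfin⟩

lemma exists_norm_le_of_energy_le (hFX : IsEnergySpace μX p FX NX) (hFY : IsEnergySpace μY p FY NY)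
    (hp : 0 ≤ p) (C : ℝ≥0) : ∃ C' : ℝ≥0, ∀ v : X → 𝕜, ∀ u ∈ FY, AEMeasurable v μX →
      energy μX p v ≤ C * energy μY p u → v ∈ FX ∧ NX v ≤ C' * NY u := by
  obtain ⟨cX, hcX⟩ := hFX.exists_le
  obtain ⟨cY, hcY⟩ := hFY.exists_ge
  have hp' : 0 ≤ 1 / p := by positivity
  refine ⟨cX * C ^ (1 / p) * cY, fun v u hu hv hle => ?_⟩
  obtain ⟨hmeas, hfin⟩ := (hFY.mem_iff u).1 hu
  refine ⟨(hFX.mem_iff v).2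
    ⟨hv, ne_top_of_le_ne_top (ENNReal.mul_ne_top ENNReal.coe_ne_top hfin) hle⟩, ?_⟩
  calc NX v ≤ cX * energy μX p v ^ (1 / p) := hcX v hv
    _ ≤ cX * (C * energy μY p u) ^ (1 / p) := by gcongr
    _ = cX * C ^ (1 / p) * energy μY p u ^ (1 / p) := by
      rw [ENNReal.mul_rpow_of_nonneg _ _ hp', mul_assoc]
    _ ≤ cX * C ^ (1 / p) * (cY * NY u) := by
      gcongr
      exact hcY u hmeas
    _ = (cX * C ^ (1 / p) * cY : ℝ≥0) * NY u := by
      push_cast [ENNReal.coe_rpow_of_nonneg _ hp']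
      ring

end IsEnergySpace

variable [BorelSpace X] [BorelSpace Y]

lemma HasControlledDistortion.exists_pullbackRegular [Nontrivial X] {η η' : ℝ → ℝ}
    (hf : HasControlledDistortion f η) (hf' : HasControlledDistortion f.symm η') {κX κY : ℝ}
    (hκX : IsUniformlyPerfect X κX) (hκY : IsUniformlyPerfect Y κY) (hX : IsDoubling μX)
    (hY : IsDoubling μY) :
    ∃ (q : ℝ) (D θ : ℝ≥0), PullbackRegular μX (μY.map f.symm) μY f q D θ := by
  have := f.symm.surjective.nontrivial
  have hν : MeasurePreserving f (μY.map f.symm) μY :=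
    MeasurePreserving.symm f.symm.toMeasurableEquiv
      (f.symm.continuous.measurable.measurePreserving μY)
  obtain ⟨q, D, θ, hreg, hreg'⟩ :=
    hκX.exists_scaleRegular_pair hX (hf.isDoubling hκX hν hY)
  exact ⟨q, D, θ, hν, hreg, hreg', hf.comparableBalls hf' hκY hν hY hreg.two_le,
    hf.exists_measure_ball_dist_le hν hY⟩

namespace PullbackRegular

variable [Nontrivial X] {q q' : ℝ} {D D' θ θ' : ℝ≥0}

lemma pullbackBounded (h : PullbackRegular μX ν μY f q D θ) (hY : ScaleRegular q' D' θ' μY)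
    (hp : 1 ≤ p) (hFX : IsEnergySpace μX p FX NX) (hFY : IsEnergySpace μY p FY NY) :
    PullbackBounded μX μY f FX NX FY NY := by
  have := f.symm.surjective.nontrivial
  obtain ⟨C, hC⟩ := h.exists_energy_preciseRep_comp_le 𝕜 hp
  obtain ⟨C', hC'⟩ := hFX.exists_norm_le_of_energy_le hFY (zero_le_one.trans hp) C
  refine ⟨C', fun u hu => ?_⟩
  obtain ⟨w, hw, huw, hfin⟩ := hFY.exists_measurable hu
  have hle := hC w hw hfin
  rw [← energy_congr p huw] at hle
  rw [divergenceSet_congr huw, preciseRep_congr huw]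
  have hint (y : Y) (r : ℝ) : IntegrableOn w (Metric.ball y r) μY :=
    integrableOn_ball_of_energy_ne_top hY.ball_pos hY.ball_lt_top hp hw.aestronglyMeasurable
      hfin y r
  exact ⟨fun y r => (hint y r).congr (ae_restrict_of_ae huw.symm),
    hY.dimH_divergenceSet hp hw hfin, h.measure_preimage_divergenceSet hp hw hfin,
    (hY.preciseRep_ae_eq hp hw hfin).trans huw.symm,
    hC' _ u hu (h.aemeasurable_preciseRep_comp hp hw hfin) hle⟩

lemma preciseRep_comp_ae_eq (h : PullbackRegular μX ν μY f q D θ) (hp : 1 ≤ p)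
    (hFY : IsEnergySpace μY p FY NY) (hb : PullbackBounded μX μY f FX NX FY NY)
    (hb' : PullbackBounded μY μX f.symm FY NY FX NX) {u : Y → 𝕜} (hu : u ∈ FY) :
    preciseRep μX (preciseRep μY u ∘ f) ∘ f.symm =ᵐ[μY] u := by
  obtain ⟨_, hb⟩ := hb
  obtain ⟨_, hb'⟩ := hb'
  obtain ⟨-, -, -, -, hmem, -⟩ := hb u hu
  obtain ⟨hint, -, hnull, -⟩ := hb' _ hmem
  obtain ⟨w, hw, huw, hfin⟩ := hFY.exists_measurable hu
  rw [preciseRep_congr huw] at hint hnull ⊢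
  filter_upwards [huw, h.ae_tendsto_average_preciseRep_comp hp hw hfin hint,
    measure_eq_zero_iff_ae_notMem.1 hnull] with y hy hlim hydiv
  rw [hy]
  exact tendsto_nhds_unique
    ((averagesTendTo_preciseRep hydiv).tendsto_scaleAverage h.regular_left.two_le) hlim

theorem inducesEquivalence {ν' : Measure Y} (h : PullbackRegular μX ν μY f q D θ)
    (h' : PullbackRegular μY ν' μX f.symm q' D' θ') (hp : 1 ≤ p)
    (hFX : IsEnergySpace μX p FX NX) (hFY : IsEnergySpace μY p FY NY) :
    InducesEquivalence μX μY f FX NX FY NY := by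
  have := f.symm.surjective.nontrivial
  have hb := h.pullbackBounded h'.regular_left hp hFX hFY
  have hb' := h'.pullbackBounded h.regular_left hp hFY hFX
  exact ⟨hb, hb', fun u hu => h.preciseRep_comp_ae_eq hp hFY hb hb' hu,
    fun v hv => h'.preciseRep_comp_ae_eq hp hFX hb' hb hv⟩

end PullbackRegular

end EnergySpaces

section BallGrowth

variable {X : Type*} [MetricSpace X] [MeasurableSpace X] {μ : Measure X} {n : ℝ} {K : ℝ≥0}

/-- The measure `μ` is doubling and `μ (B(x, d(x, y)))` is comparable to `d(x, y) ^ n`, with the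
single constant `K`; this is what the comparison of the two seminorms with the energy needs of an
Ahlfors regular measure. -/
structure HasBallGrowth (μ : Measure X) (n : ℝ) (K : ℝ≥0) : Prop where
  ball_pos : ∀ (x : X) (r : ℝ), 0 < r → 0 < μ (Metric.ball x r)
  ball_lt_top : ∀ (x : X) (r : ℝ), 0 < r → μ (Metric.ball x r) < ∞
  one_le : 1 ≤ K
  doubling : ∀ (x : X) (r : ℝ), 0 < r → μ (Metric.ball x (2 * r)) ≤ K * μ (Metric.ball x r)
  edist_rpow_le : ∀ x y : X, x ≠ y → edist x y ^ n ≤ K * μ (Metric.ball x (dist x y))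
  measure_ball_le : ∀ x y : X, x ≠ y → μ (Metric.ball x (dist x y)) ≤ K * edist x y ^ n

lemma IsAhlforsRegular.exists_hasBallGrowth [BorelSpace X] [Nontrivial X]
    (h : IsAhlforsRegular μ n) (hn : 0 < n) : ∃ K, HasBallGrowth μ n K := by
  obtain ⟨c, -, hc⟩ := h.exists_edist_rpow_comparable hn
  obtain ⟨D, hD⟩ := (h.isDoubling hn).exists_measure_ball_mul_le 2
  have hcK : c ≤ max (max c D) 1 := (le_max_left _ _).trans (le_max_left _ _)
  have hDK : D ≤ max (max c D) 1 := (le_max_right _ _).trans (le_max_left _ _)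
  refine ⟨max (max c D) 1, h.ball_pos, h.ball_lt_top, le_max_right _ _,
    fun x r hr => (hD x r hr).trans ?_, fun x y hxy => (hc x y hxy).1.trans ?_,
    fun x y hxy => (hc x y hxy).2.trans ?_⟩ <;> gcongr

namespace HasBallGrowth

lemma coe_ne_zero (h : HasBallGrowth μ n K) : (K : ℝ≥0∞) ≠ 0 := by
  exact_mod_cast (zero_lt_one.trans_le h.one_le).ne'

lemma inv_edist_rpow_le (h : HasBallGrowth μ n K) {x y : X} (hxy : x ≠ y) :
    (edist x y ^ n)⁻¹ ≤ K * (μ (Metric.ball x (dist x y)))⁻¹ :=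
  inv_le_mul_inv_of_le_mul h.coe_ne_zero ENNReal.coe_ne_top (h.measure_ball_le x y hxy)

lemma inv_measure_ball_le (h : HasBallGrowth μ n K) {x y : X} (hxy : x ≠ y) :
    (μ (Metric.ball x (dist x y)))⁻¹ ≤ K * (edist x y ^ n)⁻¹ :=
  inv_le_mul_inv_of_le_mul h.coe_ne_zero ENNReal.coe_ne_top (h.edist_rpow_le x y hxy)

lemma inv_le_of_ball_subset (h : HasBallGrowth μ n K) {x y : X} {r t : ℝ} (hr : 0 < r)
    (hxy : Metric.ball y t ⊆ Metric.ball x (2 * r)) :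
    (μ (Metric.ball x r))⁻¹ ≤ K * (μ (Metric.ball y t))⁻¹ :=
  inv_le_mul_inv_of_le_mul h.coe_ne_zero ENNReal.coe_ne_top
    ((measure_mono hxy).trans (h.doubling x r hr))

end HasBallGrowth

end BallGrowth

section BesovSpace

lemma rpow_one_div_le_of_le_mul {p : ℝ} (hp : 0 < p) {c : ℝ≥0} {a b : ℝ≥0∞} (h : a ≤ c * b) :
    a ^ (1 / p) ≤ (c ^ (1 / p) : ℝ≥0) * b ^ (1 / p) := by
  have hp1 : 0 ≤ 1 / p := by positivity
  rw [ENNReal.coe_rpow_of_nonneg _ hp1, ← ENNReal.mul_rpow_of_nonneg _ _ hp1]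
  gcongr

lemma lintegral_lintegral_le_of_le_const_mul {X : Type*} [MeasurableSpace X] {μ : Measure X}
    {F G : X → X → ℝ≥0∞} (c : ℝ≥0) (h : ∀ x y, F x y ≤ c * G x y) :
    ∫⁻ x, ∫⁻ y, F x y ∂μ ∂μ ≤ c * ∫⁻ x, ∫⁻ y, G x y ∂μ ∂μ := by
  simp only [← lintegral_const_mul' _ _ (ENNReal.coe_ne_top (r := c))]
  exact lintegral_mono fun x => lintegral_mono (h x)

variable {𝕜 X : Type*} [RCLike 𝕜] [MetricSpace X] [MeasurableSpace X] {μ : Measure X}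
  {n s p : ℝ} {K : ℝ≥0} {u : X → 𝕜}

lemma aemeasurable_of_forall_ball [OpensMeasurableSpace X] [Nonempty X]
    (h : ∀ (x : X) (r : ℝ), AEMeasurable u (μ.restrict (Metric.ball x r))) : AEMeasurable u μ := by
  obtain ⟨x⟩ := ‹Nonempty X›
  rw [← Measure.restrict_univ (μ := μ), ← Metric.iUnion_ball_nat x]
  exact AEMeasurable.iUnion fun k => h x k

lemma energy_ne_top_iff_of_le (hp : 0 < p) {N : ℝ≥0∞} {c c' : ℝ≥0}
    (h : N ≤ c * energy μ p u ^ (1 / p)) (h' : energy μ p u ^ (1 / p) ≤ c' * N) :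
    energy μ p u ≠ ∞ ↔ N < ∞ := by
  constructor
  · intro he
    exact h.trans_lt (ENNReal.mul_lt_top ENNReal.coe_lt_top
      (ENNReal.rpow_lt_top_of_nonneg (by positivity) he))
  · intro hN he
    rw [he, ENNReal.top_rpow_of_pos (by positivity), top_le_iff] at h'
    exact ENNReal.mul_ne_top ENNReal.coe_ne_top hN.ne h'

namespace HasBallGrowth

lemma besov_integrand_eq (h : HasBallGrowth μ n K) (hsp : s * p = n) {x y : X} (hxy : x ≠ y) :
    ‖u x - u y‖ₑ ^ p / (edist x y ^ (s * p) * μ (Metric.ball x (dist x y))) =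
      (edist x y ^ n)⁻¹ * ((μ (Metric.ball x (dist x y)))⁻¹ * ‖u x - u y‖ₑ ^ p) := by
  rw [hsp, ENNReal.div_eq_inv_mul, ENNReal.mul_inv (.inr (h.ball_lt_top x _ (dist_pos.2 hxy)).ne)
    (.inr (h.ball_pos x _ (dist_pos.2 hxy)).ne'), mul_assoc]

lemma besovNorm_le (h : HasBallGrowth μ n K) (hp : 0 < p) (hsp : s * p = n) (u : X → 𝕜) :
    besovNorm μ s p u ≤ (K ^ (1 / p) : ℝ≥0) * energy μ p u ^ (1 / p) := by
  refine rpow_one_div_le_of_le_mul hp (lintegral_lintegral_le_of_le_const_mul K fun x y => ?_)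
  rcases eq_or_ne x y with rfl | hxy
  · simp [hp]
  rw [h.besov_integrand_eq hsp hxy, sq, mul_assoc, ← mul_assoc (K : ℝ≥0∞)]
  gcongr
  exact h.inv_edist_rpow_le hxy

lemma le_besovNorm (h : HasBallGrowth μ n K) (hp : 0 < p) (hsp : s * p = n) (u : X → 𝕜) :
    energy μ p u ^ (1 / p) ≤ (K ^ (1 / p) : ℝ≥0) * besovNorm μ s p u := by
  refine rpow_one_div_le_of_le_mul hp (lintegral_lintegral_le_of_le_const_mul K fun x y => ?_)
  rcases eq_or_ne x y with rfl | hxy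
  · simp [hp]
  rw [h.besov_integrand_eq hsp hxy, sq, mul_assoc, ← mul_assoc (K : ℝ≥0∞)]
  gcongr
  exact h.inv_measure_ball_le hxy

theorem isEnergySpace_besovSpace [OpensMeasurableSpace X] [Nonempty X] (h : HasBallGrowth μ n K)
    (hp : 0 < p) (hsp : s * p = n) :
    IsEnergySpace μ p (besovSpace 𝕜 μ s p) (besovNorm μ s p) := by
  refine ⟨fun u => ?_, ⟨_, fun u _ => h.besovNorm_le hp hsp u⟩,
    ⟨_, fun u _ => h.le_besovNorm hp hsp u⟩⟩
  rw [energy_ne_top_iff_of_le hp (h.besovNorm_le hp hsp u) (h.le_besovNorm hp hsp u)]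
  refine ⟨fun hu => ⟨aemeasurable_of_forall_ball fun x r =>
    (hu.1 x r).aestronglyMeasurable.aemeasurable, hu.2⟩, fun hu => ⟨?_, hu.2⟩⟩
  exact memLp_ball_of_energy_ne_top h.ball_pos h.ball_lt_top hp hu.1.aestronglyMeasurable
    ((energy_ne_top_iff_of_le hp (h.besovNorm_le hp hsp u) (h.le_besovNorm hp hsp u)).2 hu.2)

end HasBallGrowth

end BesovSpace

section GradientUpperBound

lemma lintegral_lintegral_tsum {α β ι : Type*} [Countable ι] [MeasurableSpace α]
    [MeasurableSpace β] (μ : Measure α) (ν : Measure β) [SFinite ν] {F : ι → α → β → ℝ≥0∞}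
    (hF : ∀ i, Measurable (Function.uncurry (F i))) :
    ∫⁻ x, ∫⁻ y, ∑' i, F i x y ∂ν ∂μ = ∑' i, ∫⁻ x, ∫⁻ y, F i x y ∂ν ∂μ := by
  have hinner (x : α) : ∫⁻ y, ∑' i, F i x y ∂ν = ∑' i, ∫⁻ y, F i x y ∂ν :=
    lintegral_tsum fun i => ((hF i).comp measurable_prodMk_left).aemeasurable
  simp only [hinner]
  exact lintegral_tsum fun i => (hF i).lintegral_prod_right'.aemeasurable

lemma rpow_le_of_le_rpow_mul_add {s p : ℝ} (hp : 1 ≤ p) {a b c d : ℝ≥0∞}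
    (h : a ≤ d ^ s * (b + c)) : a ^ p ≤ d ^ (s * p) * (2 ^ (p - 1) * (b ^ p + c ^ p)) := by
  have hp0 : 0 ≤ p := zero_le_one.trans hp
  calc a ^ p ≤ (d ^ s * (b + c)) ^ p := by gcongr
    _ = d ^ (s * p) * (b + c) ^ p := by
      rw [ENNReal.mul_rpow_of_nonneg _ _ hp0, ← ENNReal.rpow_mul]
    _ ≤ d ^ (s * p) * (2 ^ (p - 1) * (b ^ p + c ^ p)) := by
      gcongr
      exact ENNReal.rpow_add_le_mul_rpow_add_rpow _ _ hp

lemma LpLqNorm_ofReal {X : Type*} [MeasurableSpace X] (μ : Measure X) {p : ℝ} (hp : 0 < p)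
    (g : ℤ → X → ℝ≥0∞) :
    LpLqNorm μ p (ENNReal.ofReal p) g = (∫⁻ x, ∑' k, g k x ^ p ∂μ) ^ (1 / p) := by
  simp only [LpLqNorm, lqNorm, ENNReal.ofReal_ne_top, if_false, ENNReal.toReal_ofReal hp.le]
  congr 2 with x
  rw [← ENNReal.rpow_mul, one_div_mul_cancel hp.ne', ENNReal.rpow_one]

variable {𝕜 X : Type*} [RCLike 𝕜] [MetricSpace X] [MeasurableSpace X]
  {μ : Measure X} {n s p : ℝ} {K : ℝ≥0} {u : X → 𝕜} {g : ℤ → X → ℝ≥0∞}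

lemma IsFracHajlaszGradient.exists_measurable (hg : IsFracHajlaszGradient μ s u g) :
    ∃ G : ℤ → X → ℝ≥0∞, (∀ k, Measurable (G k)) ∧ (∀ᵐ x ∂μ, ∀ k, g k x = G k x) ∧
      IsFracHajlaszGradient μ s u G := by
  obtain ⟨hgm, E, hE0, hE⟩ := hg
  choose G hG hgG using hgm
  have hgG' : ∀ᵐ x ∂μ, ∀ k, g k x = G k x := ae_all_iff.2 hgG
  refine ⟨G, hG, hgG', fun k => (hG k).aemeasurable, E ∪ {x | ¬∀ k, g k x = G k x},
    measure_union_null hE0 hgG', fun k x y hx hy hk hk' => ?_⟩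
  simp only [mem_union, mem_ofPred_eq, not_or, not_not] at hx hy
  rw [← hx.2 k, ← hy.2 k]
  exact hE k x y hx.1 hy.1 hk hk'

/-- The kernel obtained by averaging `h x + h y` over the pairs with `d(x, y) < r`. -/
def pairKernel (μ : Measure X) (r : ℝ) (h : X → ℝ≥0∞) (x y : X) : ℝ≥0∞ :=
  (μ (Metric.ball x r))⁻¹ * (Metric.ball x r).indicator (fun y => h x + h y) y

lemma measurable_pairKernel [BorelSpace X] [SecondCountableTopology X] [SFinite μ] (r : ℝ)
    {h : X → ℝ≥0∞} (hh : Measurable h) : Measurable (Function.uncurry (pairKernel μ r h)) := by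
  have hs : MeasurableSet {b : X × X | dist b.2 b.1 < r} :=
    measurableSet_lt (measurable_snd.dist measurable_fst) measurable_const
  exact ((measurable_measure_ball μ r).inv.comp measurable_fst).mul
    (((hh.comp measurable_fst).add (hh.comp measurable_snd)).indicator hs)

namespace HasBallGrowth

lemma lintegral_pairKernel_le [BorelSpace X] [SecondCountableTopology X] [SFinite μ]
    (h : HasBallGrowth μ n K) {r : ℝ} (hr : 0 < r) {G : X → ℝ≥0∞} (hG : Measurable G) :
    ∫⁻ x, ∫⁻ y, pairKernel μ r G x y ∂μ ∂μ ≤ (1 + K) * ∫⁻ x, G x ∂μ := by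
  have hpos (x) : μ (Metric.ball x r) ≠ 0 := (h.ball_pos x r hr).ne'
  have hfin (x) : μ (Metric.ball x r) ≠ ∞ := (h.ball_lt_top x r hr).ne
  have hinner (x : X) : ∫⁻ y, pairKernel μ r G x y ∂μ =
      G x + (μ (Metric.ball x r))⁻¹ * ∫⁻ y in Metric.ball x r, G y ∂μ := by
    simp only [pairKernel]
    rw [lintegral_const_mul' _ _ (ENNReal.inv_ne_top.2 (hpos x)),
      lintegral_indicator measurableSet_ball, lintegral_add_left measurable_const,
      setLIntegral_const, mul_add, mul_left_comm, ENNReal.inv_mul_cancel (hpos x) (hfin x), mul_one]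
  simp only [hinner]
  rw [lintegral_add_left hG, add_mul, one_mul]
  gcongr
  refine lintegral_inv_measure_ball_mul_setLIntegral_le hpos hfin (fun x z hxz => ?_) μ hG
  refine h.inv_le_of_ball_subset hr (Metric.ball_subset_ball' ?_)
  rw [dist_comm]
  linarith

lemma inv_sq_mul_edist_rpow_le (h : HasBallGrowth μ n K) {x y : X} (hxy : x ≠ y) {k : ℤ}
    (hk : scale 2 (k + 1) ≤ dist x y) :
    (μ (Metric.ball x (dist x y)))⁻¹ ^ 2 * edist x y ^ n ≤ K ^ 2 * (μ (sball 2 k x))⁻¹ := by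
  have hd : 0 < dist x y := dist_pos.2 hxy
  have hk' : scale 2 k ≤ 2 * dist x y := by
    have := scale_sub_one (le_refl (2 : ℝ)) (k + 1)
    rw [add_sub_cancel_right] at this
    linarith
  calc (μ (Metric.ball x (dist x y)))⁻¹ ^ 2 * edist x y ^ n
      ≤ (μ (Metric.ball x (dist x y)))⁻¹ ^ 2 * (K * μ (Metric.ball x (dist x y))) := by
        gcongr
        exact h.edist_rpow_le x y hxy
    _ = K * (μ (Metric.ball x (dist x y)))⁻¹ *
        ((μ (Metric.ball x (dist x y)))⁻¹ * μ (Metric.ball x (dist x y))) := by ring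
    _ = K * (μ (Metric.ball x (dist x y)))⁻¹ := by
        rw [ENNReal.inv_mul_cancel (h.ball_pos x _ hd).ne' (h.ball_lt_top x _ hd).ne, mul_one]
    _ ≤ K * (K * (μ (sball 2 k x))⁻¹) := by
        gcongr
        exact h.inv_le_of_ball_subset hd (Metric.ball_subset_ball hk')
    _ = K ^ 2 * (μ (sball 2 k x))⁻¹ := by ring

lemma enorm_sub_rpow_le_tsum (h : HasBallGrowth μ n K) (hp : 1 ≤ p) (hsp : s * p = n) {x y : X}
    (hg : ∀ k : ℤ, (2 : ℝ) ^ (-k - 1) ≤ dist x y → dist x y < (2 : ℝ) ^ (-k) →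
      ‖u x - u y‖ₑ ≤ edist x y ^ s * (g k x + g k y)) :
    (μ (Metric.ball x (dist x y)))⁻¹ ^ 2 * ‖u x - u y‖ₑ ^ p ≤
      K ^ 2 * 2 ^ (p - 1) * ∑' k : ℤ, pairKernel μ (scale 2 k) (fun x => g k x ^ p) x y := by
  rcases eq_or_ne x y with rfl | hxy
  · simp [zero_lt_one.trans_le hp]
  obtain ⟨k, hk1, hk2⟩ := exists_scale (le_refl (2 : ℝ)) (dist_pos.2 hxy)
  have hu : ‖u x - u y‖ₑ ^ p ≤ edist x y ^ n * (2 ^ (p - 1) * (g k x ^ p + g k y ^ p)) := by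
    rw [← hsp]
    refine rpow_le_of_le_rpow_mul_add hp (hg k ?_ hk2)
    rwa [sub_eq_add_neg, ← neg_add]
  calc (μ (Metric.ball x (dist x y)))⁻¹ ^ 2 * ‖u x - u y‖ₑ ^ p
      ≤ (μ (Metric.ball x (dist x y)))⁻¹ ^ 2 *
        (edist x y ^ n * (2 ^ (p - 1) * (g k x ^ p + g k y ^ p))) := by gcongr
    _ = (μ (Metric.ball x (dist x y)))⁻¹ ^ 2 * edist x y ^ n *
        (2 ^ (p - 1) * (g k x ^ p + g k y ^ p)) := by ring
    _ ≤ K ^ 2 * (μ (sball 2 k x))⁻¹ * (2 ^ (p - 1) * (g k x ^ p + g k y ^ p)) := by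
        gcongr ?_ * _
        exact h.inv_sq_mul_edist_rpow_le hxy hk1
    _ = K ^ 2 * 2 ^ (p - 1) * pairKernel μ (scale 2 k) (fun x => g k x ^ p) x y := by
        rw [pairKernel, indicator_of_mem (by rwa [Metric.mem_ball, dist_comm])]
        ring
    _ ≤ _ := by
        gcongr
        exact ENNReal.le_tsum k

lemma energy_le_of_measurable_gradient [BorelSpace X] [SecondCountableTopology X] [SFinite μ]
    (h : HasBallGrowth μ n K) (hp : 1 ≤ p) (hsp : s * p = n) (hgm : ∀ k, Measurable (g k))
    (hg : IsFracHajlaszGradient μ s u g) :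
    energy μ p u ≤ K ^ 2 * 2 ^ (p - 1) * (1 + K) * ∫⁻ x, ∑' k, g k x ^ p ∂μ := by
  obtain ⟨-, E, hE0, hE⟩ := hg
  have hEae : ∀ᵐ x ∂μ, x ∉ E := measure_eq_zero_iff_ae_notMem.1 hE0
  have hgp (k) : Measurable fun x => g k x ^ p := (hgm k).pow_const p
  set C : ℝ≥0∞ := K ^ 2 * 2 ^ (p - 1)
  have hCt : C ≠ ∞ := ENNReal.mul_ne_top (ENNReal.pow_ne_top ENNReal.coe_ne_top)
    (ENNReal.rpow_ne_top_of_nonneg (by linarith) ENNReal.ofNat_ne_top)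
  calc energy μ p u
      ≤ ∫⁻ x, ∫⁻ y, C * ∑' k, pairKernel μ (scale 2 k) (fun x => g k x ^ p) x y ∂μ ∂μ := by
        refine lintegral_mono_ae (hEae.mono fun x hx => ?_)
        refine lintegral_mono_ae (hEae.mono fun y hy => ?_)
        exact h.enorm_sub_rpow_le_tsum hp hsp fun k => hE k x y hx hy
    _ = C * ∑' k, ∫⁻ x, ∫⁻ y, pairKernel μ (scale 2 k) (fun x => g k x ^ p) x y ∂μ ∂μ := by
        simp only [lintegral_const_mul' _ _ hCt]
        rw [lintegral_lintegral_tsum μ μ fun k => measurable_pairKernel _ (hgp k)]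
    _ ≤ C * ∑' k, (1 + K) * ∫⁻ x, g k x ^ p ∂μ := by
        gcongr with k
        exact h.lintegral_pairKernel_le (scale_pos le_rfl k) (hgp k)
    _ = C * (1 + K) * ∫⁻ x, ∑' k, g k x ^ p ∂μ := by
        rw [ENNReal.tsum_mul_left, lintegral_tsum fun k => (hgp k).aemeasurable, mul_assoc C]

theorem energy_le_of_gradient [BorelSpace X] [SecondCountableTopology X] [SFinite μ]
    (h : HasBallGrowth μ n K) (hp : 1 ≤ p) (hsp : s * p = n)
    (hg : IsFracHajlaszGradient μ s u g) :
    energy μ p u ≤ K ^ 2 * 2 ^ (p - 1) * (1 + K) * ∫⁻ x, ∑' k, g k x ^ p ∂μ := by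
  obtain ⟨G, hG, hgG, hGgrad⟩ := hg.exists_measurable
  refine (h.energy_le_of_measurable_gradient hp hsp hG hGgrad).trans_eq ?_
  congr 1
  refine lintegral_congr_ae (hgG.mono fun x hx => ?_)
  simp only [hx]

end HasBallGrowth

end GradientUpperBound

section GradientConstruction

/-- The weight `2 ^ ((k + 1) n)`, the reciprocal of the smallest value of `d(x, y) ^ n` when
`2 ^ (-k - 1) ≤ d(x, y) < 2 ^ (-k)`. -/
def scaleWeight (n : ℝ) (k : ℤ) : ℝ≥0∞ := (ENNReal.ofReal (scale 2 (k + 1)) ^ n)⁻¹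

section Weights

variable {n : ℝ}

lemma one_le_edist_rpow_mul_scaleWeight {X : Type*} [MetricSpace X] (hn : 0 < n) {x y : X} {k : ℤ}
    (h : scale 2 (k + 1) ≤ dist x y) : 1 ≤ edist x y ^ n * scaleWeight n k := by
  have hpos : 0 < ENNReal.ofReal (scale 2 (k + 1)) := ENNReal.ofReal_pos.2 (scale_pos le_rfl _)
  have h0 : ENNReal.ofReal (scale 2 (k + 1)) ^ n ≠ 0 :=
    (ENNReal.rpow_pos hpos ENNReal.ofReal_ne_top).ne'
  have ht : ENNReal.ofReal (scale 2 (k + 1)) ^ n ≠ ∞ :=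
    ENNReal.rpow_ne_top_of_nonneg hn.le ENNReal.ofReal_ne_top
  rw [scaleWeight, ← ENNReal.mul_inv_cancel h0 ht, edist_dist]
  gcongr

lemma scaleWeight_sub_le (hn : 0 < n) {d : ℝ} {m : ℤ} (hd : d < scale 2 m) (i : ℕ) :
    scaleWeight n (m + 1 - i) ≤ 4 ^ n * (2⁻¹ ^ n) ^ i * (ENNReal.ofReal d ^ n)⁻¹ := by
  have hscale : scale 2 m = 4 * 2⁻¹ ^ i * scale 2 (m + 1 - i + 1) := by
    have h2 : (2 : ℝ) ≠ 0 := two_ne_zero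
    simp only [scale]
    rw [show -(m + 1 - (i : ℤ) + 1) = -m + i - 2 by ring, zpow_sub₀ h2, zpow_add₀ h2, zpow_natCast,
      inv_pow]
    field_simp
    norm_num
  have hσ0 : (2⁻¹ : ℝ≥0∞) ^ n ≠ 0 := (ENNReal.rpow_pos (by simp) (by simp)).ne'
  have hσt : (2⁻¹ : ℝ≥0∞) ^ n ≠ ∞ := ENNReal.rpow_ne_top_of_nonneg hn.le (by simp)
  refine inv_le_mul_inv_of_le_mul
    (mul_ne_zero (ENNReal.rpow_pos (by simp) (by simp)).ne' (pow_ne_zero i hσ0))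
    (ENNReal.mul_ne_top (ENNReal.rpow_ne_top_of_nonneg hn.le (by simp)) (ENNReal.pow_ne_top hσt)) ?_
  calc ENNReal.ofReal d ^ n
      ≤ ENNReal.ofReal (4 * 2⁻¹ ^ i * scale 2 (m + 1 - i + 1)) ^ n := by
        rw [← hscale]
        gcongr
    _ = (4 * 2⁻¹ ^ i * ENNReal.ofReal (scale 2 (m + 1 - i + 1))) ^ n := by
        rw [ENNReal.ofReal_mul (by positivity), ENNReal.ofReal_mul (by positivity),
          ENNReal.ofReal_pow (by positivity), ENNReal.ofReal_inv_of_pos two_pos,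
          ENNReal.ofReal_ofNat, ENNReal.ofReal_ofNat]
    _ = 4 ^ n * (2⁻¹ ^ n) ^ i * ENNReal.ofReal (scale 2 (m + 1 - i + 1)) ^ n := by
        rw [ENNReal.mul_rpow_of_nonneg _ _ hn.le, ENNReal.mul_rpow_of_nonneg _ _ hn.le,
          ← ENNReal.rpow_natCast, ← ENNReal.rpow_natCast, ← ENNReal.rpow_mul, ← ENNReal.rpow_mul,
          mul_comm n]

lemma exists_tsum_scaleWeight_le (hn : 0 < n) : ∃ K : ℝ≥0, ∀ d : ℝ, 0 < d →
    ∑' k : ℤ, (if d < scale 2 (k - 1) then scaleWeight n k else 0) ≤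
      K * (ENNReal.ofReal d ^ n)⁻¹ := by
  have hσ : (2⁻¹ : ℝ≥0∞) ^ n < 1 := ENNReal.rpow_lt_one (by simp) hn
  have hKt : (4 : ℝ≥0∞) ^ n * ∑' i : ℕ, ((2⁻¹ : ℝ≥0∞) ^ n) ^ i ≠ ∞ :=
    ENNReal.mul_ne_top (ENNReal.rpow_ne_top_of_nonneg hn.le ENNReal.ofNat_ne_top)
      (tsum_geometric_ne_top hσ)
  refine ⟨(4 ^ n * ∑' i : ℕ, ((2⁻¹ : ℝ≥0∞) ^ n) ^ i).toNNReal, fun d hd => ?_⟩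
  obtain ⟨m, hm1, hm2⟩ := exists_scale (le_refl (2 : ℝ)) hd
  have hzero (k : ℤ) (hk : m + 1 < k) :
      (if d < scale 2 (k - 1) then scaleWeight n k else 0) = 0 :=
    if_neg (not_lt.2 ((scale_anti le_rfl (by omega)).trans hm1))
  rw [tsum_int_eq_tsum_nat (m + 1) hzero, ENNReal.coe_toNNReal hKt, ← ENNReal.tsum_mul_left,
    ← ENNReal.tsum_mul_right]
  refine ENNReal.tsum_le_tsum fun i => ?_
  split_ifs
  · exact scaleWeight_sub_le hn hm2 i
  · exact zero_le

end Weights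

lemma enorm_sub_rpow_le_inv_mul_setLIntegral {𝕜 X : Type*} [RCLike 𝕜] [MeasurableSpace X]
    {μ : Measure X} {p : ℝ} {w : X → 𝕜} (hp : 1 ≤ p) (hw : Measurable w) {A : Set X}
    (hA0 : μ A ≠ 0) (hAt : μ A ≠ ∞) (x y : X) :
    ‖w x - w y‖ₑ ^ p ≤ 2 ^ (p - 1) * ((μ A)⁻¹ * ∫⁻ z in A, ‖w x - w z‖ₑ ^ p ∂μ +
      (μ A)⁻¹ * ∫⁻ z in A, ‖w y - w z‖ₑ ^ p ∂μ) := by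
  have hCt : (2 : ℝ≥0∞) ^ (p - 1) ≠ ∞ :=
    ENNReal.rpow_ne_top_of_nonneg (by linarith) ENNReal.ofNat_ne_top
  have hm : Measurable fun z => ‖w x - w z‖ₑ ^ p :=
    (measurable_enorm_sub_rpow hw p).comp measurable_prodMk_left
  calc ‖w x - w y‖ₑ ^ p = (μ A)⁻¹ * ∫⁻ _ in A, ‖w x - w y‖ₑ ^ p ∂μ := by
        rw [setLIntegral_const, mul_left_comm, ENNReal.inv_mul_cancel hA0 hAt, mul_one]
    _ ≤ (μ A)⁻¹ * ∫⁻ z in A, 2 ^ (p - 1) * (‖w x - w z‖ₑ ^ p + ‖w y - w z‖ₑ ^ p) ∂μ := by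
        gcongr with z
        exact enorm_sub_rpow_le hp _ _ _
    _ = _ := by
        rw [lintegral_const_mul' _ _ hCt, lintegral_add_left hm]
        ring

variable {𝕜 X : Type*} [RCLike 𝕜] [MetricSpace X] [MeasurableSpace X]
  {μ : Measure X} {n s p : ℝ} {K : ℝ≥0} {u w : X → 𝕜}

/-- The average of `|w x - w z| ^ p` over the ball `B(x, 2 ^ (1 - k))`. -/
def oscAverage (μ : Measure X) (p : ℝ) (w : X → 𝕜) (k : ℤ) (x : X) : ℝ≥0∞ :=
  (μ (sball 2 (k - 1) x))⁻¹ * ∫⁻ z in sball 2 (k - 1) x, ‖w x - w z‖ₑ ^ p ∂μ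

lemma measurable_oscAverage [BorelSpace X] [SecondCountableTopology X] [SFinite μ]
    (hw : Measurable w) (k : ℤ) : Measurable (oscAverage μ p w k) :=
  (measurable_measure_ball μ _).inv.mul
    (measurable_setLIntegral_ball μ measurable_id (measurable_enorm_sub_rpow hw p) _)

lemma tsum_scaleWeight_mul_oscAverage_eq [OpensMeasurableSpace X] (hw : Measurable w) (x : X) :
    ∑' k : ℤ, scaleWeight n k * oscAverage μ p w k x =
      ∫⁻ z, ∑' k : ℤ, scaleWeight n k * (μ (sball 2 (k - 1) x))⁻¹ *
        (sball 2 (k - 1) x).indicator (fun z => ‖w x - w z‖ₑ ^ p) z ∂μ := by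
  have hm : Measurable fun z => ‖w x - w z‖ₑ ^ p :=
    (measurable_enorm_sub_rpow hw p).comp measurable_prodMk_left
  rw [lintegral_tsum fun k => ((hm.indicator measurableSet_ball).const_mul _).aemeasurable]
  congr with k
  rw [lintegral_const_mul _ (hm.indicator measurableSet_ball),
    lintegral_indicator measurableSet_ball, oscAverage, mul_assoc]

namespace HasBallGrowth

lemma inv_mul_setLIntegral_le_oscAverage (h : HasBallGrowth μ n K) {x y : X} {k : ℤ}
    (hxy : dist x y < scale 2 k) :
    (μ (sball 2 k x))⁻¹ * ∫⁻ z in sball 2 k x, ‖w y - w z‖ₑ ^ p ∂μ ≤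
      K ^ 2 * oscAverage μ p w k y := by
  have hr := scale_pos (le_refl (2 : ℝ)) k
  have hr2 : scale 2 (k - 1) = 2 * scale 2 k := scale_sub_one le_rfl k
  have hinv : (μ (sball 2 k x))⁻¹ ≤ K ^ 2 * (μ (sball 2 (k - 1) y))⁻¹ := by
    calc (μ (sball 2 k x))⁻¹ ≤ K * (μ (Metric.ball x (2 * scale 2 k)))⁻¹ :=
          h.inv_le_of_ball_subset hr subset_rfl
      _ ≤ K * (K * (μ (sball 2 (k - 1) y))⁻¹) := by
          gcongr
          refine h.inv_le_of_ball_subset (by positivity) (Metric.ball_subset_ball' ?_)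
          rw [hr2, dist_comm]
          linarith
      _ = K ^ 2 * (μ (sball 2 (k - 1) y))⁻¹ := by ring
  rw [oscAverage, ← mul_assoc]
  gcongr
  exact sball_subset_of_dist le_rfl hxy

lemma enorm_sub_rpow_le_oscAverage (h : HasBallGrowth μ n K) (hp : 1 ≤ p) (hw : Measurable w)
    {x y : X} {k : ℤ} (hxy : dist x y < scale 2 k) :
    ‖w x - w y‖ₑ ^ p ≤ 2 ^ (p - 1) * K ^ 2 * (oscAverage μ p w k x + oscAverage μ p w k y) := by
  have hr := scale_pos (le_refl (2 : ℝ)) k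
  rw [mul_assoc, mul_add]
  refine (enorm_sub_rpow_le_inv_mul_setLIntegral hp hw (h.ball_pos x _ hr).ne'
    (h.ball_lt_top x _ hr).ne x y).trans (mul_le_mul_right (add_le_add ?_ ?_) _)
  · exact h.inv_mul_setLIntegral_le_oscAverage ((dist_self x).trans_lt hr)
  · exact h.inv_mul_setLIntegral_le_oscAverage hxy

lemma isFracHajlaszGradient_oscAverage [BorelSpace X] [SecondCountableTopology X] [SFinite μ]
    (h : HasBallGrowth μ n K) (hn : 0 < n) (hp : 1 ≤ p) (hsp : s * p = n) (hw : Measurable w)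
    (huw : u =ᵐ[μ] w) :
    IsFracHajlaszGradient μ s u fun k x =>
      (2 ^ (p - 1) * K ^ 2 * (scaleWeight n k * oscAverage μ p w k x)) ^ (1 / p) := by
  have hp0 : 0 < p := by linarith
  have hp1 : 0 ≤ 1 / p := by positivity
  refine ⟨fun k => ((((measurable_oscAverage hw k).const_mul _).const_mul _).pow_const
    _).aemeasurable, {x | u x ≠ w x}, huw, fun k x y hx hy hk1 hk2 => ?_⟩
  rw [mem_ofPred_eq, not_not] at hx hy
  set G : X → ℝ≥0∞ := fun x => 2 ^ (p - 1) * K ^ 2 * (scaleWeight n k * oscAverage μ p w k x)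
    with hG
  have hscale : scale 2 (k + 1) ≤ dist x y := by
    rwa [scale, neg_add, ← sub_eq_add_neg]
  have hpow : ‖w x - w y‖ₑ ^ p ≤ edist x y ^ n * (G x + G y) := by
    calc ‖w x - w y‖ₑ ^ p
        ≤ 1 * (2 ^ (p - 1) * K ^ 2 * (oscAverage μ p w k x + oscAverage μ p w k y)) := by
          rw [one_mul]
          exact h.enorm_sub_rpow_le_oscAverage hp hw hk2
      _ ≤ edist x y ^ n * scaleWeight n k *
          (2 ^ (p - 1) * K ^ 2 * (oscAverage μ p w k x + oscAverage μ p w k y)) := by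
          gcongr
          exact one_le_edist_rpow_mul_scaleWeight hn hscale
      _ = edist x y ^ n * (G x + G y) := by
          simp only [hG]
          ring
  calc ‖u x - u y‖ₑ = (‖w x - w y‖ₑ ^ p) ^ (1 / p) := by
        rw [← ENNReal.rpow_mul, mul_one_div_cancel hp0.ne', ENNReal.rpow_one, hx, hy]
    _ ≤ (edist x y ^ n * (G x + G y)) ^ (1 / p) := by gcongr
    _ = edist x y ^ s * (G x + G y) ^ (1 / p) := by
        rw [ENNReal.mul_rpow_of_nonneg _ _ hp1, ← ENNReal.rpow_mul, ← hsp,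
          mul_assoc, mul_one_div_cancel hp0.ne', mul_one]
    _ ≤ edist x y ^ s * (G x ^ (1 / p) + G y ^ (1 / p)) := by
        gcongr
        exact ENNReal.rpow_add_le_add_rpow _ _ hp1 ((div_le_one hp0).2 hp)

lemma hajlaszNorm_le_oscAverage [BorelSpace X] [SecondCountableTopology X] [SFinite μ]
    (h : HasBallGrowth μ n K) (hn : 0 < n) (hp : 1 ≤ p) (hsp : s * p = n) (hw : Measurable w)
    (huw : u =ᵐ[μ] w) :
    hajlaszNorm μ s p (ENNReal.ofReal p) u ≤ (2 ^ (p - 1) * K ^ 2 *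
      ∫⁻ x, ∑' k : ℤ, scaleWeight n k * oscAverage μ p w k x ∂μ) ^ (1 / p) := by
  have hp0 : 0 < p := by linarith
  have hC : (2 : ℝ≥0∞) ^ (p - 1) * K ^ 2 ≠ ∞ :=
    ENNReal.mul_ne_top (ENNReal.rpow_ne_top_of_nonneg (by linarith) ENNReal.ofNat_ne_top)
      (ENNReal.pow_ne_top ENNReal.coe_ne_top)
  refine (iInf₂_le _ (h.isFracHajlaszGradient_oscAverage hn hp hsp hw huw)).trans_eq ?_
  rw [LpLqNorm_ofReal μ hp0, ← lintegral_const_mul' _ _ hC]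
  congr 2 with x
  simp only [← ENNReal.tsum_mul_left, ← ENNReal.rpow_mul, one_div_mul_cancel hp0.ne',
    ENNReal.rpow_one]

lemma tsum_scaleWeight_mul_indicator_le (h : HasBallGrowth μ n K) {C : ℝ≥0}
    (hC : ∀ d : ℝ, 0 < d → ∑' k : ℤ, (if d < scale 2 (k - 1) then scaleWeight n k else 0) ≤
      C * (ENNReal.ofReal d ^ n)⁻¹) {F : X → ℝ≥0∞} {x : X} (hF : F x = 0) (z : X) :
    ∑' k : ℤ, scaleWeight n k * (μ (sball 2 (k - 1) x))⁻¹ * (sball 2 (k - 1) x).indicator F z ≤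
      C * K * ((μ (Metric.ball x (dist x z)))⁻¹ ^ 2 * F z) := by
  rcases eq_or_ne x z with rfl | hxz
  · simp [indicator, hF]
  have hterm (k : ℤ) :
      scaleWeight n k * (μ (sball 2 (k - 1) x))⁻¹ * (sball 2 (k - 1) x).indicator F z ≤
        (if dist x z < scale 2 (k - 1) then scaleWeight n k else 0) *
          ((μ (Metric.ball x (dist x z)))⁻¹ * F z) := by
    split_ifs with hk
    · rw [indicator_of_mem (by rwa [Metric.mem_ball, dist_comm]), mul_assoc]
      gcongr
      exact Metric.ball_subset_ball hk.le
    · rw [indicator_of_notMem (by rwa [Metric.mem_ball, dist_comm]), mul_zero, zero_mul]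
  calc _ ≤ ∑' k : ℤ, (if dist x z < scale 2 (k - 1) then scaleWeight n k else 0) *
          ((μ (Metric.ball x (dist x z)))⁻¹ * F z) := ENNReal.tsum_le_tsum hterm
    _ ≤ C * (edist x z ^ n)⁻¹ * ((μ (Metric.ball x (dist x z)))⁻¹ * F z) := by
        rw [ENNReal.tsum_mul_right, edist_dist]
        gcongr
        exact hC _ (dist_pos.2 hxz)
    _ ≤ C * (K * (μ (Metric.ball x (dist x z)))⁻¹) *
        ((μ (Metric.ball x (dist x z)))⁻¹ * F z) := by
        gcongr
        exact h.inv_edist_rpow_le hxz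
    _ = C * K * ((μ (Metric.ball x (dist x z)))⁻¹ ^ 2 * F z) := by ring

lemma exists_lintegral_tsum_oscAverage_le [OpensMeasurableSpace X] (h : HasBallGrowth μ n K)
    (hn : 0 < n) (hp : 0 < p) : ∃ C : ℝ≥0, ∀ w : X → 𝕜, Measurable w →
      ∫⁻ x, ∑' k : ℤ, scaleWeight n k * oscAverage μ p w k x ∂μ ≤ C * energy μ p w := by
  obtain ⟨C, hC⟩ := exists_tsum_scaleWeight_le hn
  refine ⟨C * K, fun w hw => ?_⟩
  simp only [tsum_scaleWeight_mul_oscAverage_eq hw]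
  refine lintegral_lintegral_le_of_le_const_mul _ fun x z => ?_
  push_cast
  exact h.tsum_scaleWeight_mul_indicator_le hC (by simp [hp]) z

lemma exists_hajlaszNorm_le [BorelSpace X] [SecondCountableTopology X] [SFinite μ]
    (h : HasBallGrowth μ n K) (hn : 0 < n) (hp : 1 ≤ p) (hsp : s * p = n) :
    ∃ C : ℝ≥0, ∀ u : X → 𝕜, AEMeasurable u μ →
      hajlaszNorm μ s p (ENNReal.ofReal p) u ≤ C * energy μ p u ^ (1 / p) := by
  have hp0 : 0 < p := by linarith
  obtain ⟨C, hC⟩ := h.exists_lintegral_tsum_oscAverage_le (𝕜 := 𝕜) hn hp0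
  refine ⟨(2 ^ (p - 1) * K ^ 2 * C) ^ (1 / p), fun u hu => ?_⟩
  refine (h.hajlaszNorm_le_oscAverage hn hp hsp hu.measurable_mk hu.ae_eq_mk).trans
    ((ENNReal.rpow_le_rpow ?_ (by positivity)).trans (rpow_one_div_le_of_le_mul hp0 le_rfl))
  rw [energy_congr p hu.ae_eq_mk]
  push_cast [ENNReal.coe_rpow_of_nonneg _ (sub_nonneg.2 hp)]
  rw [mul_assoc _ (C : ℝ≥0∞)]
  gcongr
  exact hC _ hu.measurable_mk

lemma exists_le_hajlaszNorm [BorelSpace X] [SecondCountableTopology X] [SFinite μ]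
    (h : HasBallGrowth μ n K) (hp : 1 ≤ p) (hsp : s * p = n) :
    ∃ C : ℝ≥0, ∀ u : X → 𝕜,
      energy μ p u ^ (1 / p) ≤ C * hajlaszNorm μ s p (ENNReal.ofReal p) u := by
  have hp0 : 0 < p := by linarith
  have hK0 : 0 < K := zero_lt_one.trans_le h.one_le
  set C : ℝ≥0 := (K ^ 2 * 2 ^ (p - 1) * (1 + K)) ^ (1 / p)
  have hC0 : (C : ℝ≥0∞) ≠ 0 := by
    have : 0 < C := by positivity
    exact_mod_cast this.ne'
  refine ⟨C, fun u => ?_⟩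
  rw [← ENNReal.div_le_iff' hC0 ENNReal.coe_ne_top]
  refine le_iInf₂ fun g hg => ENNReal.div_le_of_le_mul' ?_
  rw [LpLqNorm_ofReal μ hp0]
  refine rpow_one_div_le_of_le_mul hp0 ?_
  push_cast [ENNReal.coe_rpow_of_nonneg _ (sub_nonneg.2 hp)]
  exact h.energy_le_of_gradient hp hsp hg

theorem isEnergySpace_hajlaszSpace [BorelSpace X] (h : HasBallGrowth μ n K) (hn : 0 < n)
    (hp : 1 ≤ p) (hsp : s * p = n) :
    IsEnergySpace μ p (hajlaszSpace 𝕜 μ s p (ENNReal.ofReal p))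
      (hajlaszNorm μ s p (ENNReal.ofReal p)) := by
  have := secondCountableTopology_of_measure_ball μ h.ball_pos h.ball_lt_top
  have := isLocallyFiniteMeasure_of_measure_ball μ h.ball_lt_top
  obtain ⟨C, hC⟩ := h.exists_hajlaszNorm_le (𝕜 := 𝕜) hn hp hsp
  obtain ⟨C', hC'⟩ := h.exists_le_hajlaszNorm (𝕜 := 𝕜) hp hsp
  refine ⟨fun u => and_congr_right fun hu => ?_, ⟨C, hC⟩, ⟨C', fun u _ => hC' u⟩⟩
  exact (energy_ne_top_iff_of_le (zero_lt_one.trans_le hp) (hC u hu) (hC' u)).symm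

end HasBallGrowth

end GradientConstruction

section Subsingleton

lemma eq_const_of_subsingleton {X β : Type*} [Subsingleton X] (u : X → β) (x : X) :
    u = fun _ => u x :=
  funext fun y => congrArg u (Subsingleton.elim y x)

variable {𝕜 X Y : Type*} [RCLike 𝕜] [MetricSpace X] [MeasurableSpace X]
  [MetricSpace Y] [MeasurableSpace Y] [Subsingleton X] {μX : Measure X}
  {μY : Measure Y} {n n₁ n₂ s p : ℝ}

lemma besovNorm_of_subsingleton (hp : 0 < p) (u : X → 𝕜) : besovNorm μX s p u = 0 := by
  have hzero (x y : X) :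
      ‖u x - u y‖ₑ ^ p / (edist x y ^ (s * p) * μX (Metric.ball x (dist x y))) = 0 := by
    rw [Subsingleton.elim x y]
    simp [hp]
  simp [besovNorm, hzero, hp]

lemma hajlaszNorm_of_subsingleton (hp : 0 < p) (u : X → 𝕜) :
    hajlaszNorm μX s p (ENNReal.ofReal p) u = 0 := by
  have hg : IsFracHajlaszGradient μX s u fun _ _ => 0 := by
    refine ⟨fun _ => aemeasurable_const, ∅, measure_empty, fun k x y _ _ _ _ => ?_⟩
    rw [Subsingleton.elim x y]
    simp
  refine le_antisymm ((iInf₂_le _ hg).trans_eq ?_) zero_le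
  rw [LpLqNorm_ofReal μX hp]
  simp [hp]

lemma hajlaszSpace_of_subsingleton (hp : 0 < p) :
    hajlaszSpace 𝕜 μX s p (ENNReal.ofReal p) = univ := by
  refine eq_univ_of_forall fun u => ⟨Subsingleton.measurable.aemeasurable, ?_⟩
  rw [hajlaszNorm_of_subsingleton hp]
  exact ENNReal.zero_lt_top

namespace IsAhlforsRegular

lemma averagesTendTo_of_subsingleton (h : IsAhlforsRegular μX n) (u : X → 𝕜) (x : X) :
    AveragesTendTo μX u x (u x) := by
  refine tendsto_const_nhds.congr' ?_
  filter_upwards [self_mem_nhdsWithin] with r hr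
  rw [eq_const_of_subsingleton u x]
  exact (setAverage_const (h.ball_pos x r hr).ne' (h.ball_lt_top x r hr).ne _).symm

lemma preciseRep_of_subsingleton (h : IsAhlforsRegular μX n) (u : X → 𝕜) :
    preciseRep μX u = u :=
  funext fun x => (h.averagesTendTo_of_subsingleton u x).preciseRep_eq

lemma divergenceSet_of_subsingleton (h : IsAhlforsRegular μX n) (u : X → 𝕜) :
    divergenceSet μX u = ∅ :=
  eq_empty_of_forall_notMem fun x hx => hx ⟨_, h.averagesTendTo_of_subsingleton u x⟩

lemma besovSpace_of_subsingleton (h : IsAhlforsRegular μX n) (hp : 0 < p) :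
    besovSpace 𝕜 μX s p = univ := by
  refine eq_univ_of_forall fun u => ⟨fun x r => ?_, ?_⟩
  · have := isFiniteMeasure_restrict_ball h.ball_lt_top x r
    rw [eq_const_of_subsingleton u x]
    exact memLp_const _
  · rw [besovNorm_of_subsingleton hp]
    exact ENNReal.zero_lt_top

lemma pullbackBounded_of_subsingleton (hX : IsAhlforsRegular μX n) (μY : Measure Y) (f : Y ≃ₜ X)
    {NY : (Y → 𝕜) → ℝ≥0∞} (hNY : ∀ u, NY u = 0) (FX : Set (X → 𝕜)) (NX : (X → 𝕜) → ℝ≥0∞) :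
    PullbackBounded μY μX f univ NY FX NX := by
  refine ⟨0, fun u _ => ?_⟩
  rw [hX.divergenceSet_of_subsingleton, hX.preciseRep_of_subsingleton]
  refine ⟨fun x r => ?_, dimH_empty, by simp, ae_eq_rfl, mem_univ _, by simp [hNY]⟩
  have := isFiniteMeasure_restrict_ball hX.ball_lt_top x r
  rw [eq_const_of_subsingleton u x]
  exact integrable_const _

lemma inducesEquivalence_of_subsingleton [Subsingleton Y] (hX : IsAhlforsRegular μX n₁)
    (hY : IsAhlforsRegular μY n₂) (f : X ≃ₜ Y) {NX : (X → 𝕜) → ℝ≥0∞} (hNX : ∀ u, NX u = 0)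
    {NY : (Y → 𝕜) → ℝ≥0∞} (hNY : ∀ u, NY u = 0) :
    InducesEquivalence μX μY f univ NX univ NY := by
  refine ⟨hY.pullbackBounded_of_subsingleton μX f hNX _ _,
    hX.pullbackBounded_of_subsingleton μY f.symm hNY _ _, fun u _ => ?_, fun v _ => ?_⟩
  · rw [hX.preciseRep_of_subsingleton, hY.preciseRep_of_subsingleton, Function.comp_assoc,
      f.self_comp_symm, Function.comp_id]
  · rw [hX.preciseRep_of_subsingleton, hY.preciseRep_of_subsingleton, Function.comp_assoc,
      f.symm_comp_self, Function.comp_id]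

end IsAhlforsRegular

end Subsingleton

lemma IsAhlforsRegular.inducesEquivalence {𝕜 X Y : Type*} [RCLike 𝕜] [MetricSpace X]
    [MeasurableSpace X] [BorelSpace X] [Nontrivial X] [MetricSpace Y] [MeasurableSpace Y]
    [BorelSpace Y] {μX : Measure X} {μY : Measure Y} {n₁ n₂ p : ℝ} {f : X ≃ₜ Y}
    (hX : IsAhlforsRegular μX n₁) (hY : IsAhlforsRegular μY n₂) (hn₁ : 0 < n₁) (hn₂ : 0 < n₂)
    (hf : IsQuasisymmetric f) (hp : 1 ≤ p)
    {FX : Set (X → 𝕜)} {NX : (X → 𝕜) → ℝ≥0∞} (hFX : IsEnergySpace μX p FX NX)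
    {FY : Set (Y → 𝕜)} {NY : (Y → 𝕜) → ℝ≥0∞} (hFY : IsEnergySpace μY p FY NY) :
    InducesEquivalence μX μY f FX NX FY NY := by
  have : Nontrivial Y := f.injective.nontrivial
  obtain ⟨κX, hκX⟩ := hX.exists_isUniformlyPerfect hn₁
  obtain ⟨κY, hκY⟩ := hY.exists_isUniformlyPerfect hn₂
  obtain ⟨η, hη⟩ := hf.exists_hasControlledDistortion
  obtain ⟨η', hη'⟩ := hf.exists_hasControlledDistortion_symm
  obtain ⟨q, D, θ, h⟩ :=
    hη.exists_pullbackRegular hη' hκX hκY (hX.isDoubling hn₁) (hY.isDoubling hn₂)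
  obtain ⟨q', D', θ', h'⟩ :=
    hη'.exists_pullbackRegular hη hκY hκX (hY.isDoubling hn₂) (hX.isDoubling hn₁)
  exact h.inducesEquivalence h' hp hFX hFY

end

end HajlaszBesov

theorem theorem5p1_general {𝕜 X Y : Type*} [RCLike 𝕜]
    [MetricSpace X] [MeasurableSpace X] [BorelSpace X]
    [MetricSpace Y] [MeasurableSpace Y] [BorelSpace Y]
    (μX : Measure X) (μY : Measure Y) (n₁ n₂ : ℝ)
    (hX : IsAhlforsRegular μX n₁) (hY : IsAhlforsRegular μY n₂)
    (f : X ≃ₜ Y) (hf : IsQuasisymmetric f)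
    (s₁ s₂ : ℝ) (hs₁ : s₁ ∈ Set.Ioc 0 n₁) (hs₂ : s₂ ∈ Set.Ioc 0 n₂)
    (hs : n₁ / s₁ = n₂ / s₂) :
    InducesEquivalence μX μY f
      (hajlaszSpace 𝕜 μX s₁ (n₁ / s₁) (ENNReal.ofReal (n₁ / s₁)))
      (hajlaszNorm μX s₁ (n₁ / s₁) (ENNReal.ofReal (n₁ / s₁)))
      (hajlaszSpace 𝕜 μY s₂ (n₂ / s₂) (ENNReal.ofReal (n₂ / s₂)))
      (hajlaszNorm μY s₂ (n₂ / s₂) (ENNReal.ofReal (n₂ / s₂))) ∧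
    InducesEquivalence μX μY f
      (besovSpace 𝕜 μX s₁ (n₁ / s₁)) (besovNorm μX s₁ (n₁ / s₁))
      (besovSpace 𝕜 μY s₂ (n₂ / s₂)) (besovNorm μY s₂ (n₂ / s₂)) := by
  have hsp₁ : s₁ * (n₁ / s₁) = n₁ := mul_div_cancel₀ n₁ hs₁.1.ne'
  have hsp₂ : s₂ * (n₁ / s₁) = n₂ := by rw [hs, mul_div_cancel₀ n₂ hs₂.1.ne']
  have hp : 1 ≤ n₁ / s₁ := (one_le_div hs₁.1).2 hs₁.2
  rw [← hs]
  generalize n₁ / s₁ = p at hsp₁ hsp₂ hp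
  have hp₀ : 0 < p := one_pos.trans_le hp
  have hn₁ : 0 < n₁ := hs₁.1.trans_le hs₁.2
  have hn₂ : 0 < n₂ := hs₂.1.trans_le hs₂.2
  rcases subsingleton_or_nontrivial X with hsub | hnon
  · have : Subsingleton Y := f.symm.injective.subsingleton
    simp only [hajlaszSpace_of_subsingleton hp₀, hX.besovSpace_of_subsingleton hp₀,
      hY.besovSpace_of_subsingleton hp₀]
    exact ⟨hX.inducesEquivalence_of_subsingleton hY f (hajlaszNorm_of_subsingleton hp₀)
        (hajlaszNorm_of_subsingleton hp₀),
      hX.inducesEquivalence_of_subsingleton hY f (besovNorm_of_subsingleton hp₀)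
        (besovNorm_of_subsingleton hp₀)⟩
  · have : Nontrivial Y := f.injective.nontrivial
    obtain ⟨K₁, hK₁⟩ := hX.exists_hasBallGrowth hn₁
    obtain ⟨K₂, hK₂⟩ := hY.exists_hasBallGrowth hn₂
    exact ⟨hX.inducesEquivalence hY hn₁ hn₂ hf hp
        (hK₁.isEnergySpace_hajlaszSpace hn₁ hp hsp₁) (hK₂.isEnergySpace_hajlaszSpace hn₂ hp hsp₂),
      hX.inducesEquivalence hY hn₁ hn₂ hf hp
        (hK₁.isEnergySpace_besovSpace hp₀ hsp₁) (hK₂.isEnergySpace_besovSpace hp₀ hsp₂)⟩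

theorem theorem5p1 {𝕜 X Y : Type*} [RCLike 𝕜]
    [MetricSpace X] [MeasurableSpace X] [BorelSpace X]
    [MetricSpace Y] [MeasurableSpace Y] [BorelSpace Y]
    (μX : Measure X) (μY : Measure Y) (n₁ n₂ : ℝ) (hn₁ : 0 < n₁) (hn₂ : 0 < n₂)
    (hX : IsAhlforsRegular μX n₁) (hY : IsAhlforsRegular μY n₂)
    (f : X ≃ₜ Y) (hf : IsQuasisymmetric f)
    (s₁ s₂ : ℝ) (hs₁ : s₁ ∈ Set.Ioo 0 n₁) (hs₂ : s₂ ∈ Set.Ioo 0 n₂)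
    (hs : n₁ / s₁ = n₂ / s₂) :
    InducesEquivalence μX μY f
      (hajlaszSpace 𝕜 μX s₁ (n₁ / s₁) (ENNReal.ofReal (n₁ / s₁)))
      (hajlaszNorm μX s₁ (n₁ / s₁) (ENNReal.ofReal (n₁ / s₁)))
      (hajlaszSpace 𝕜 μY s₂ (n₂ / s₂) (ENNReal.ofReal (n₂ / s₂)))
      (hajlaszNorm μY s₂ (n₂ / s₂) (ENNReal.ofReal (n₂ / s₂))) ∧
    InducesEquivalence μX μY f
      (besovSpace 𝕜 μX s₁ (n₁ / s₁)) (besovNorm μX s₁ (n₁ / s₁))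
      (besovSpace 𝕜 μY s₂ (n₂ / s₂)) (besovNorm μY s₂ (n₂ / s₂)) :=
  theorem5p1_general μX μY n₁ n₂ hX hY f hf s₁ s₂ (Set.Ioo_subset_Ioc_self hs₁)
    (Set.Ioo_subset_Ioc_self hs₂) hs
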